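/- **Theorem 2.3 (Goldston–Yıldırım for function fields).** Let $\mathbf F_q$ be a finite field with $q$ elements, let $k\ge 1$ be an integer and $K=q^k$. *Notation.* $\mathbf G_N$ is the set of polynomials in $\mathbf F_q[t]$ of degree $<N$ (including $0$); $|f|=q^{\deg f}$ for $f\neq 0$; $\mathcal P$ is the set of all irreducible polynomials in $\mathbf F_q[t]$. For $\mathcal A\subset\mathcal P$ the relative upper density is $\overline d_{\mathcal P}(\mathcal A)=\limsup_{N\to\infty}\#\{f\in\mathcal A:\deg f<N\}/\#\{f\in\mathcal P:\deg f<N\}$. For each $N\ge 1$ a monic irreducible polynomial $f_N$ of degree $N$ is fixed, and $\mathbf F_{q^N}$ denotes $\mathbf G_N$ with addition and multiplication modulo $f_N$. $\mathbb E$ denotes the average over a finite set. *Pseudorandom measures.* A measure is a family $\nu=(\nu_N)_{N\ge1}$ of functions $\nu_N:\mathbf F_{q^N}\to[0,\infty)$. It is ($k$-)pseudorandom if the following two conditions hold. (a) (Linear forms.) For $m\le K2^{K-1}$ affine forms $\psi_i(\mathbf x)=\sum_{j=1}^n L_{ij}x_j+b_i$ in $n\le 3K-4$ variables, where each $L_{ij}$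 is a quotient $a/g$ with $a,g\in\mathbf G_k$, $g\ne0$ (read in $\mathbf F_{q^N}$ for $N\ge k$), the vectors $(L_{ij})_j$ are nonzero and pairwise not proportional over $\mathbf F_q(t)$, and $b_i\in\mathbf F_{q^N}$ is arbitrary, $$\mathbb E\big(\nu_N(\psi_1(\mathbf x))\cdots\nu_N(\psi_m(\mathbf x))\,\big|\,\mathbf x\in\mathbf F_{q^N}^n\big)=1+o(1)\qquad(N\to\infty),$$ uniformly in all these data. (b) (Correlation.) There are functions $\tau_N:\mathbf F_{q^N}\to[0,\infty)$ such that for every real $p>1$ the averages $\mathbb E(\tau_N(x)^p\mid x\in\mathbf F_{q^N})$ are bounded uniformly in $N$, and such that for all $N\ge 1$, all $2\le l\le 2^{K-1}$ and all (not necessarily distinct) $h_1,\dots,h_l\in\mathbf F_{q^N}$ $$\mathbb E\big(\nu_N(x+h_1)\cdots\nu_N(x+h_l)\,\big|\,x\in\mathbf F_{q^N}\big)\le\sum_{1\le i<j\le l}\tau_N(h_i-h_j).$$ *Truncated divisor sums.* For $\chi:\mathbf R\to\mathbf R$ and $R>0$ put $\Lambda_R(f)=\sum \mu(d)\,\chi(\deg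 d/R)$, where the sum is over the monic divisors $d$ of $f$ with $\deg d<R$ and $\mu$ is the Möbius function of $\mathbf F_q[t]$. $\Phi(W)$ is the number of polynomials of degree $<\deg W$ that are coprime to $W$. *Statement.* There are a real $\alpha>0$, a smooth $\chi:\mathbf R\to\mathbf R$ supported on $[-1,1]$ with $\chi(0)>0$ and $\int_0^\infty\chi'(x)^2\,dx=1$, and a constant $C$, all depending only on $q$ and $k$, such that for every $\varepsilon>0$ there is $\delta>0$ with the following property. For every choice of the polynomials $f_N$ and every $\mathcal A\subset\mathcal P$ with $\overline d_{\mathcal P}(\mathcal A)\ge\varepsilon$ there exist a function $w:\{1,2,\dots\}\to\{0,1,2,\dots\}$ with $w(N)\to\infty$ and polynomials $W_N,b_N$ such that, for all $N\ge1$, $$W_N=\prod_{\substack{P\text{ monic irreducible}\\ \deg P<w(N)}}P\in\mathbf G_N,\qquad \deg b_N<\deg W_N,\qquad \gcd(b_N,W_N)=1$$ (with $\deg 0=-\infty$), such that the family $$\nu_N(h)=R\,\frac{\Phi(W_N)}{|W_N|}\,\Lambda_R(W_Nh+b_N)^2\quad(h\in\mathbf G_N),\qquad R=\alpha N,$$ is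 a pseudorandom measure, and such that for infinitely many $N$ there is a function $\phi:\mathbf F_{q^N}\to\mathbf R$ with 1. $\phi(h)=0$ for every $h\in\mathbf G_N$ with $W_Nh+b_N\notin\mathcal A$ (computed in $\mathbf F_q[t]$); 2. $0\le\phi\le\nu_N$; 3. $\mathbb E(\phi\mid\mathbf F_{q^N})\ge\delta$; 4. $\|\phi\|_\infty\le CN$. -/

import Mathlib

open Polynomial Filter
open scoped BigOperators Topology ContDiff

namespace FunctionFieldGT

/-- The finite set of all polynomials of degree less than `N` over a finite field `F`
(the zero polynomial included). -/
noncomputable def polysLT (F : Type*) [Field F] [Fintype F] (N : ℕ) : Finset F[X] :=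
  open scoped Classical in
  Finset.univ.image fun c : Fin N → F => ((degreeLTEquiv F N).symm c : F[X])

theorem mem_polysLT {F : Type*} [Field F] [Fintype F] {N : ℕ} {p : F[X]} :
    p ∈ polysLT F N ↔ p.degree < N := by
  classical
  rw [← mem_degreeLT]
  constructor
  · intro h
    obtain ⟨c, -, rfl⟩ := Finset.mem_image.1 h
    exact ((degreeLTEquiv F N).symm c).2
  · intro h
    exact Finset.mem_image.2 ⟨degreeLTEquiv F N ⟨p, h⟩, Finset.mem_univ _, by simp⟩

/-- The set of all irreducible polynomials (monic or not). -/
def irreducibles (F : Type*) [Field F] : Set F[X] := {p | Irreducible p}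

/-- The relative upper density of `A` in the set of all irreducible polynomials:
`limsup_N #{f ∈ A : deg f < N} / #{f irreducible : deg f < N}`. -/
noncomputable def relUpperDensity {F : Type*} [Field F] (A : Set F[X]) : ℝ :=
  limsup (fun N : ℕ => (Set.ncard {f ∈ A | f.degree < N} : ℝ) /
    (Set.ncard {f ∈ irreducibles F | f.degree < N} : ℝ)) atTop

/-- A choice, for every `N ≥ 1`, of a monic irreducible polynomial of degree `N`. It makes the
polynomials of degree less than `N` into a field with `q ^ N` elements. -/
structure FieldChoice (F : Type*) [Field F] where
  /-- the chosen polynomials -/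
  f : ℕ+ → F[X]
  monic : ∀ N, (f N).Monic
  irreducible : ∀ N, Irreducible (f N)
  natDegree_eq : ∀ N : ℕ+, (f N).natDegree = N

namespace FieldChoice

variable {F : Type*} [Field F]

/-- The field with `q ^ N` elements: polynomials modulo `f N`. -/
abbrev FqN (M : FieldChoice F) (N : ℕ+) : Type _ := AdjoinRoot (M.f N)

noncomputable instance (M : FieldChoice F) (N : ℕ+) : Field (M.FqN N) :=
  haveI : Fact (Irreducible (M.f N)) := ⟨M.irreducible N⟩
  AdjoinRoot.instField

instance (M : FieldChoice F) [Fintype F] (N : ℕ+) : Finite (M.FqN N) :=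
  haveI := (M.monic N).finite_adjoinRoot
  Module.finite_of_finite F

noncomputable instance (M : FieldChoice F) [Fintype F] (N : ℕ+) : Fintype (M.FqN N) :=
  Fintype.ofFinite _

/-- The polynomial of degree less than `N` that represents an element of the field. -/
noncomputable def rep (M : FieldChoice F) (N : ℕ+) (x : M.FqN N) : F[X] :=
  AdjoinRoot.modByMonicHom (M.monic N) x

/-- The value in the field of a rational function `a / g` (meaningful when `f N` does not divide
the reduced denominator, in particular when `deg g < N`). -/
noncomputable def embed (M : FieldChoice F) (N : ℕ+) (r : RatFunc F) : M.FqN N :=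
  AdjoinRoot.mk (M.f N) r.num / AdjoinRoot.mk (M.f N) r.denom

end FieldChoice

/-- The rational functions `a / g` with `deg a, deg g < k₀`, `g ≠ 0`. -/
def smallRatFunc (F : Type*) [Field F] (k₀ : ℕ) : Set (RatFunc F) :=
  {r | ∃ a g : F[X], a.degree < k₀ ∧ g.degree < k₀ ∧ g ≠ 0 ∧
    r = algebraMap F[X] (RatFunc F) a / algebraMap F[X] (RatFunc F) g}

section Pseudorandom

variable {F : Type*} [Field F] [Fintype F] (M : FieldChoice F)

/-- The `(m₀, n₀, k₀)`-linear forms condition for a family `ν N`: the average of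
`ν(ψ₁(x)) ⋯ ν(ψₘ(x))` over all `x` is `1 + o(1)` as `N → ∞`, uniformly over all systems of `m ≤ m₀`
affine forms `ψᵢ(x) = ∑ⱼ L i j * x j + b i` in `n ≤ n₀` variables whose coefficients `L i j` are
quotients of polynomials of degree less than `k₀`, whose homogeneous parts are nonzero and pairwise
not proportional over the field of rational functions, with arbitrary constant terms `b i`. -/
def LinearFormsCondition (m₀ n₀ k₀ : ℕ) (ν : ∀ N : ℕ+, M.FqN N → ℝ) : Prop :=
  ∀ ε : ℝ, 0 < ε → ∃ N₀ : ℕ+, ∀ N : ℕ+, N₀ ≤ N →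
    ∀ m n : ℕ, m ≤ m₀ → n ≤ n₀ →
    ∀ L : Fin m → Fin n → RatFunc F,
      (∀ i j, L i j ∈ smallRatFunc F k₀) →
      (∀ i, L i ≠ 0) →
      (∀ i i', i ≠ i' → ∀ c : RatFunc F, L i ≠ c • L i') →
    ∀ b : Fin m → M.FqN N,
      |(𝔼 x : Fin n → M.FqN N, ∏ i, ν N (∑ j, M.embed N (L i j) * x j + b i)) - 1| ≤ ε

/-- The `l₀`-correlation condition for a family `ν N`: there are nonnegative weights `τ N` all of
whose `L^p` norms are bounded in `N`, such that the average of `ν(x + h₁) ⋯ ν(x + hₗ)` is at most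
`∑_{i < j} τ(hᵢ - hⱼ)` for all `2 ≤ l ≤ l₀` and all shifts `h`, distinct or not. -/
def CorrelationCondition (l₀ : ℕ) (ν : ∀ N : ℕ+, M.FqN N → ℝ) : Prop :=
  ∃ τ : ∀ N : ℕ+, M.FqN N → ℝ,
    (∀ N x, 0 ≤ τ N x) ∧
    (∀ p : ℝ, 1 < p → ∃ C : ℝ, ∀ N : ℕ+, (𝔼 x : M.FqN N, τ N x ^ p) ≤ C) ∧
    ∀ N : ℕ+, ∀ l : ℕ, 2 ≤ l → l ≤ l₀ → ∀ h : Fin l → M.FqN N,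
      (𝔼 x : M.FqN N, ∏ i, ν N (x + h i)) ≤
        ∑ i : Fin l, ∑ j ∈ Finset.Ioi i, τ N (h i - h j)

/-- `k`-pseudorandom measures, with `K = q ^ k`: families of nonnegative functions satisfying the
`(K * 2 ^ (K - 1), 3 * K - 4, k)`-linear forms condition and the `2 ^ (K - 1)`-correlation
condition. -/
structure IsPseudorandom (k : ℕ) (ν : ∀ N : ℕ+, M.FqN N → ℝ) : Prop where
  nonneg : ∀ N x, 0 ≤ ν N x
  linearForms : LinearFormsCondition M
    (Fintype.card F ^ k * 2 ^ (Fintype.card F ^ k - 1)) (3 * Fintype.card F ^ k - 4) k ν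
  correlation : CorrelationCondition M (2 ^ (Fintype.card F ^ k - 1)) ν

end Pseudorandom

section DivisorSum

variable {F : Type*} [Field F] [Fintype F]

/-- The norm `|f| = q ^ deg f` for `f ≠ 0`, and `|0| = 0`. -/
noncomputable def polyNorm (f : F[X]) : ℝ :=
  open scoped Classical in
  if f = 0 then 0 else (Fintype.card F : ℝ) ^ f.natDegree

/-- Euler's totient: the number of polynomials of degree less than `deg f` coprime to `f`. -/
noncomputable def polyTotient (f : F[X]) : ℕ :=
  Set.ncard {g : F[X] | g.degree < f.degree ∧ IsCoprime g f}

/-- The product of all monic irreducible polynomials of degree less than `w`. -/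
noncomputable def polyPrimorial (F : Type*) [Field F] [Fintype F] (w : ℕ) : F[X] :=
  open scoped Classical in
  ∏ P ∈ (polysLT F w).filter (fun P : F[X] => P.Monic ∧ Irreducible P), P

/-- Admissible smooth cutoffs: smooth, supported on `[-1, 1]`, positive at `0`, and normalized by
`∫_0^∞ χ'(x)^2 dx = 1`. -/
structure IsCutoff (χ : ℝ → ℝ) : Prop where
  smooth : ContDiff ℝ ∞ χ
  support_subset : Function.support χ ⊆ Set.Icc (-1) 1
  pos : 0 < χ 0
  integral_eq : ∫ x in Set.Ioi (0 : ℝ), deriv χ x ^ 2 = 1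

/-- The truncated divisor sum `Λ_R(f) = ∑ μ(d) χ(deg d / R)`, over the monic divisors `d` of `f`
with `deg d < R`. -/
noncomputable def divisorSum (χ : ℝ → ℝ) (R : ℝ) (f : F[X]) : ℝ :=
  open scoped Classical in
  ∑ d ∈ (polysLT F ⌈R⌉₊).filter (fun d => d.Monic ∧ d ∣ f ∧ (d.natDegree : ℝ) < R),
    (UniqueFactorizationMonoid.moebius d : ℝ) * χ (d.natDegree / R)

/-- The normalized square `R * (Φ(W) / |W|) * Λ_R(W h + b) ^ 2`. -/
noncomputable def sieveWeight (χ : ℝ → ℝ) (R : ℝ) (W b h : F[X]) : ℝ :=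
  R * ((polyTotient W : ℝ) / polyNorm W) * divisorSum χ R (W * h + b) ^ 2

end DivisorSum

end FunctionFieldGT

set_option linter.unusedSectionVars false

/-! Everything rests on one asymptotic formula: over a large box of polynomials, products of the
weights `sieveWeight` along affine forms have average close to `1`. Expanding the squared divisor
sums gives a sum over sets of primes placed in `2m` slots, two for each form, weighted by products
of local densities (`expect_prod_divisorSum_sq`). By the Chinese remainder theorem this is exact as
long as the degree of the box is at least `2mR`.

The sum is evaluated without contour integrals. Let the shifts `Z s` act on bounded functions on
`ℕ^(2m)`. The sum is the value at `0` of `(∏_P E_P) f`, where `f n = ∏ χ(n s / R)` and `E_P` is the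
local Euler factor taken at the powers `Z s ^ deg P`. The zeta function of the polynomial ring gives
`∏_P (1 - X ^ deg P / |P|) = 1 - X` modulo `X ^ N` (`X_pow_dvd_prod_primesLT`), and `Z s ^ N` kills
`f`; so the inverse zeta factors act on `f` as difference operators. With `ρ(a, b) = ∑_j Δ(a + j)
Δ(b + j)`, where `Δ` is the forward difference of `χ(· / R)`, and with `F` the tensor power of `ρ`,
one gets `∏ (1 - Z s) f = ∏ (1 - Z (i, false) Z (i, true)) F`. Hence `(∏ E_P) f` is `F` multiplied
by local ratios. For `P` not dividing `W` the ratios are `1` up to a summable second order error.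
For `P ∣ W` they multiply to `(∏ (1 - 1/|P|)) ^ (-m)` modulo the elements `Z s - 1`, and these
shrink `F` by a factor of order `R`. Finally `R * ρ(0, 0)` is a Riemann sum of `∫ χ'² = 1`. The
lemmas are `exists_norm_euler_prod_smul_sub_le` and `exists_abs_sieveSum_sub_le`.

For linear forms, the average over the field is split into averages over translated boxes that
absorb all denominators, so that no reduction modulo `f N` takes place. For correlations, a prime
dividing `h i - h j` costs `1/|P|` instead of `1/|P|²`; the resulting weight `exp(c ∑_{P ∣ h}
1/|P|)` has bounded moments (`exists_expect_exp_invNormSum_le`).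

For density, the pigeonhole principle finds a class `b` modulo `W` rich in elements of `A`. At
irreducible values of degree at least `R` the divisor sum is `χ 0`, so the majorant has order `R`
there and its restriction has mean bounded below. The modulus grows so slowly (`exists_slow_growth`)
that errors depending on `W` vanish, while `N + deg W` still meets the good degrees infinitely
often. -/

namespace FunctionFieldGT

/-! ### Local Euler factors in a commutative Banach algebra -/

section EulerOperators

variable {𝒜 : Type*} [NormedCommRing 𝒜] [NormedAlgebra ℝ 𝒜] {m : ℕ}

/-- A local Euler factor with density `c` on the sets of forms, evaluated at the operators `z`. -/
noncomputable def eulerOp (c : Finset (Fin m) → ℝ) (z : Fin m × Bool → 𝒜) : 𝒜 :=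
  ∑ B : Finset (Fin m × Bool), ((-1) ^ B.card * c (B.image Prod.fst)) • ∏ s ∈ B, z s

/-- The product of the inverse local zeta factors of all slots. -/
noncomputable def numOp (p : ℝ) (z : Fin m × Bool → 𝒜) : 𝒜 := ∏ s, (1 - p • z s)

/-- The product of the inverse local zeta factors of all pairs of slots. -/
noncomputable def denOp (p : ℝ) (z : Fin m × Bool → 𝒜) : 𝒜 :=
  ∏ i, (1 - p • (z (i, false) * z (i, true)))

theorem norm_prod_le_one_of_le [NormOneClass 𝒜] {ι : Type*} (s : Finset ι) (z : ι → 𝒜)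
    (hz : ∀ i ∈ s, ‖z i‖ ≤ 1) : ‖∏ i ∈ s, z i‖ ≤ 1 :=
  (Finset.norm_prod_le s z).trans (Finset.prod_le_one (fun _ _ => norm_nonneg _) hz)

/-- The error is a polynomial in the `x i` with nonnegative coefficients, so it is majorized by its
value with every `x i` replaced by `p`. -/
theorem norm_prod_one_add_sub_le [NormOneClass 𝒜] {ι : Type*} (s : Finset ι) (x : ι → 𝒜) {p : ℝ}
    (hp0 : 0 ≤ p) (hx : ∀ i ∈ s, ‖x i‖ ≤ p) :
    ‖∏ i ∈ s, (1 + x i) - (1 + ∑ i ∈ s, x i)‖ ≤ (1 + p) ^ s.card - (1 + s.card * p) := by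
  classical
  induction s using Finset.induction_on with
  | empty => simp
  | insert a s ha ih =>
    have ih' := ih fun i hi => hx i (Finset.mem_insert_of_mem hi)
    have hxa := hx a (Finset.mem_insert_self a s)
    have hsum : ‖∑ i ∈ s, x i‖ ≤ s.card * p := by
      refine (norm_sum_le _ _).trans ((Finset.sum_le_sum fun i hi =>
        hx i (Finset.mem_insert_of_mem hi)).trans ?_)
      simp
    rw [Finset.prod_insert ha, Finset.sum_insert ha, Finset.card_insert_of_notMem ha]
    have : (1 + x a) * ∏ i ∈ s, (1 + x i) - (1 + (x a + ∑ i ∈ s, x i)) =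
        (1 + x a) * (∏ i ∈ s, (1 + x i) - (1 + ∑ i ∈ s, x i)) + x a * ∑ i ∈ s, x i := by ring
    rw [this]
    have h1 : ‖1 + x a‖ ≤ 1 + p := (norm_add_le _ _).trans (by rw [norm_one]; linarith)
    calc _ ≤ (1 + p) * ((1 + p) ^ s.card - (1 + s.card * p)) + p * (s.card * p) := by
          refine (norm_add_le _ _).trans (add_le_add ?_ ?_)
          · exact (norm_mul_le _ _).trans (mul_le_mul h1 ih' (norm_nonneg _) (by linarith))
          · exact (norm_mul_le _ _).trans (mul_le_mul hxa hsum (norm_nonneg _) hp0)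
      _ = _ := by push_cast; ring

/-- The quotient `((1 + x) ^ n - 1 - n * x) / x ^ 2` is a polynomial with nonnegative coefficients,
hence increasing for `x ≥ 0`. The inequality is this monotonicity with denominators cleared. -/
theorem one_add_pow_sub_le (n : ℕ) {p b : ℝ} (hp0 : 0 ≤ p) (hpb : p ≤ b) :
    ((1 + p) ^ n - (1 + n * p)) * b ^ 2 ≤ ((1 + b) ^ n - (1 + n * b)) * p ^ 2 := by
  induction n with
  | zero => simp
  | succ n ih =>
    have hb0 : 0 ≤ b := hp0.trans hpb
    have hB : 0 ≤ (1 + b) ^ n - (1 + n * b) := by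
      have := one_add_mul_le_pow (a := b) (by linarith) n
      linarith
    have e : ∀ x : ℝ, (1 + x) ^ (n + 1) - (1 + ((n + 1 : ℕ) : ℝ) * x) =
        (1 + x) * ((1 + x) ^ n - (1 + n * x)) + n * x ^ 2 := by
      intro x; push_cast; ring
    rw [e, e]
    have h1 : (1 + p) * (((1 + p) ^ n - (1 + n * p)) * b ^ 2) ≤
        (1 + b) * (((1 + b) ^ n - (1 + n * b)) * p ^ 2) :=
      mul_le_mul (by linarith) ih (by
        have := one_add_mul_le_pow (a := p) (by linarith) n
        exact mul_nonneg (by linarith) (sq_nonneg _)) (by linarith)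
    nlinarith [h1]

/-- The first order expansion of a product of factors close to `1`. -/
theorem norm_prod_one_add_sub_le_sq [NormOneClass 𝒜] {ι : Type*} (s : Finset ι) (x : ι → 𝒜)
    {p : ℝ} (hp0 : 0 ≤ p) (hp : p ≤ 3 / 2) (hx : ∀ i ∈ s, ‖x i‖ ≤ p) :
    ‖∏ i ∈ s, (1 + x i) - (1 + ∑ i ∈ s, x i)‖ ≤ 3 ^ s.card * p ^ 2 := by
  refine (norm_prod_one_add_sub_le s x hp0 hx).trans ?_
  have h := one_add_pow_sub_le s.card hp0 (b := 2) (by linarith)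
  have h3 : ((1 : ℝ) + 2) ^ s.card = 3 ^ s.card := by norm_num
  rw [h3] at h
  have : (0 : ℝ) ≤ s.card := Nat.cast_nonneg _
  have h2 : 0 ≤ (1 + (s.card : ℝ) * 2) * p ^ 2 := by positivity
  have h4 : 0 ≤ (3 : ℝ) ^ s.card * p ^ 2 := by positivity
  nlinarith

/-- Sets of pairs as families of sets. -/
def finsetProdEquiv (α β : Type*) [Fintype α] [Fintype β] [DecidableEq α] [DecidableEq β] :
    Finset (α × β) ≃ (α → Finset β) where
  toFun B i := Finset.univ.filter fun b => (i, b) ∈ B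
  invFun φ := Finset.univ.filter fun s => s.2 ∈ φ s.1
  left_inv B := by ext ⟨i, b⟩; simp
  right_inv φ := by ext i b; simp

theorem norm_eulerOp_le [NormOneClass 𝒜] {c : Finset (Fin m) → ℝ} {z : Fin m × Bool → 𝒜} {e : ℝ}
    (hc : ∀ C, |c C| ≤ e) (hz : ∀ s, ‖z s‖ ≤ 1) : ‖eulerOp c z‖ ≤ 4 ^ m * e := by
  unfold eulerOp
  refine (norm_sum_le _ _).trans ((Finset.sum_le_card_nsmul _ _ e ?_).trans ?_)
  · intro B _
    rw [norm_smul, norm_mul, norm_pow, norm_neg, norm_one, one_pow, one_mul, Real.norm_eq_abs]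
    have := norm_prod_le_one_of_le B z fun s _ => hz s
    nlinarith [hc (B.image Prod.fst), abs_nonneg (c (B.image Prod.fst)), norm_nonneg (∏ s ∈ B, z s)]
  · simp only [Finset.card_univ, Fintype.card_finset, Fintype.card_prod, Fintype.card_fin,
      Fintype.card_bool, nsmul_eq_mul]
    push_cast
    rw [mul_comm m 2, pow_mul]
    norm_num

theorem eulerOp_sub (c c' : Finset (Fin m) → ℝ) (z : Fin m × Bool → 𝒜) :
    eulerOp c z - eulerOp c' z = eulerOp (fun C => c C - c' C) z := by
  unfold eulerOp
  rw [← Finset.sum_sub_distrib]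
  refine Finset.sum_congr rfl fun B _ => ?_
  rw [← sub_smul]
  ring_nf

/-- With density `p ^ |C|` the forms are independent, so the sum over sets of slots factors over the
forms. Using both slots of one form costs only one factor `p`, whence the positive mixed term. -/
theorem eulerOp_pow_card (p : ℝ) (z : Fin m × Bool → 𝒜) :
    eulerOp (fun C => p ^ C.card) z =
      ∏ i, (1 + (-(p • z (i, false)) - p • z (i, true) + p • (z (i, false) * z (i, true)))) := by
  have h : ∀ i, (1 + (-(p • z (i, false)) - p • z (i, true) + p • (z (i, false) * z (i, true)))) =
      ∑ S : Finset Bool, ((-1) ^ S.card * (if S = ∅ then 1 else p)) • ∏ b ∈ S, z (i, b) := by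
    intro i
    have hu : (Finset.univ : Finset (Finset Bool)) = {∅, {false}, {true}, {false, true}} := by
      decide
    rw [hu, Finset.sum_insert (by decide), Finset.sum_insert (by decide),
      Finset.sum_insert (by decide), Finset.sum_singleton]
    rw [Finset.prod_insert (s := {true}) (a := false) (by decide)]
    have e1 : ({false, true} : Finset Bool) ≠ ∅ := by decide
    have e2 : ({true} : Finset Bool) ≠ ∅ := by decide
    have e3 : ({false} : Finset Bool) ≠ ∅ := by decide
    have e4 : ({false, true} : Finset Bool).card = 2 := by decide
    simp only [e1, e2, e3, e4, if_true, if_false, Finset.card_empty, Finset.card_singleton,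
      Finset.prod_empty, Finset.prod_singleton]
    norm_num
    abel
  rw [Finset.prod_congr rfl fun i _ => h i, Finset.prod_univ_sum, Fintype.piFinset_univ]
  unfold eulerOp
  refine Fintype.sum_equiv (finsetProdEquiv (Fin m) Bool) _ _ fun B => ?_
  have hmem : ∀ i b, b ∈ finsetProdEquiv (Fin m) Bool B i ↔ (i, b) ∈ B := by
    intro i b; simp [finsetProdEquiv]
  have hprod : ∏ s ∈ B, z s = ∏ i, ∏ b ∈ finsetProdEquiv (Fin m) Bool B i, z (i, b) :=
    Finset.prod_finset_product B Finset.univ (finsetProdEquiv (Fin m) Bool B)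
      (by rintro ⟨i, b⟩; simp [hmem])
  have hcard : B.card = ∑ i, (finsetProdEquiv (Fin m) Bool B i).card := by
    have := Finset.sum_finset_product B Finset.univ (finsetProdEquiv (Fin m) Bool B)
      (f := fun _ => (1 : ℕ)) (by rintro ⟨i, b⟩; simp [hmem])
    simpa using this
  have himg : p ^ (B.image Prod.fst).card =
      ∏ i, (if finsetProdEquiv (Fin m) Bool B i = ∅ then 1 else p) := by
    rw [Finset.prod_ite]
    simp only [Finset.prod_const_one, one_mul, Finset.prod_const]
    congr 2
    ext i
    simp only [Finset.mem_image, Finset.mem_filter, Finset.mem_univ, true_and,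
      ← Finset.nonempty_iff_ne_empty]
    constructor
    · rintro ⟨⟨j, b⟩, hB, rfl⟩
      exact ⟨b, (hmem _ _).2 hB⟩
    · rintro ⟨b, hb⟩
      exact ⟨(i, b), (hmem _ _).1 hb, rfl⟩
  beta_reduce
  rw [hprod, hcard, himg, ← Finset.prod_pow_eq_pow_sum, ← Finset.prod_mul_distrib]
  simp only [Algebra.smul_def, Finset.prod_mul_distrib, map_prod, map_mul]

/-- The density is compared with the independent one: they differ only for `|C| ≥ 2`, by at most `e
+ p ^ 2 ≤ 2 * e`. The independent product is then expanded to first order, each factor being within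
`3 * p` of `1`; so `11 = 2 + 9`. -/
theorem norm_eulerOp_sub_le [NormOneClass 𝒜] {c : Finset (Fin m) → ℝ} {z : Fin m × Bool → 𝒜}
    {p e : ℝ} (hp0 : 0 ≤ p) (hp : p ≤ 1 / 2) (hc0 : c ∅ = 1) (hc1 : ∀ i, c {i} = p)
    (hc2 : ∀ C, 2 ≤ C.card → |c C| ≤ e) (he : p ^ 2 ≤ e) (hz : ∀ s, ‖z s‖ ≤ 1) :
    ‖eulerOp c z - (1 + ∑ i, (-(p • z (i, false)) - p • z (i, true) +
      p • (z (i, false) * z (i, true))))‖ ≤ 11 * 4 ^ m * e := by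
  have h1 : ‖eulerOp c z - eulerOp (fun C => p ^ C.card) z‖ ≤ 4 ^ m * (2 * e) := by
    rw [eulerOp_sub]
    refine norm_eulerOp_le (fun C => ?_) hz
    rcases Nat.lt_or_ge C.card 2 with h | h
    · have : c C - p ^ C.card = 0 := by
        interval_cases hC : C.card
        · rw [Finset.card_eq_zero] at hC; simp [hC, hc0]
        · obtain ⟨i, rfl⟩ := Finset.card_eq_one.1 hC; simp [hc1]
      rw [this, abs_zero]
      nlinarith
    · have : p ^ C.card ≤ p ^ 2 := pow_le_pow_of_le_one hp0 (by linarith) h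
      have h0 : 0 ≤ p ^ C.card := by positivity
      have := abs_le.1 (hc2 C h)
      rw [abs_le]; constructor <;> linarith
  have hn : ∀ s t, ‖p • (z s * z t)‖ ≤ p := fun s t => by
    rw [norm_smul, Real.norm_of_nonneg hp0]
    have := (norm_mul_le (z s) (z t)).trans
      (mul_le_one₀ (hz s) (norm_nonneg _) (hz t))
    nlinarith
  have hn1 : ∀ s, ‖p • z s‖ ≤ p := fun s => by
    rw [norm_smul, Real.norm_of_nonneg hp0]
    nlinarith [hz s]
  have h2 := norm_prod_one_add_sub_le_sq (Finset.univ : Finset (Fin m))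
    (fun i => -(p • z (i, false)) - p • z (i, true) + p • (z (i, false) * z (i, true)))
    (p := 3 * p) (by linarith) (by linarith) (fun i _ => by
      refine (norm_add_le _ _).trans ?_
      have h3 := norm_sub_le (-(p • z (i, false))) (p • z (i, true))
      rw [norm_neg] at h3
      linarith [hn (i, false) (i, true), hn1 (i, false), hn1 (i, true)])
  rw [← eulerOp_pow_card, Finset.card_univ, Fintype.card_fin] at h2
  have h3 : (3 : ℝ) ^ m ≤ 4 ^ m := by gcongr; norm_num
  have h4 : (3 : ℝ) ^ m * (3 * p) ^ 2 ≤ 4 ^ m * (9 * e) := by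
    apply mul_le_mul h3 _ (by positivity) (by positivity)
    nlinarith
  calc _ ≤ 4 ^ m * (2 * e) + 4 ^ m * (9 * e) := by
        rw [← sub_add_sub_cancel]
        exact (norm_add_le _ _).trans (add_le_add h1 (h2.trans h4))
    _ = _ := by ring

theorem exists_inverse_one_sub [CompleteSpace 𝒜] [NormOneClass 𝒜] {x : 𝒜} (hx : ‖x‖ ≤ 1 / 2) :
    ∃ y : 𝒜, (1 - x) * y = 1 ∧ ‖y‖ ≤ 2 := by
  have hlt : ‖x‖ < 1 := by linarith
  refine ⟨∑' i : ℕ, x ^ i, mul_neg_geom_series x hlt, ?_⟩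
  set y := ∑' i : ℕ, x ^ i
  have h : y = 1 + x * y := by linear_combination mul_neg_geom_series x hlt
  have h2 : ‖y‖ ≤ 1 + ‖x‖ * ‖y‖ := by
    conv_lhs => rw [h]
    exact (norm_add_le _ _).trans (by rw [norm_one]; gcongr; exact norm_mul_le _ _)
  nlinarith [norm_nonneg y]

theorem norm_real_smul_le {z : 𝒜} {p : ℝ} (hp0 : 0 ≤ p) (hz : ‖z‖ ≤ 1) : ‖p • z‖ ≤ p := by
  rw [norm_smul, Real.norm_of_nonneg hp0]
  nlinarith

theorem exists_inverse_numOp [CompleteSpace 𝒜] [NormOneClass 𝒜] {p : ℝ} (hp0 : 0 ≤ p)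
    (hp : p ≤ 1 / 2) {z : Fin m × Bool → 𝒜} (hz : ∀ s, ‖z s‖ ≤ 1) :
    ∃ y : 𝒜, numOp p z * y = 1 ∧ ‖y‖ ≤ 4 ^ m := by
  choose y hy hn using fun s =>
    exists_inverse_one_sub ((norm_real_smul_le hp0 (hz s)).trans hp)
  refine ⟨∏ s, y s, ?_, ?_⟩
  · rw [numOp, ← Finset.prod_mul_distrib]
    exact Finset.prod_eq_one fun s _ => hy s
  · refine (Finset.norm_prod_le _ _).trans
      ((Finset.prod_le_prod (fun _ _ => norm_nonneg _) fun s _ => hn s).trans ?_)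
    simp only [Finset.prod_const, Finset.card_univ, Fintype.card_prod, Fintype.card_fin,
      Fintype.card_bool]
    rw [mul_comm m 2, pow_mul]
    norm_num

theorem exists_inverse_denOp [CompleteSpace 𝒜] [NormOneClass 𝒜] {p : ℝ} (hp0 : 0 ≤ p)
    (hp : p ≤ 1 / 2) {z : Fin m × Bool → 𝒜} (hz : ∀ s, ‖z s‖ ≤ 1) :
    ∃ y : 𝒜, denOp p z * y = 1 := by
  choose y hy hn using fun i : Fin m =>
    exists_inverse_one_sub ((norm_real_smul_le hp0 ((norm_mul_le (z (i, false)) (z (i, true))).trans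
      (mul_le_one₀ (hz _) (norm_nonneg _) (hz _)))).trans hp)
  refine ⟨∏ s, y s, ?_⟩
  rw [denOp, ← Finset.prod_mul_distrib]
  exact Finset.prod_eq_one fun s _ => hy s

/-- A local factor agrees with the zeta model up to second order. -/
theorem norm_eulerOp_ratio_sub_one_le [CompleteSpace 𝒜] [NormOneClass 𝒜] {c : Finset (Fin m) → ℝ}
    {z : Fin m × Bool → 𝒜} {p e : ℝ} (hp0 : 0 ≤ p) (hp : p ≤ 1 / 2) (hc0 : c ∅ = 1)
    (hc1 : ∀ i, c {i} = p) (hc : ∀ C, |c C| ≤ 1)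
    (hc2 : ∀ C, 2 ≤ C.card → |c C| ≤ e) (he : p ^ 2 ≤ e) (hz : ∀ s, ‖z s‖ ≤ 1)
    {y : 𝒜} (hy : numOp p z * y = 1) (hyn : ‖y‖ ≤ 4 ^ m) :
    ‖eulerOp c z * denOp p z * y - 1‖ ≤ 40 * 64 ^ m * e := by
  set K : ℝ := 4 ^ m with hK
  have hK1 : 1 ≤ K := one_le_pow₀ (by norm_num)
  have he0 : 0 ≤ e := (sq_nonneg p).trans he
  set E := eulerOp c z
  set a := ∑ s, z s with ha
  set b := ∑ i : Fin m, z (i, false) * z (i, true) with hb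
  have hm : (m : ℝ) ≤ K := by
    have h1 : m ≤ 4 ^ m := (Nat.lt_pow_self (by norm_num)).le
    rw [hK]; exact_mod_cast h1
  have hm2 : ((2 * m : ℕ) : ℝ) ≤ K := by
    have h1 : 2 * m ≤ 2 ^ (2 * m) := (Nat.lt_pow_self (by norm_num)).le
    rw [pow_mul] at h1
    rw [hK]; exact_mod_cast h1
  have hzz : ∀ i : Fin m, ‖z (i, false) * z (i, true)‖ ≤ 1 := fun i =>
    (norm_mul_le _ _).trans (mul_le_one₀ (hz _) (norm_nonneg _) (hz _))
  have hna : ‖a‖ ≤ K := by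
    refine (norm_sum_le _ _).trans ((Finset.sum_le_sum fun s _ => hz s).trans ?_)
    simpa [mul_comm] using hm2
  have hnb : ‖b‖ ≤ K := by
    refine (norm_sum_le _ _).trans ((Finset.sum_le_sum fun s _ => hzz s).trans ?_)
    simpa using hm
  have hE1 : ‖E - (1 - p • a + p • b)‖ ≤ 11 * K * e := by
    have h := norm_eulerOp_sub_le hp0 hp hc0 hc1 hc2 he hz
    have e1 : (1 + ∑ i, (-(p • z (i, false)) - p • z (i, true) +
      p • (z (i, false) * z (i, true)))) = 1 - p • a + p • b := by
      rw [ha, hb, Fintype.sum_prod_type]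
      simp only [Fintype.sum_bool, Finset.sum_add_distrib, Finset.sum_sub_distrib,
        Finset.sum_neg_distrib, ← Finset.smul_sum, smul_add]
      abel
    rwa [e1] at h
  have hEn : ‖E‖ ≤ K := by simpa using norm_eulerOp_le hc hz
  have hD : ‖denOp p z - (1 - p • b)‖ ≤ K * e := by
    have h := norm_prod_one_add_sub_le_sq Finset.univ
      (fun i : Fin m => -(p • (z (i, false) * z (i, true)))) hp0 (by linarith)
      (fun i _ => by rw [norm_neg]; exact norm_real_smul_le hp0 (hzz i))
    have e1 : (1 : 𝒜) + ∑ i : Fin m, -(p • (z (i, false) * z (i, true))) = 1 - p • b := by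
      rw [Finset.sum_neg_distrib, ← Finset.smul_sum]; abel
    rw [e1] at h
    simp only [← sub_eq_add_neg] at h
    refine h.trans (mul_le_mul ?_ he (sq_nonneg _) (by linarith))
    rw [Finset.card_univ, Fintype.card_fin, hK]; gcongr; norm_num
  have hN : ‖numOp p z - (1 - p • a)‖ ≤ K ^ 2 * e := by
    have h := norm_prod_one_add_sub_le_sq Finset.univ
      (fun s : Fin m × Bool => -(p • z s)) hp0 (by linarith)
      (fun s _ => by rw [norm_neg]; exact norm_real_smul_le hp0 (hz s))
    have e1 : (1 : 𝒜) + ∑ s : Fin m × Bool, -(p • z s) = 1 - p • a := by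
      rw [Finset.sum_neg_distrib, ← Finset.smul_sum]; abel
    rw [e1] at h
    simp only [← sub_eq_add_neg] at h
    refine h.trans (mul_le_mul ?_ he (sq_nonneg _) (by positivity))
    rw [Finset.card_univ, Fintype.card_prod, Fintype.card_fin, Fintype.card_bool, hK, ← pow_mul]
    gcongr; norm_num
  have hpb : ‖1 - p • b‖ ≤ 1 + K := by
    refine (norm_sub_le _ _).trans ?_
    rw [norm_one, norm_smul, Real.norm_of_nonneg hp0]
    nlinarith [norm_nonneg b]
  have hbr : ‖(1 - p • b) * (1 - p • a + p • b) - (1 - p • a)‖ ≤ 2 * K ^ 2 * e := by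
    have e1 : (1 - p • b) * (1 - p • a + p • b) - (1 - p • a) = (p ^ 2) • (b * (a - b)) := by
      simp only [Algebra.smul_def, map_pow]
      ring
    rw [e1, norm_smul, Real.norm_of_nonneg (sq_nonneg p)]
    have h1 : ‖b * (a - b)‖ ≤ K * (K + K) :=
      (norm_mul_le _ _).trans (mul_le_mul hnb ((norm_sub_le _ _).trans (add_le_add hna hnb))
        (norm_nonneg _) (by linarith))
    calc p ^ 2 * ‖b * (a - b)‖ ≤ e * (K * (K + K)) :=
          mul_le_mul he h1 (norm_nonneg _) he0
      _ = _ := by ring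
  -- To first order `E` is `1 - pa + pb` and `denOp` is `1 - pb`, so their product has first order
  -- part `1 - pa`, the same as `numOp`. The difference `E * denOp - numOp` splits into four second
  -- order errors.
  have key : E * denOp p z * y - 1 = ((denOp p z - (1 - p • b)) * E +
      (1 - p • b) * (E - (1 - p • a + p • b)) +
      ((1 - p • b) * (1 - p • a + p • b) - (1 - p • a)) - (numOp p z - (1 - p • a))) * y := by
    linear_combination hy
  have hX : ‖(denOp p z - (1 - p • b)) * E +
      (1 - p • b) * (E - (1 - p • a + p • b)) +
      ((1 - p • b) * (1 - p • a + p • b) - (1 - p • a)) - (numOp p z - (1 - p • a))‖ ≤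
      40 * K ^ 2 * e := by
    calc _ ≤ K * e * K + (1 + K) * (11 * K * e) + 2 * K ^ 2 * e + K ^ 2 * e := by
          refine (norm_sub_le _ _).trans (add_le_add ((norm_add_le _ _).trans
            (add_le_add ((norm_add_le _ _).trans (add_le_add ?_ ?_)) hbr)) hN)
          · exact (norm_mul_le _ _).trans (mul_le_mul hD hEn (norm_nonneg _) (by positivity))
          · exact (norm_mul_le _ _).trans (mul_le_mul hpb hE1 (norm_nonneg _) (by positivity))
      _ = (15 * K ^ 2 + 11 * K) * e := by ring
      _ ≤ 40 * K ^ 2 * e := by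
          apply mul_le_mul_of_nonneg_right _ he0
          nlinarith
  rw [key]
  calc _ ≤ 40 * K ^ 2 * e * K :=
        (norm_mul_le _ _).trans (mul_le_mul hX hyn (norm_nonneg _) (by positivity))
    _ = 40 * 64 ^ m * e := by
        have : (64 : ℝ) ^ m = K ^ 3 := by rw [hK, ← pow_mul, mul_comm m 3, pow_mul]; norm_num
        rw [this]; ring

end EulerOperators

/-! ### Comparison of an Euler product with the zeta model -/

section MainIdentity

variable {𝒜 : Type*} [NormedCommRing 𝒜] [NormedAlgebra ℝ 𝒜] [CompleteSpace 𝒜] [NormOneClass 𝒜]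
  {E : Type*} [NormedAddCommGroup E] [NormedSpace ℝ E] [Module 𝒜 E] [IsBoundedSMul 𝒜 E]
  [IsScalarTower ℝ 𝒜 E] {m : ℕ} {κ : Type*}

theorem eulerOp_eq_one {c : Finset (Fin m) → ℝ} (z : Fin m × Bool → 𝒜) (h0 : c ∅ = 1)
    (h : ∀ C, C.Nonempty → c C = 0) : eulerOp c z = 1 := by
  unfold eulerOp
  rw [Finset.sum_eq_single ∅]
  · simp [h0]
  · intro B _ hB
    rw [h _ (by simpa using Finset.nonempty_iff_ne_empty.2 hB), mul_zero, zero_smul]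
  · simp

/-- Operators that are congruent to a constant when the shifts are set equal to `1`. -/
theorem exists_norm_smul_sub_le {Z : Fin m × Bool → 𝒜} {T : 𝒜}
    (hT : T ∈ Ideal.span (Set.range fun s => Z s - 1)) :
    ∃ K : ℝ, 0 ≤ K ∧ ∀ (F : E) (A : ℝ), (∀ s, ‖(Z s - 1) • F‖ ≤ A) → ‖T • F‖ ≤ K * A := by
  obtain ⟨u, rfl⟩ := Ideal.mem_span_range_iff_exists_fun.1 hT
  refine ⟨∑ s, ‖u s‖, Finset.sum_nonneg fun _ _ => norm_nonneg _, fun F A hA => ?_⟩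
  rw [Finset.sum_smul, Finset.sum_mul]
  refine (norm_sum_le _ _).trans (Finset.sum_le_sum fun s _ => ?_)
  rw [mul_smul]
  exact (norm_smul_le _ _).trans (mul_le_mul_of_nonneg_left (hA s) (norm_nonneg _))

/-- In the quotient by the ideal every `Z s` is `1`, so `numOp` becomes `(1 - p) ^ (2 * m)` and
`denOp` becomes `(1 - p) ^ m`; their ratio is `(1 - p) ^ (-m)`. -/
theorem ratio_sub_one_mem {Z : Fin m × Bool → 𝒜} (S : Finset κ) (n : κ → ℕ) {p : κ → ℝ}
    (y : κ → 𝒜) (hy : ∀ P ∈ S, numOp (p P) (fun s => Z s ^ n P) * y P = 1) :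
    algebraMap ℝ 𝒜 ((∏ P ∈ S, (1 - p P)) ^ m) *
      ∏ P ∈ S, (denOp (p P) (fun s => Z s ^ n P) * y P) - 1 ∈
        Ideal.span (Set.range fun s => Z s - 1) := by
  set I := Ideal.span (Set.range fun s => Z s - 1)
  have hZ : ∀ s, Ideal.Quotient.mk I (Z s) = 1 := fun s => by
    rw [← map_one (Ideal.Quotient.mk I), Ideal.Quotient.eq]
    exact Ideal.subset_span ⟨s, rfl⟩
  rw [← Ideal.Quotient.eq, map_one, map_mul, map_prod, ← Finset.prod_pow, map_prod, map_prod,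
    ← Finset.prod_mul_distrib]
  refine Finset.prod_eq_one fun P hP => ?_
  have h1 := congrArg (Ideal.Quotient.mk I) (hy P hP)
  have hn : Ideal.Quotient.mk I (numOp (p P) (fun s => Z s ^ n P)) =
      Ideal.Quotient.mk I (algebraMap ℝ 𝒜 ((1 - p P) ^ (2 * m))) := by
    simp only [numOp, Algebra.smul_def, map_prod, map_sub, map_one, map_mul, map_pow, hZ, one_pow,
      mul_one, Finset.prod_const, Finset.card_univ, Fintype.card_prod, Fintype.card_fin,
      Fintype.card_bool]
    rw [mul_comm]
  have hd : Ideal.Quotient.mk I (denOp (p P) (fun s => Z s ^ n P)) =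
      Ideal.Quotient.mk I (algebraMap ℝ 𝒜 ((1 - p P) ^ m)) := by
    simp only [denOp, Algebra.smul_def, map_prod, map_sub, map_one, map_mul, map_pow, hZ, one_pow,
      mul_one, Finset.prod_const, Finset.card_univ, Fintype.card_fin]
  rw [map_mul, hn, map_one, two_mul, pow_add, map_mul, map_mul] at h1
  rw [map_mul, hd, ← mul_assoc]
  exact h1

/-- The Euler product of a sieve, compared with the zeta model: `f` is the cutoff and `F` its
regularization. -/
theorem exists_norm_euler_prod_smul_sub_le {Z : Fin m × Bool → 𝒜} (hZ : ∀ s, ‖Z s‖ ≤ 1)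
    (S : Finset κ) (n : κ → ℕ) (p : κ → ℝ) (hp0 : ∀ P, 0 ≤ p P) (hp : ∀ P, p P ≤ 1 / 2) :
    ∃ K : ℝ, 0 ≤ K ∧ ∀ (T : Finset κ) (c : κ → Finset (Fin m) → ℝ) (e : κ → ℝ), S ⊆ T →
      (∀ P ∈ T, c P ∅ = 1) → (∀ P ∈ S, ∀ C : Finset (Fin m), C.Nonempty → c P C = 0) →
      (∀ P ∈ T, P ∉ S → ∀ i, c P {i} = p P) → (∀ P ∈ T, P ∉ S → ∀ C, |c P C| ≤ 1) →
      (∀ P ∈ T, P ∉ S → ∀ C, 2 ≤ C.card → |c P C| ≤ e P) →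
      (∀ P ∈ T, P ∉ S → p P ^ 2 ≤ e P) →
      ∀ (f F : E) (A A' L : ℝ),
      (∏ P ∈ T, numOp (p P) (fun s => Z s ^ n P)) • f =
        (∏ P ∈ T, denOp (p P) (fun s => Z s ^ n P)) • F →
      ‖F‖ ≤ A → (∀ s, ‖(Z s - 1) • F‖ ≤ A') → (∀ U, U ⊆ T → Disjoint U S → ∑ P ∈ U, e P ≤ L) →
      ‖((∏ P ∈ S, (1 - p P)) ^ m) • ((∏ P ∈ T, eulerOp (c P) (fun s => Z s ^ n P)) • f) - F‖ ≤
        (Real.exp (40 * 64 ^ m * L) - 1) * A + Real.exp (40 * 64 ^ m * L) * (K * A') := by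
  classical
  have hZn : ∀ P s, ‖Z s ^ n P‖ ≤ 1 := fun P s => by
    refine (norm_pow_le _ _).trans (pow_le_one₀ (norm_nonneg _) (hZ s))
  choose y hy hyn using fun P => exists_inverse_numOp (hp0 P) (hp P) (hZn P)
  choose x hx using fun P => exists_inverse_denOp (hp0 P) (hp P) (hZn P)
  obtain ⟨K, hK0, hK⟩ := exists_norm_smul_sub_le (E := E)
    (ratio_sub_one_mem (m := m) S n (p := p) (Z := Z) y (fun P _ => hy P))
  refine ⟨K, hK0, ?_⟩
  intro T c e hST hc0 hcS hc1 hcle hc2 he f F A A' L hfF hF hF' hL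
  set V := (∏ P ∈ S, (1 - p P)) ^ m
  set N : κ → 𝒜 := fun P => numOp (p P) (fun s => Z s ^ n P)
  set D : κ → 𝒜 := fun P => denOp (p P) (fun s => Z s ^ n P)
  set Eu : κ → 𝒜 := fun P => eulerOp (c P) (fun s => Z s ^ n P)
  -- `G` is close to `1` in norm. `H` is not, but `V * H - 1` lies in the ideal generated by the `Z
  -- s - 1` and is therefore small on `F`.
  set H := ∏ P ∈ S, (D P * y P)
  set G := ∏ P ∈ T \ S, (Eu P * D P * y P)
  have hf : (∏ P ∈ T, Eu P) • f = (G * H) • F := by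
    have h1 : f = (∏ P ∈ T, (D P * y P)) • F := by
      have h2 : (∏ P ∈ T, y P) * ∏ P ∈ T, N P = 1 := by
        rw [← Finset.prod_mul_distrib]
        exact Finset.prod_eq_one fun P _ => by rw [mul_comm]; exact hy P
      calc f = ((∏ P ∈ T, y P) * ∏ P ∈ T, N P) • f := by rw [h2, one_smul]
        _ = (∏ P ∈ T, y P) • ((∏ P ∈ T, D P) • F) := by rw [mul_smul, hfF]
        _ = _ := by rw [← mul_smul, Finset.prod_mul_distrib, mul_comm]
    have hES : ∏ P ∈ S, Eu P = 1 := Finset.prod_eq_one fun P hP =>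
      eulerOp_eq_one _ (hc0 P (hST hP)) (hcS P hP)
    conv_lhs => rw [h1]
    rw [← mul_smul]
    congr 1
    rw [← Finset.prod_sdiff hST, hES, ← Finset.prod_sdiff hST, mul_one, ← mul_assoc,
      ← Finset.prod_mul_distrib]
    congr 1
    exact Finset.prod_congr rfl fun P _ => by ring
  have hGe : ‖G - 1‖ ≤ Real.exp (40 * 64 ^ m * L) - 1 := by
    have h1 := (T \ S).norm_prod_one_add_sub_one_le (fun P => Eu P * D P * y P - 1)
    simp only [add_sub_cancel] at h1
    refine h1.trans (sub_le_sub_right (Real.exp_le_exp.2 ?_) 1)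
    refine le_trans (Finset.sum_le_sum (g := fun P => 40 * 64 ^ m * e P) fun P hP => ?_) ?_
    · obtain ⟨hT, hS⟩ := Finset.mem_sdiff.1 hP
      exact norm_eulerOp_ratio_sub_one_le (hp0 P) (hp P) (hc0 P hT) (hc1 P hT hS) (hcle P hT hS)
        (hc2 P hT hS) (he P hT hS) (hZn P) (hy P) (hyn P)
    · rw [← Finset.mul_sum]
      exact mul_le_mul_of_nonneg_left (hL _ Finset.sdiff_subset Finset.sdiff_disjoint)
        (by positivity)
  have hGn : ‖G‖ ≤ Real.exp (40 * 64 ^ m * L) := by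
    have := norm_add_le (G - 1) 1
    rw [sub_add_cancel, norm_one] at this
    linarith
  have hid : V • ((∏ P ∈ T, Eu P) • f) - F =
      (G - 1) • F + G • ((algebraMap ℝ 𝒜 V * H - 1) • F) := by
    rw [hf, ← algebraMap_smul 𝒜 V, ← mul_smul, ← mul_smul, ← add_smul]
    nth_rewrite 2 [← one_smul 𝒜 F]
    rw [← sub_smul]
    congr 1
    ring
  rw [hid]
  refine (norm_add_le _ _).trans (add_le_add ?_ ?_)
  · exact (norm_smul_le _ _).trans (mul_le_mul hGe hF (norm_nonneg _)
      ((norm_nonneg _).trans hGe))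
  · exact (norm_smul_le _ _).trans (mul_le_mul hGn (hK F A' hF') (norm_nonneg _)
      (Real.exp_nonneg _))

end MainIdentity


/-! ### The commutative Banach algebra of shifts -/

section Shifts

variable {ι : Type*} [Finite ι] [DecidableEq ι]

/-- Bounded functions on a finite power of `ℕ`. -/
def BddFun (ι : Type*) : Type _ := BoundedContinuousFunction (ι → ℕ) ℝ

noncomputable instance : NormedAddCommGroup (BddFun ι) :=
  inferInstanceAs (NormedAddCommGroup (BoundedContinuousFunction (ι → ℕ) ℝ))

noncomputable instance : NormedSpace ℝ (BddFun ι) :=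
  inferInstanceAs (NormedSpace ℝ (BoundedContinuousFunction (ι → ℕ) ℝ))

instance : CompleteSpace (BddFun ι) :=
  inferInstanceAs (CompleteSpace (BoundedContinuousFunction (ι → ℕ) ℝ))

instance : CoeFun (BddFun ι) fun _ => (ι → ℕ) → ℝ :=
  ⟨fun f => @DFunLike.coe (BoundedContinuousFunction (ι → ℕ) ℝ) _ _ _ f⟩

/-- The bounded function with given values and bound. -/
noncomputable def mkBdd (f : (ι → ℕ) → ℝ) (C : ℝ) (h : ∀ n, ‖f n‖ ≤ C) : BddFun ι :=
  BoundedContinuousFunction.ofNormedAddCommGroupDiscrete f C h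

theorem mkBdd_apply (f : (ι → ℕ) → ℝ) (C : ℝ) (h : ∀ n, ‖f n‖ ≤ C) (n : ι → ℕ) :
    mkBdd f C h n = f n := rfl

instance : Nontrivial (BddFun ι) where
  exists_pair_ne := ⟨mkBdd (fun _ => 0) 0 (by simp), mkBdd (fun _ => 1) 1 (by simp), fun h => by
    have := congrArg (fun f : BddFun ι => f 0) h
    simp [mkBdd_apply] at this⟩

namespace BddFun

theorem ext {f g : BddFun ι} (h : ∀ n, f n = g n) : f = g :=
  BoundedContinuousFunction.ext h

theorem norm_apply_le (f : BddFun ι) (n : ι → ℕ) : |f n| ≤ ‖f‖ :=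
  BoundedContinuousFunction.norm_coe_le_norm (show BoundedContinuousFunction (ι → ℕ) ℝ from f) n

theorem norm_le {f : BddFun ι} {C : ℝ} (hC : 0 ≤ C) (h : ∀ n, |f n| ≤ C) : ‖f‖ ≤ C :=
  (BoundedContinuousFunction.norm_le hC).2 h

theorem zero_apply (n : ι → ℕ) : (0 : BddFun ι) n = 0 := rfl

theorem sub_apply (f g : BddFun ι) (n : ι → ℕ) : (f - g) n = f n - g n := rfl

theorem smul_apply (r : ℝ) (f : BddFun ι) (n : ι → ℕ) : (r • f) n = r * f n := rfl

/-- Evaluation at a point as a linear map. -/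
def eval (n : ι → ℕ) : BddFun ι →ₗ[ℝ] ℝ where
  toFun f := f n
  map_add' _ _ := rfl
  map_smul' _ _ := rfl

theorem sum_apply {α : Type*} (s : Finset α) (f : α → BddFun ι) (n : ι → ℕ) :
    (∑ a ∈ s, f a) n = ∑ a ∈ s, f a n :=
  map_sum (eval n) f s

end BddFun

/-- The shift by one in the direction `s`. -/
noncomputable def shiftOp (s : ι) : BddFun ι →L[ℝ] BddFun ι :=
  LinearMap.mkContinuous
    { toFun := fun f => BoundedContinuousFunction.compContinuous f
        ⟨fun n => n + Pi.single s 1, continuous_of_discreteTopology⟩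
      map_add' := fun _ _ => rfl
      map_smul' := fun _ _ => rfl } 1 (fun f => by
        rw [one_mul]
        exact BddFun.norm_le (norm_nonneg f) fun n => f.norm_apply_le _)

theorem shiftOp_comm (s t : ι) : shiftOp s * shiftOp t = shiftOp t * shiftOp s := by
  refine ContinuousLinearMap.ext fun f => BddFun.ext fun n => ?_
  change f (n + Pi.single s 1 + Pi.single t 1) = f (n + Pi.single t 1 + Pi.single s 1)
  rw [add_right_comm]

/-- The closed algebra of operators generated by the shifts. -/
noncomputable def shiftSubalgebra (ι : Type*) [Finite ι] [DecidableEq ι] :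
    Subalgebra ℝ (BddFun ι →L[ℝ] BddFun ι) :=
  (Algebra.adjoin ℝ (Set.range shiftOp)).topologicalClosure

/-- The commutative Banach algebra generated by the shifts. -/
abbrev ShiftAlg (ι : Type*) [Finite ι] [DecidableEq ι] : Type _ := shiftSubalgebra ι

/-- The shifts commute, hence so does the algebra they generate and, by continuity, its closure.
Closedness supplies the completeness needed for Neumann series. -/
theorem shiftAlg_mul_comm (x y : ShiftAlg ι) : x * y = y * x := by
  have hc := Algebra.isMulCommutative_adjoin ℝ (s := Set.range (shiftOp (ι := ι))) (by
      rintro _ ⟨s, rfl⟩ _ ⟨t, rfl⟩; exact shiftOp_comm s t)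
  have h : ∀ x y : Algebra.adjoin ℝ (Set.range (shiftOp (ι := ι))), x * y = y * x :=
    fun x y => hc.is_comm.comm x y
  exact (Subalgebra.commRingTopologicalClosure _ h).mul_comm x y

noncomputable instance : NormedCommRing (ShiftAlg ι) :=
  { (inferInstance : NormedRing (ShiftAlg ι)) with mul_comm := shiftAlg_mul_comm }

noncomputable instance : NormedAlgebra ℝ (ShiftAlg ι) where
  norm_smul_le r x := norm_smul_le r (x : BddFun ι →L[ℝ] BddFun ι)

instance : CompleteSpace (ShiftAlg ι) :=
  (Subalgebra.isClosed_topologicalClosure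
    (Algebra.adjoin ℝ (Set.range (shiftOp (ι := ι))))).completeSpace_coe

instance : NormOneClass (ShiftAlg ι) where
  norm_one := norm_one (α := BddFun ι →L[ℝ] BddFun ι)

instance : IsBoundedSMul (ShiftAlg ι) (BddFun ι) :=
  IsBoundedSMul.of_norm_smul_le fun x f => (x : BddFun ι →L[ℝ] BddFun ι).le_opNorm f

instance : IsScalarTower ℝ (ShiftAlg ι) (BddFun ι) where
  smul_assoc _ _ _ := rfl

/-- The shift as an element of the Banach algebra. -/
noncomputable def shift (s : ι) : ShiftAlg ι :=
  ⟨shiftOp s, Subalgebra.le_topologicalClosure _ (Algebra.subset_adjoin ⟨s, rfl⟩)⟩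

theorem norm_shift_le (s : ι) : ‖shift s‖ ≤ 1 :=
  (shiftOp s).opNorm_le_bound zero_le_one fun f => by
    rw [one_mul]
    exact BddFun.norm_le (norm_nonneg f) fun n => f.norm_apply_le _

theorem shift_smul_apply (s : ι) (f : BddFun ι) (n : ι → ℕ) :
    (shift s • f) n = f (n + Pi.single s 1) := rfl

theorem shift_pow_smul_apply (s : ι) (k : ℕ) (f : BddFun ι) (n : ι → ℕ) :
    (shift s ^ k • f) n = f (n + Pi.single s k) := by
  induction k generalizing n with
  | zero => simp
  | succ k ih =>
    rw [pow_succ', mul_smul, shift_smul_apply, ih, add_assoc, ← Pi.single_add, add_comm 1 k]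

theorem prod_shift_pow_smul_apply (S : Finset ι) (k : ι → ℕ) (f : BddFun ι) (n : ι → ℕ) :
    ((∏ s ∈ S, shift s ^ k s) • f) n = f (fun s => n s + if s ∈ S then k s else 0) := by
  induction S using Finset.induction_on generalizing n with
  | empty => simp
  | insert a S ha ih =>
    rw [Finset.prod_insert ha, mul_smul, shift_pow_smul_apply, ih]
    congr 1
    funext s
    rcases eq_or_ne s a with rfl | h
    · simp [ha]
    · simp [h]

end Shifts

/-! ### Sieve sums as values of operators -/

section Slots

variable {m : ℕ} {κ : Type*}

/-- Expanding the product chooses a set of slots for every prime. The chosen monomial of shifts,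
evaluated at `0`, reads `f` at the vector of total degrees of the primes in each slot. -/
theorem prod_eulerOp_smul_apply_zero (T : Finset κ) [DecidableEq κ] (n : κ → ℕ)
    (c : κ → Finset (Fin m) → ℝ) (f : BddFun (Fin m × Bool)) :
    ((∏ P ∈ T, eulerOp (c P) (fun s => shift s ^ n P)) • f) 0 =
      ∑ B : T → Finset (Fin m × Bool),
        (∏ P : T, ((-1) ^ (B P).card * c P ((B P).image Prod.fst))) *
          f (fun s => ∑ P : T, if s ∈ B P then n P else 0) := by
  have hpow : ∀ (U : Finset T) (B : T → Finset (Fin m × Bool)) (x : Fin m × Bool → ℕ),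
      ((∏ P ∈ U, ∏ s ∈ B P, shift s ^ n P) • f) x =
        f (fun s => x s + ∑ P ∈ U, if s ∈ B P then n P else 0) := by
    intro U B
    induction U using Finset.induction_on with
    | empty => simp
    | insert a U ha ih =>
      intro x
      rw [Finset.prod_insert ha, mul_smul, prod_shift_pow_smul_apply, ih]
      congr 1
      funext s
      rw [Finset.sum_insert ha, add_assoc]
  rw [← Finset.prod_coe_sort]
  unfold eulerOp
  rw [Finset.prod_univ_sum, Fintype.piFinset_univ, Finset.sum_smul,
    BddFun.sum_apply]
  refine Finset.sum_congr rfl fun B _ => ?_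
  have h : ∏ P : T, (((-1 : ℝ) ^ (B P).card * c P ((B P).image Prod.fst)) •
        ∏ s ∈ B P, shift s ^ n P) =
      (∏ P : T, ((-1 : ℝ) ^ (B P).card * c P ((B P).image Prod.fst))) •
        ∏ P : T, ∏ s ∈ B P, shift s ^ n P := by
    simp only [Algebra.smul_def, Finset.prod_mul_distrib, map_prod, map_mul]
  rw [h, smul_assoc, BddFun.smul_apply, hpow]
  simp

variable {𝒜 : Type*} [CommRing 𝒜] [Algebra ℝ 𝒜] {E : Type*} [AddCommGroup E] [Module 𝒜 E]

/-- The polynomial identity is known only modulo `X ^ N`; this is enough because `z ^ N` annihilates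
`f`. -/
theorem prod_one_sub_smul_eq {T : Finset κ} {n : κ → ℕ} {p : κ → ℝ} {N : ℕ}
    (hpoly : (X : ℝ[X]) ^ N ∣ ∏ P ∈ T, (1 - C (p P) * X ^ n P) - (1 - X)) {z : 𝒜} {f : E}
    (hf : z ^ N • f = 0) : (∏ P ∈ T, (1 - p P • z ^ n P)) • f = (1 - z) • f := by
  obtain ⟨Q, hQ⟩ := hpoly
  have h := congrArg (aeval z) hQ
  simp only [map_sub, map_prod, map_one, map_mul, aeval_C, map_pow, aeval_X] at h
  simp only [Algebra.smul_def]
  rw [sub_eq_iff_eq_add] at h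
  rw [h, add_smul, mul_comm, mul_smul, hf, smul_zero, zero_add]

theorem prod_prod_one_sub_smul_eq {σ : Type*} [DecidableEq σ] {T : Finset κ} {n : κ → ℕ}
    {p : κ → ℝ} {N : ℕ}
    (hpoly : (X : ℝ[X]) ^ N ∣ ∏ P ∈ T, (1 - C (p P) * X ^ n P) - (1 - X)) (S : Finset σ)
    (z : σ → 𝒜) (f : E) (hf : ∀ s ∈ S, z s ^ N • f = 0) :
    (∏ P ∈ T, ∏ s ∈ S, (1 - p P • z s ^ n P)) • f = (∏ s ∈ S, (1 - z s)) • f := by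
  rw [Finset.prod_comm]
  induction S using Finset.induction_on with
  | empty => simp
  | insert a S ha ih =>
    rw [Finset.prod_insert ha, Finset.prod_insert ha, mul_smul,
      ih fun s hs => hf s (Finset.mem_insert_of_mem hs)]
    have h1 : z a ^ N • ((∏ s ∈ S, (1 - z s)) • f) = 0 := by
      rw [smul_comm, hf a (Finset.mem_insert_self _ _), smul_zero]
    rw [prod_one_sub_smul_eq hpoly h1, ← mul_smul]

end Slots

/-! ### The difference equation linking cutoff and regularization -/

section Regularization

variable {m : ℕ}

/-- If `u` and `ρ` satisfy the one-pair difference equation, so do their tensor powers. -/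
theorem prod_one_sub_shift_smul_eq {g : ℕ → ℝ} {ρ : ℕ → ℕ → ℝ}
    (hρ : ∀ a b, ρ a b - ρ (a + 1) (b + 1) = (g a - g (a + 1)) * (g b - g (b + 1)))
    {f F : BddFun (Fin m × Bool)} (hf : ∀ n, f n = ∏ s, g (n s))
    (hF : ∀ n, F n = ∏ i, ρ (n (i, false)) (n (i, true))) :
    (∏ s : Fin m × Bool, (1 - shift s)) • f = (∏ i : Fin m, (1 - shift (i, false) * shift (i, true))) • F := by
  refine BddFun.ext fun n => ?_
  rw [Finset.prod_sub, Finset.prod_sub, Finset.sum_smul, Finset.sum_smul,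
    BddFun.sum_apply, BddFun.sum_apply]
  have hs : ∀ (k : ℕ) (T : ShiftAlg (Fin m × Bool)) (G : BddFun (Fin m × Bool)),
      (((-1) ^ k * T) • G) n = (-1 : ℝ) ^ k * (T • G) n := by
    intro k T G
    rcases Nat.even_or_odd k with hk | hk
    · rw [hk.neg_one_pow, hk.neg_one_pow, one_mul, one_mul]
    · rw [hk.neg_one_pow, hk.neg_one_pow, neg_one_mul, neg_one_mul, neg_smul, ← zero_sub,
        BddFun.sub_apply, BddFun.zero_apply, zero_sub]
  have e1 : ∀ B : Finset (Fin m × Bool), ((((-1) ^ B.card * ∏ _s ∈ Finset.univ \ B,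
      (1 : ShiftAlg (Fin m × Bool))) * ∏ s ∈ B, shift s) • f) n =
      (-1) ^ B.card * ∏ s, (if s ∈ B then g (n s + 1) else g (n s)) := by
    intro B
    rw [Finset.prod_const_one, mul_one, hs]
    have := prod_shift_pow_smul_apply B (fun _ => 1) f n
    simp only [pow_one] at this
    rw [this, hf]
    congr 1
    refine Finset.prod_congr rfl fun s _ => ?_
    split_ifs <;> simp
  have e2 : ∀ B : Finset (Fin m), ((((-1) ^ B.card * ∏ _s ∈ Finset.univ \ B,
      (1 : ShiftAlg (Fin m × Bool))) * ∏ i ∈ B, (shift (i, false) * shift (i, true))) • F) n =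
      (-1) ^ B.card * ∏ i, (if i ∈ B then ρ (n (i, false) + 1) (n (i, true) + 1)
        else ρ (n (i, false)) (n (i, true))) := by
    intro B
    rw [Finset.prod_const_one, mul_one, hs]
    have h1 : ∏ i ∈ B, (shift (i, false) * shift (i, true)) =
        ∏ s ∈ B ×ˢ (Finset.univ : Finset Bool), shift s := by
      rw [Finset.prod_product]
      refine Finset.prod_congr rfl fun i _ => ?_
      rw [Fintype.prod_bool, mul_comm]
    have := prod_shift_pow_smul_apply (B ×ˢ (Finset.univ : Finset Bool)) (fun _ => 1) F n
    simp only [pow_one] at this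
    rw [h1, this, hF]
    congr 1
    refine Finset.prod_congr rfl fun i _ => ?_
    simp only [Finset.mem_product, Finset.mem_univ, and_true]
    split_ifs <;> simp
  rw [Finset.sum_congr rfl fun B _ => e1 B, Finset.sum_congr rfl fun B _ => e2 B]
  have k1 : ∑ B ∈ Finset.univ.powerset, (-1 : ℝ) ^ B.card *
      ∏ s : Fin m × Bool, (if s ∈ B then g (n s + 1) else g (n s)) =
      ∏ s, (g (n s) - g (n s + 1)) := by
    rw [Finset.prod_sub]
    refine Finset.sum_congr rfl fun B _ => ?_
    rw [mul_assoc, Finset.prod_ite, mul_comm (∏ _ ∈ _, _)]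
    congr 3 <;> ext s <;> simp
  have k2 : ∑ B ∈ Finset.univ.powerset, (-1 : ℝ) ^ B.card *
      ∏ i : Fin m, (if i ∈ B then ρ (n (i, false) + 1) (n (i, true) + 1)
        else ρ (n (i, false)) (n (i, true))) =
      ∏ i, (ρ (n (i, false)) (n (i, true)) - ρ (n (i, false) + 1) (n (i, true) + 1)) := by
    rw [Finset.prod_sub]
    refine Finset.sum_congr rfl fun B _ => ?_
    rw [mul_assoc, Finset.prod_ite, mul_comm (∏ _ ∈ _, _)]
    congr 3 <;> ext s <;> simp
  rw [k1, k2, Fintype.prod_prod_type]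
  refine Finset.prod_congr rfl fun i _ => ?_
  rw [hρ, Fintype.prod_bool, mul_comm]

end Regularization


/-! ### The smooth cutoff and its two-variable correlation -/

section Cutoff

namespace IsCutoff

variable {χ : ℝ → ℝ}


theorem hasCompactSupport (hχ : IsCutoff χ) : HasCompactSupport χ :=
  HasCompactSupport.of_support_subset_isCompact isCompact_Icc hχ.support_subset

/-- The support condition does not exclude `x = 1`; the value there is `0` by continuity from the
right. -/
theorem eq_zero (hχ : IsCutoff χ) {x : ℝ} (hx : 1 ≤ x) : χ x = 0 := by
  rcases hx.eq_or_lt with rfl | hx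
  · have h : Tendsto χ (𝓝[>] 1) (𝓝 (χ 1)) :=
      hχ.smooth.continuous.continuousAt.tendsto.mono_left nhdsWithin_le_nhds
    refine tendsto_nhds_unique h (tendsto_const_nhds.congr' ?_)
    filter_upwards [self_mem_nhdsWithin] with x hx
    by_contra h0
    exact absurd (hχ.support_subset (Function.mem_support.2 (Ne.symm h0))).2 (not_le.2 hx)
  · by_contra h0
    exact absurd (hχ.support_subset (Function.mem_support.2 h0)).2 (not_le.2 hx)

theorem contDiff_deriv (hχ : IsCutoff χ) : ContDiff ℝ ∞ (deriv χ) :=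
  ((contDiff_infty_iff_deriv (f := χ)).1 hχ.smooth).2

theorem differentiable (hχ : IsCutoff χ) : Differentiable ℝ χ :=
  hχ.smooth.differentiable (by simp)

theorem differentiable_deriv (hχ : IsCutoff χ) : Differentiable ℝ (deriv χ) :=
  hχ.contDiff_deriv.differentiable (by simp)

/-- A bound for the cutoff and its first two derivatives. -/
theorem exists_bound (hχ : IsCutoff χ) : ∃ L : ℝ, 1 ≤ L ∧ (∀ x, |χ x| ≤ L) ∧
    (∀ x, |deriv χ x| ≤ L) ∧ ∀ x, |deriv (deriv χ) x| ≤ L := by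
  obtain ⟨A, hA⟩ := hχ.hasCompactSupport.exists_bound_of_continuous hχ.smooth.continuous
  obtain ⟨B, hB⟩ := hχ.hasCompactSupport.deriv.exists_bound_of_continuous
    hχ.contDiff_deriv.continuous
  obtain ⟨C, hC⟩ := hχ.hasCompactSupport.deriv.deriv.exists_bound_of_continuous
    (hχ.contDiff_deriv.continuous_deriv (by simp))
  refine ⟨max 1 (max A (max B C)), le_max_left _ _, fun x => (hA x).trans ?_,
    fun x => (hB x).trans ?_, fun x => (hC x).trans ?_⟩ <;> simp

theorem deriv_eq_zero (hχ : IsCutoff χ) {x : ℝ} (hx : 1 ≤ x) : deriv χ x = 0 := by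
  rcases hx.eq_or_lt with rfl | hx
  · have h : Tendsto (deriv χ) (𝓝[>] 1) (𝓝 (deriv χ 1)) :=
      hχ.contDiff_deriv.continuous.continuousAt.tendsto.mono_left nhdsWithin_le_nhds
    refine tendsto_nhds_unique h (tendsto_const_nhds.congr' ?_)
    filter_upwards [self_mem_nhdsWithin] with x hx
    have : χ =ᶠ[𝓝 x] fun _ => 0 := by
      filter_upwards [Ioi_mem_nhds hx] with y hy using hχ.eq_zero (le_of_lt hy)
    rw [this.deriv_eq, deriv_const]
  · have : χ =ᶠ[𝓝 x] fun _ => 0 := by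
      filter_upwards [Ioi_mem_nhds hx] with y hy using hχ.eq_zero (le_of_lt hy)
    rw [this.deriv_eq, deriv_const]

end IsCutoff

theorem abs_sub_le_of_abs_deriv_le {f : ℝ → ℝ} {L : ℝ} (hf : Differentiable ℝ f)
    (hL : ∀ x, |deriv f x| ≤ L) (x y : ℝ) : |f y - f x| ≤ L * |y - x| :=
  convex_univ.norm_image_sub_le_of_norm_deriv_le (fun x _ => hf x) (fun x _ => hL x)
    (Set.mem_univ x) (Set.mem_univ y)

theorem abs_second_difference_le {f : ℝ → ℝ} {L : ℝ} (hf : Differentiable ℝ f)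
    (hf' : Differentiable ℝ (deriv f)) (hL : ∀ x, |deriv (deriv f) x| ≤ L) (x : ℝ) {u : ℝ}
    (hu : 0 ≤ u) : |(f (x + u) - f (x + u + u)) - (f x - f (x + u))| ≤ L * u * u := by
  have hd : Differentiable ℝ fun y => f y - f (y + u) :=
    hf.sub (hf.comp (differentiable_id.add_const u))
  have hder : ∀ y, deriv (fun y => f y - f (y + u)) y = deriv f y - deriv f (y + u) := by
    intro y
    have h := ((hf y).hasDerivAt.sub ((hf (y + u)).hasDerivAt.comp_add_const y u)).deriv
    exact h
  have h := abs_sub_le_of_abs_deriv_le (L := L * u) hd (fun y => by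
    rw [hder, abs_sub_comm]
    have := abs_sub_le_of_abs_deriv_le hf' hL y (y + u)
    rwa [add_sub_cancel_left, abs_of_nonneg hu] at this) x (x + u)
  rwa [add_sub_cancel_left, abs_of_nonneg hu] at h

/-- The forward difference of the rescaled cutoff. -/
noncomputable def cutoffDiff (χ : ℝ → ℝ) (R : ℝ) (n : ℕ) : ℝ :=
  χ (n / R) - χ ((n + 1 : ℕ) / R)

/-- The two-variable regularization of the rescaled cutoff. -/
noncomputable def cutoffCorr (χ : ℝ → ℝ) (R : ℝ) (a b : ℕ) : ℝ :=
  ∑ j ∈ Finset.range ⌈R⌉₊, cutoffDiff χ R (a + j) * cutoffDiff χ R (b + j)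

section

variable {χ : ℝ → ℝ} {R : ℝ}

theorem cutoffDiff_eq_zero (hχ : IsCutoff χ) (hR : 0 < R) {n : ℕ} (hn : R ≤ n) :
    cutoffDiff χ R n = 0 := by
  have h1 : 1 ≤ (n : ℝ) / R := (one_le_div hR).2 hn
  have h2 : 1 ≤ ((n + 1 : ℕ) : ℝ) / R := (one_le_div hR).2 (by push_cast; linarith)
  rw [cutoffDiff, hχ.eq_zero h1, hχ.eq_zero h2, sub_zero]

/-- The diagonal sum telescopes. Its end term at `⌈R⌉₊` vanishes because the cutoff is already `0`
there, so stopping the sum at `⌈R⌉₊` loses nothing. -/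
theorem cutoffCorr_sub (hχ : IsCutoff χ) (hR : 0 < R) (a b : ℕ) :
    cutoffCorr χ R a b - cutoffCorr χ R (a + 1) (b + 1) = cutoffDiff χ R a * cutoffDiff χ R b := by
  have h := Finset.sum_range_sub' (fun j => cutoffDiff χ R (a + j) * cutoffDiff χ R (b + j)) ⌈R⌉₊
  have h0 : cutoffDiff χ R (a + ⌈R⌉₊) = 0 := cutoffDiff_eq_zero hχ hR
    ((Nat.le_ceil R).trans (by push_cast; linarith [(Nat.cast_nonneg a : (0 : ℝ) ≤ a)]))
  rw [h0, zero_mul, sub_zero, add_zero, add_zero, Finset.sum_sub_distrib] at h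
  rw [← h, cutoffCorr, cutoffCorr]
  congr 1
  exact Finset.sum_congr rfl fun j _ => by rw [add_right_comm a, add_right_comm b, add_assoc, add_assoc]

theorem cutoffCorr_eq_zero_left (hχ : IsCutoff χ) (hR : 0 < R) {a : ℕ} (ha : R ≤ a) (b : ℕ) :
    cutoffCorr χ R a b = 0 :=
  Finset.sum_eq_zero fun j _ => by
    rw [cutoffDiff_eq_zero hχ hR (ha.trans (by push_cast; linarith [(Nat.cast_nonneg j : (0 : ℝ) ≤ j)])),
      zero_mul]

theorem cutoffCorr_comm (a b : ℕ) : cutoffCorr χ R a b = cutoffCorr χ R b a :=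
  Finset.sum_congr rfl fun _ _ => mul_comm _ _

variable {L : ℝ}

theorem abs_cutoffDiff_le (hχ : IsCutoff χ) (hR : 1 ≤ R) (h1 : ∀ x, |deriv χ x| ≤ L) (n : ℕ) :
    |cutoffDiff χ R n| ≤ L / R := by
  have h := abs_sub_le_of_abs_deriv_le hχ.differentiable h1 ((n + 1 : ℕ) / R) (n / R)
  refine h.trans (le_of_eq ?_)
  rw [← sub_div, abs_div, abs_of_nonneg (by linarith : 0 ≤ R)]
  push_cast
  rw [sub_add_cancel_left, abs_neg, abs_one, mul_one_div]

theorem abs_cutoffDiff_succ_sub_le (hχ : IsCutoff χ) (hR : 1 ≤ R)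
    (h2 : ∀ x, |deriv (deriv χ) x| ≤ L) (n : ℕ) :
    |cutoffDiff χ R (n + 1) - cutoffDiff χ R n| ≤ L / R ^ 2 := by
  have h := abs_second_difference_le hχ.differentiable hχ.differentiable_deriv h2 (n / R)
    (u := 1 / R) (by positivity)
  have e1 : (n : ℝ) / R + 1 / R = ((n + 1 : ℕ) : ℝ) / R := by push_cast; ring
  have e2 : ((n + 1 : ℕ) : ℝ) / R + 1 / R = ((n + 1 + 1 : ℕ) : ℝ) / R := by push_cast; ring
  rw [e1, e2] at h
  refine h.trans (le_of_eq ?_)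
  field_simp

theorem ceil_le_two_mul (hR : 1 ≤ R) : (⌈R⌉₊ : ℝ) ≤ 2 * R := by
  linarith [Nat.ceil_lt_add_one (by linarith : 0 ≤ R)]

theorem abs_cutoffCorr_le (hχ : IsCutoff χ) (hR : 1 ≤ R) (h1 : ∀ x, |deriv χ x| ≤ L) (a b : ℕ) :
    |cutoffCorr χ R a b| ≤ 2 * L ^ 2 / R := by
  have hL : 0 ≤ L := (abs_nonneg _).trans (h1 0)
  have hR0 : 0 < R := by linarith
  calc _ ≤ ∑ j ∈ Finset.range ⌈R⌉₊, L / R * (L / R) := by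
        refine (Finset.abs_sum_le_sum_abs _ _).trans (Finset.sum_le_sum fun j _ => ?_)
        rw [abs_mul]
        exact mul_le_mul (abs_cutoffDiff_le hχ hR h1 _) (abs_cutoffDiff_le hχ hR h1 _)
          (abs_nonneg _) (by positivity)
    _ = ⌈R⌉₊ * (L / R * (L / R)) := by simp
    _ ≤ 2 * R * (L / R * (L / R)) :=
        mul_le_mul_of_nonneg_right (ceil_le_two_mul hR) (by positivity)
    _ = _ := by field_simp

/-- The extra factor `1 / R`, compared with the bound for `cutoffCorr` itself, comes from the second
derivative. It is what makes `shift s - 1` small on the regularization. -/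
theorem abs_cutoffCorr_succ_sub_le (hχ : IsCutoff χ) (hR : 1 ≤ R) (h1 : ∀ x, |deriv χ x| ≤ L)
    (h2 : ∀ x, |deriv (deriv χ) x| ≤ L) (a b : ℕ) :
    |cutoffCorr χ R (a + 1) b - cutoffCorr χ R a b| ≤ 2 * L ^ 2 / R / R := by
  have hL : 0 ≤ L := (abs_nonneg _).trans (h1 0)
  have hR0 : 0 < R := by linarith
  calc _ ≤ ∑ j ∈ Finset.range ⌈R⌉₊, L / R ^ 2 * (L / R) := by
        rw [cutoffCorr, cutoffCorr, ← Finset.sum_sub_distrib]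
        refine (Finset.abs_sum_le_sum_abs _ _).trans (Finset.sum_le_sum fun j _ => ?_)
        rw [← sub_mul, abs_mul, add_right_comm]
        exact mul_le_mul (abs_cutoffDiff_succ_sub_le hχ hR h2 _) (abs_cutoffDiff_le hχ hR h1 _)
          (abs_nonneg _) (by positivity)
    _ = ⌈R⌉₊ * (L / R ^ 2 * (L / R)) := by simp
    _ ≤ 2 * R * (L / R ^ 2 * (L / R)) :=
        mul_le_mul_of_nonneg_right (ceil_le_two_mul hR) (by positivity)
    _ = _ := by field_simp

open MeasureTheory intervalIntegral in
/-- The diagonal value of the regularization is a Riemann sum of `∫ χ'²`. -/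
theorem abs_mul_cutoffCorr_sub_one_le (hχ : IsCutoff χ) (hR : 1 ≤ R)
    (h1 : ∀ x, |deriv χ x| ≤ L) (h2 : ∀ x, |deriv (deriv χ) x| ≤ L) :
    |R * cutoffCorr χ R 0 0 - 1| ≤ 4 * L ^ 2 / R := by
  have hL : 0 ≤ L := (abs_nonneg _).trans (h1 0)
  have hR0 : 0 < R := by linarith
  have hcont : Continuous fun x => deriv χ x ^ 2 := hχ.contDiff_deriv.continuous.pow 2
  set T := ⌈R⌉₊
  have hT : 1 ≤ (T : ℝ) / R := (one_le_div hR0).2 (Nat.le_ceil R)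
  have hint : ∫ x in (0 : ℝ)..(T / R), deriv χ x ^ 2 = 1 := by
    rw [← hχ.integral_eq, integral_of_le (by positivity),
      ← Set.Ioc_union_Ioi_eq_Ioi (a := 0) (b := (T : ℝ) / R) (by positivity)]
    refine (setIntegral_eq_of_subset_of_forall_sdiff_eq_zero
      (measurableSet_Ioc.union measurableSet_Ioi) Set.subset_union_left ?_).symm
    rintro x ⟨hx | hx, hx'⟩
    · exact absurd hx hx'
    · rw [hχ.deriv_eq_zero (hT.trans (le_of_lt hx)), zero_pow two_ne_zero]
  have hsum : ∑ j ∈ Finset.range T, ∫ x in ((j : ℝ) / R)..((j + 1 : ℕ) / R), deriv χ x ^ 2 = 1 := by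
    have := sum_integral_adjacent_intervals (μ := volume) (f := fun x => deriv χ x ^ 2)
      (a := fun j : ℕ => (j : ℝ) / R) (n := T) fun k _ => hcont.intervalIntegrable _ _
    rw [this]
    simpa using hint
  rw [← hsum, cutoffCorr, Finset.mul_sum, ← Finset.sum_sub_distrib]
  have hterm : ∀ j : ℕ, |R * (cutoffDiff χ R (0 + j) * cutoffDiff χ R (0 + j)) -
      ∫ x in ((j : ℝ) / R)..((j + 1 : ℕ) / R), deriv χ x ^ 2| ≤ 2 * L ^ 2 / R * (1 / R) := by
    intro j
    rw [zero_add]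
    have hlt : (j : ℝ) / R < ((j + 1 : ℕ) : ℝ) / R := by
      push_cast; gcongr; linarith
    have hlen : ((j + 1 : ℕ) : ℝ) / R - (j : ℝ) / R = 1 / R := by push_cast; ring
    -- By the mean value theorem the `j`-th term is the integral over its cell of the constant
    -- `deriv χ ξ ^ 2`, so only the oscillation of `deriv χ ^ 2` on a cell of length `1 / R` has to
    -- be bounded.
    obtain ⟨ξ, hξ, hξ'⟩ := exists_deriv_eq_slope χ hlt hχ.smooth.continuous.continuousOn
      hχ.differentiable.differentiableOn
    have hd : cutoffDiff χ R j = -(deriv χ ξ / R) := by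
      rw [hξ', hlen, cutoffDiff]; field_simp; ring
    have hc : R * (cutoffDiff χ R j * cutoffDiff χ R j) =
        ∫ _x in ((j : ℝ) / R)..((j + 1 : ℕ) / R), deriv χ ξ ^ 2 := by
      rw [intervalIntegral.integral_const, hlen, hd, smul_eq_mul]; field_simp
    rw [hc, ← intervalIntegral.integral_sub (by simp) (hcont.intervalIntegrable _ _)]
    have := intervalIntegral.norm_integral_le_of_norm_le_const (a := (j : ℝ) / R)
      (b := ((j + 1 : ℕ) : ℝ) / R) (f := fun x => deriv χ ξ ^ 2 - deriv χ x ^ 2)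
      (C := 2 * L ^ 2 / R) ?_
    · rwa [hlen, abs_of_nonneg (by positivity)] at this
    · intro x hx
      rw [Set.uIoc_of_le hlt.le] at hx
      rw [Real.norm_eq_abs, sq_sub_sq, abs_mul]
      have ha : |deriv χ ξ + deriv χ x| ≤ 2 * L :=
        (abs_add_le _ _).trans (by linarith [h1 ξ, h1 x])
      have hb : |deriv χ ξ - deriv χ x| ≤ L * (1 / R) := by
        refine (abs_sub_le_of_abs_deriv_le hχ.differentiable_deriv h2 x ξ).trans ?_
        refine mul_le_mul_of_nonneg_left ?_ hL
        rw [abs_le]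
        constructor <;> linarith [hx.1, hx.2, hξ.1, hξ.2]
      calc _ ≤ 2 * L * (L * (1 / R)) := mul_le_mul ha hb (abs_nonneg _) (by positivity)
        _ = _ := by ring
  calc _ ≤ ∑ j ∈ Finset.range T, 2 * L ^ 2 / R * (1 / R) :=
        (Finset.abs_sum_le_sum_abs _ _).trans (Finset.sum_le_sum fun j _ => hterm j)
    _ = T * (2 * L ^ 2 / R * (1 / R)) := by simp
    _ ≤ 2 * R * (2 * L ^ 2 / R * (1 / R)) :=
        mul_le_mul_of_nonneg_right (ceil_le_two_mul hR) (by positivity)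
    _ = _ := by field_simp; ring

end

open MeasureTheory in
-- A bump function is divided by the square root of `∫ f'²` over the half-line. This integral is
-- positive since `f` falls from `1` at `0` to `0` at `2`, which forces a point with nonzero
-- derivative.
theorem exists_isCutoff : ∃ χ : ℝ → ℝ, IsCutoff χ := by
  let f : ContDiffBump (0 : ℝ) := ⟨1 / 2, 1, by norm_num, by norm_num⟩
  have hf : ContDiff ℝ ∞ f := f.contDiff
  have hsupp : Function.support f ⊆ Set.Icc (-1) 1 := by
    rw [f.support_eq]
    intro x hx
    rw [Metric.mem_ball, dist_zero_right, Real.norm_eq_abs, abs_lt] at hx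
    exact ⟨hx.1.le, hx.2.le⟩
  have hf0 : f 0 = 1 := f.one_of_mem_closedBall (by simp [f])
  have hf2 : f 2 = 0 := by
    by_contra h
    have := (hsupp (Function.mem_support.2 h)).2
    norm_num at this
  have hcs : HasCompactSupport f := f.hasCompactSupport
  have hd : Continuous (deriv f) := hf.continuous_deriv (by simp)
  have hpos : 0 < ∫ x in Set.Ioi (0 : ℝ), deriv f x ^ 2 := by
    obtain ⟨ξ, hξ, hξ'⟩ := exists_deriv_eq_slope f (zero_lt_two' ℝ) hf.continuous.continuousOn
      (hf.differentiable (by simp)).differentiableOn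
    have hint : Integrable fun x => deriv f x ^ 2 :=
      (hd.pow 2).integrable_of_hasCompactSupport (by
        simpa [sq] using hcs.deriv.mul_left (f := deriv f))
    rw [setIntegral_pos_iff_support_of_nonneg_ae (Eventually.of_forall fun x => sq_nonneg _)
      hint.integrableOn]
    have ho : IsOpen ((Function.support fun x => deriv f x ^ 2) ∩ Set.Ioi 0) :=
      ((hd.pow 2).isOpen_support).inter isOpen_Ioi
    refine ho.measure_pos _ ⟨ξ, ?_, hξ.1⟩
    rw [Function.mem_support, hξ', hf2, hf0]
    norm_num
  set I := ∫ x in Set.Ioi (0 : ℝ), deriv f x ^ 2 with hI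
  refine ⟨fun x => (Real.sqrt I)⁻¹ * f x, contDiff_const.mul hf, ?_, ?_, ?_⟩
  · exact (Function.support_mul_subset_right _ _).trans hsupp
  · rw [hf0, mul_one]; exact inv_pos.2 (Real.sqrt_pos.2 hpos)
  · have : ∀ x, deriv (fun x => (Real.sqrt I)⁻¹ * f x) x ^ 2 = I⁻¹ * deriv f x ^ 2 := by
      intro x
      rw [deriv_const_mul _ ((hf.differentiable (by simp)) x), mul_pow, inv_pow, Real.sq_sqrt hpos.le]
    simp_rw [this]
    rw [integral_const_mul, ← hI, inv_mul_cancel₀ hpos.ne']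

end Cutoff

/-! ### Asymptotics of the abstract sieve sum -/

section Sieve

variable {κ : Type*}

set_option maxHeartbeats 1000000 in
/-- The asymptotic formula for the multidimensional truncated sieve sum with local densities `c`. -/
theorem exists_abs_sieveSum_sub_le {χ : ℝ → ℝ} (hχ : IsCutoff χ) (m : ℕ) [DecidableEq κ]
    (n : κ → ℕ) (p : κ → ℝ) (hp0 : ∀ P, 0 ≤ p P) (hp : ∀ P, p P ≤ 1 / 2) :
    ∃ M : ℝ, 0 ≤ M ∧ ∀ S : Finset κ, ∃ K : ℝ, 0 ≤ K ∧
      ∀ (T : Finset κ) (c : κ → Finset (Fin m) → ℝ) (e : κ → ℝ), S ⊆ T →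
      (∀ P ∈ T, c P ∅ = 1) → (∀ P ∈ S, ∀ C : Finset (Fin m), C.Nonempty → c P C = 0) →
      (∀ P ∈ T, P ∉ S → ∀ i, c P {i} = p P) → (∀ P ∈ T, P ∉ S → ∀ C, |c P C| ≤ 1) →
      (∀ P ∈ T, P ∉ S → ∀ C, 2 ≤ C.card → |c P C| ≤ e P) →
      (∀ P ∈ T, P ∉ S → p P ^ 2 ≤ e P) →
      ∀ (R L : ℝ) (N : ℕ), 1 ≤ R → R ≤ N →
      (X : ℝ[X]) ^ N ∣ ∏ P ∈ T, (1 - C (p P) * X ^ n P) - (1 - X) →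
      (∀ U, U ⊆ T → Disjoint U S → ∑ P ∈ U, e P ≤ L) →
      |R ^ m * (∏ P ∈ S, (1 - p P)) ^ m * (∑ B : T → Finset (Fin m × Bool),
        (∏ P : T, ((-1) ^ (B P).card * c P ((B P).image Prod.fst))) *
          ∏ s, χ ((∑ P : T, if s ∈ B P then n P else 0 : ℕ) / R)) -
        (R * cutoffCorr χ R 0 0) ^ m| ≤
      (Real.exp (40 * 64 ^ m * L) - 1) * M + Real.exp (40 * 64 ^ m * L) * (K / R) := by
  obtain ⟨L₀, hL1, hb0, hb1, hb2⟩ := hχ.exists_bound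
  set D : ℝ := 2 * L₀ ^ 2 with hD
  have hD0 : 0 ≤ D := by positivity
  -- `D ^ m` bounds `R ^ m * ‖F'‖`. It does not involve `S`, whereas `K` does and is only controlled
  -- after division by `R`.
  refine ⟨D ^ m, by positivity, fun S => ?_⟩
  obtain ⟨K, hK0, hK⟩ := exists_norm_euler_prod_smul_sub_le (𝒜 := ShiftAlg (Fin m × Bool))
    (E := BddFun (Fin m × Bool)) (m := m) (Z := shift) norm_shift_le S n p hp0 hp
  refine ⟨K * D ^ m, by positivity, ?_⟩
  intro T c e hST hc0 hcS hc1 hcle hc2 he R L N hR hRN hpoly hL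
  have hR0 : 0 < R := by linarith
  let f : BddFun (Fin m × Bool) := mkBdd (fun x => ∏ s, χ (x s / R)) (∏ _s : Fin m × Bool, L₀) (by
    intro x
    rw [Real.norm_eq_abs, Finset.abs_prod]
    exact Finset.prod_le_prod (fun _ _ => abs_nonneg _) fun s _ => hb0 _)
  have hFb : ∀ x : Fin m × Bool → ℕ, |∏ i : Fin m, cutoffCorr χ R (x (i, false)) (x (i, true))| ≤
      (D / R) ^ m := by
    intro x
    rw [Finset.abs_prod]
    refine (Finset.prod_le_prod (fun _ _ => abs_nonneg _) fun i _ =>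
      abs_cutoffCorr_le hχ hR hb1 _ _).trans ?_
    simp [hD, div_pow]
  let F' : BddFun (Fin m × Bool) := mkBdd
    (fun x => ∏ i : Fin m, cutoffCorr χ R (x (i, false)) (x (i, true))) ((D / R) ^ m) hFb
  have hFa : ∀ x, F' x = ∏ i : Fin m, cutoffCorr χ R (x (i, false)) (x (i, true)) := fun _ => rfl
  have hF : ‖F'‖ ≤ (D / R) ^ m := BddFun.norm_le (by positivity) hFb
  have hdiff : ∀ s : Fin m × Bool, ‖(shift s - 1) • F'‖ ≤ (D / R) ^ m / R := by
    rintro ⟨i, b⟩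
    refine BddFun.norm_le (by positivity) fun x => ?_
    rw [sub_smul, one_smul, BddFun.sub_apply, shift_smul_apply, hFa, hFa]
    rw [← Finset.mul_prod_erase _ _ (Finset.mem_univ i), ← Finset.mul_prod_erase Finset.univ
      (fun j : Fin m => cutoffCorr χ R (x (j, false)) (x (j, true))) (Finset.mem_univ i)]
    have h1 : ∏ j ∈ Finset.univ.erase i, cutoffCorr χ R
        ((x + Pi.single (i, b) 1 : Fin m × Bool → ℕ) (j, false)) ((x + Pi.single (i, b) 1 : Fin m × Bool → ℕ) (j, true)) =
        ∏ j ∈ Finset.univ.erase i, cutoffCorr χ R (x (j, false)) (x (j, true)) := by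
      refine Finset.prod_congr rfl fun j hj => ?_
      have := Finset.ne_of_mem_erase hj
      simp [this]
    rw [h1, ← sub_mul, abs_mul]
    have h2 : |cutoffCorr χ R ((x + Pi.single (i, b) 1 : Fin m × Bool → ℕ) (i, false))
        ((x + Pi.single (i, b) 1 : Fin m × Bool → ℕ) (i, true)) - cutoffCorr χ R (x (i, false)) (x (i, true))| ≤
        D / R / R := by
      cases b
      · simpa using abs_cutoffCorr_succ_sub_le hχ hR hb1 hb2 (x (i, false)) (x (i, true))
      · rw [cutoffCorr_comm, cutoffCorr_comm (x (i, false))]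
        simpa using abs_cutoffCorr_succ_sub_le hχ hR hb1 hb2 (x (i, true)) (x (i, false))
    have h3 : |∏ j ∈ Finset.univ.erase i, cutoffCorr χ R (x (j, false)) (x (j, true))| ≤
        (D / R) ^ (m - 1) := by
      rw [Finset.abs_prod]
      refine (Finset.prod_le_prod (fun _ _ => abs_nonneg _) fun i _ =>
        abs_cutoffCorr_le hχ hR hb1 _ _).trans ?_
      simp [hD, div_pow]
    have hm : m = m - 1 + 1 := by have := i.pos; omega
    calc _ ≤ D / R / R * (D / R) ^ (m - 1) :=
          mul_le_mul h2 h3 (abs_nonneg _) (by positivity)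
      _ = (D / R) ^ m / R := by conv_rhs => rw [hm, pow_succ]
                                ring
  have hvan : ∀ (s : Fin m × Bool) (G : BddFun (Fin m × Bool)),
      (∀ x, R ≤ x s → G x = 0) → shift s ^ N • G = 0 := by
    intro s G hG
    refine BddFun.ext fun x => ?_
    rw [shift_pow_smul_apply, BddFun.zero_apply]
    apply hG
    simp only [Pi.add_apply, Pi.single_eq_same]
    push_cast
    linarith [(Nat.cast_nonneg (x s) : (0 : ℝ) ≤ x s)]
  -- The zeta identity collapses both products over `T`: each slot contributes `1 - shift` on `f`
  -- and each pair of slots `1 - shift * shift` on `F'`. The two results agree by the difference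
  -- equation for `cutoffCorr`.
  have hfF : (∏ P ∈ T, numOp (p P) (fun s : Fin m × Bool => shift s ^ n P)) • f =
      (∏ P ∈ T, denOp (p P) (fun s : Fin m × Bool => shift s ^ n P)) • F' := by
    unfold numOp denOp
    simp_rw [← mul_pow]
    rw [prod_prod_one_sub_smul_eq hpoly Finset.univ (fun s : Fin m × Bool => shift s) f,
      prod_prod_one_sub_smul_eq hpoly Finset.univ
        (fun i : Fin m => shift (i, false) * shift (i, true)) F']
    · exact prod_one_sub_shift_smul_eq (g := fun a => χ (a / R)) (ρ := cutoffCorr χ R)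
        (fun a b => by rw [cutoffCorr_sub hχ hR0]; rfl) (fun _ => rfl) (fun _ => rfl)
    · intro i _
      rw [mul_pow, mul_comm, mul_smul, hvan (i, false) F', smul_zero]
      intro x hx
      rw [hFa]
      exact Finset.prod_eq_zero (Finset.mem_univ i) (cutoffCorr_eq_zero_left hχ hR0 hx _)
    · intro s _
      refine hvan s f fun x hx => ?_
      change ∏ _, _ = _
      exact Finset.prod_eq_zero (Finset.mem_univ s) (hχ.eq_zero ((one_le_div hR0).2 hx))
  have main := hK T c e hST hc0 hcS hc1 hcle hc2 he f F' _ _ L hfF hF hdiff hL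
  have hev := (BddFun.norm_apply_le _ 0).trans main
  rw [BddFun.sub_apply, BddFun.smul_apply, prod_eulerOp_smul_apply_zero] at hev
  have hF0 : F' 0 = cutoffCorr χ R 0 0 ^ m := by
    rw [hFa]
    simp
  rw [hF0] at hev
  change |_ * (∑ B : T → Finset (Fin m × Bool), _ *
    ∏ s, χ ((∑ P : T, if s ∈ B P then n P else 0 : ℕ) / R)) - _| ≤ _ at hev
  have hRm : 0 < R ^ m := by positivity
  have := mul_le_mul_of_nonneg_left hev hRm.le
  rw [← abs_of_pos hRm, ← abs_mul, abs_of_pos hRm, mul_sub, ← mul_assoc, ← mul_pow _ (cutoffCorr χ R 0 0)] at this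
  refine this.trans (le_of_eq ?_)
  rw [div_pow]
  field_simp

end Sieve


/-! ### Primes of the polynomial ring and their norms -/

/-- The monic irreducible polynomials. -/
abbrev MonicIrr (F : Type*) [Field F] : Type _ := {P : F[X] // P.Monic ∧ Irreducible P}

section Primes

variable {F : Type*} [Field F]

namespace MonicIrr

variable (P Q : MonicIrr F)

theorem monic : P.1.Monic := P.2.1

theorem irreducible : Irreducible P.1 := P.2.2

theorem prime : Prime P.1 := P.2.2.prime

/-- The degree of a monic irreducible polynomial. -/
noncomputable def deg : ℕ := P.1.natDegree

theorem deg_pos : 0 < P.deg := P.irreducible.natDegree_pos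

theorem isCoprime {P Q : MonicIrr F} (h : P ≠ Q) : IsCoprime P.1 Q.1 := by
  rw [P.irreducible.coprime_iff_not_dvd]
  intro hd
  exact h (Subtype.ext (eq_of_monic_of_associated P.monic Q.monic
    (P.irreducible.associated_of_dvd Q.irreducible hd)))

theorem prod_dvd_iff (S : Finset (MonicIrr F)) (f : F[X]) :
    ∏ P ∈ S, P.1 ∣ f ↔ ∀ P ∈ S, P.1 ∣ f := by
  refine ⟨fun h P hP => (Finset.dvd_prod_of_mem _ hP).trans h, fun h => ?_⟩
  exact Finset.prod_dvd_of_coprime (fun P _ Q _ hPQ => isCoprime hPQ) h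

theorem dvd_prod_iff (S : Finset (MonicIrr F)) : P.1 ∣ ∏ Q ∈ S, Q.1 ↔ P ∈ S := by
  refine ⟨fun h => ?_, fun h => Finset.dvd_prod_of_mem _ h⟩
  obtain ⟨Q, hQ, hd⟩ := P.prime.exists_mem_finset_dvd h
  by_contra hP
  have : P ≠ Q := fun h => hP (h ▸ hQ)
  exact P.irreducible.not_isUnit ((isCoprime this).isUnit_of_dvd' dvd_rfl hd)

theorem monic_prod (S : Finset (MonicIrr F)) : (∏ P ∈ S, P.1).Monic :=
  monic_prod_of_monic _ _ fun P _ => P.monic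

theorem natDegree_prod (S : Finset (MonicIrr F)) :
    (∏ P ∈ S, P.1).natDegree = ∑ P ∈ S, P.deg :=
  natDegree_prod_of_monic _ _ fun P _ => P.monic

theorem moebius_prod (S : Finset (MonicIrr F)) :
    UniqueFactorizationMonoid.moebius (∏ P ∈ S, P.1) = (-1) ^ S.card := by
  classical
  induction S using Finset.induction_on with
  | empty => simp
  | insert P S hP ih =>
    rw [Finset.prod_insert hP, Finset.card_insert_of_notMem hP, IsRelPrime.moebius_mul, ih,
      P.irreducible.moebius_eq, pow_succ']
    refine (IsCoprime.prod_right fun Q hQ => isCoprime ?_).isRelPrime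
    rintro rfl
    exact hP hQ

theorem exists_dvd {f : F[X]} (hf : ¬ IsUnit f) : ∃ P : MonicIrr F, P.1 ∣ f := by
  obtain ⟨P, hP, hi, hd⟩ := exists_monic_irreducible_factor f hf
  exact ⟨⟨P, hP, hi⟩, hd⟩

end MonicIrr

variable (F) [Fintype F]

open scoped Classical in
/-- The monic irreducible polynomials of degree less than `N`. -/
noncomputable def primesLT (N : ℕ) : Finset (MonicIrr F) :=
  (polysLT F N).subtype fun P => P.Monic ∧ Irreducible P

variable {F}

theorem mem_primesLT {N : ℕ} {P : MonicIrr F} : P ∈ primesLT F N ↔ P.deg < N := by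
  classical
  rw [primesLT, Finset.mem_subtype, mem_polysLT, degree_eq_natDegree P.monic.ne_zero, Nat.cast_lt]
  rfl

theorem primesLT_mono {M N : ℕ} (h : M ≤ N) : primesLT F M ⊆ primesLT F N := fun _ hP =>
  mem_primesLT.2 ((mem_primesLT.1 hP).trans_le h)

theorem polyPrimorial_eq (w : ℕ) : polyPrimorial F w = ∏ P ∈ primesLT F w, P.1 := by
  classical
  rw [polyPrimorial, primesLT, Finset.prod_subtype_eq_prod_filter (fun x : F[X] => x)]

theorem card_polysLT (N : ℕ) : (polysLT F N).card = Fintype.card F ^ N := by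
  classical
  rw [polysLT, Finset.card_image_of_injective, Finset.card_univ, Fintype.card_fun, Fintype.card_fin]
  exact fun a b h => (degreeLTEquiv F N).symm.injective (Subtype.ext h)

theorem two_le_card : 2 ≤ Fintype.card F := Fintype.one_lt_card

/-- The inverse norm of a prime. -/
noncomputable def invNorm (P : MonicIrr F) : ℝ := ((Fintype.card F : ℝ) ^ P.deg)⁻¹

theorem invNorm_pos (P : MonicIrr F) : 0 < invNorm P := by
  have : (0 : ℝ) < Fintype.card F := by exact_mod_cast Fintype.card_pos
  unfold invNorm; positivity

theorem invNorm_le_half_pow (P : MonicIrr F) : invNorm P ≤ (1 / 2) ^ P.deg := by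
  have h2 : (2 : ℝ) ≤ Fintype.card F := by exact_mod_cast two_le_card
  rw [invNorm, one_div, inv_pow]
  gcongr

theorem invNorm_le_half (P : MonicIrr F) : invNorm P ≤ 1 / 2 :=
  (invNorm_le_half_pow P).trans (pow_le_of_le_one (by norm_num) (by norm_num) P.deg_pos.ne')

/-- Removing the leading term injects the primes of degree `n` into the polynomials of degree less
than `n`. -/
theorem card_filter_deg_le (U : Finset (MonicIrr F)) (n : ℕ) :
    (U.filter fun P => P.deg = n).card ≤ Fintype.card F ^ n := by
  rw [← card_polysLT n]
  refine Finset.card_le_card_of_injOn (fun P => P.1 - X ^ n) ?_ ?_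
  · intro P hP
    have hd : P.1.natDegree = n := (Finset.mem_filter.1 hP).2
    rw [Finset.mem_coe, mem_polysLT]
    have h1 : P.1.degree = n := (degree_eq_iff_natDegree_eq P.monic.ne_zero).2 hd
    rw [← h1]
    refine degree_sub_lt_left (by rw [h1, degree_X_pow]) P.monic.ne_zero ?_
    rw [P.monic.leadingCoeff, leadingCoeff_X_pow]
  · intro P _ Q _ h
    exact Subtype.ext (sub_left_injective h)

/-- The sum of the inverse squares of the norms of primes of large degree is small. -/
theorem sum_invNorm_sq_le (U : Finset (MonicIrr F)) (w : ℕ) (hU : ∀ P ∈ U, w ≤ P.deg) :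
    ∑ P ∈ U, invNorm P ^ 2 ≤ 2 * (1 / 2) ^ w := by
  have hq : (0 : ℝ) < Fintype.card F := by exact_mod_cast Fintype.card_pos
  have h2 : (2 : ℝ) ≤ Fintype.card F := by exact_mod_cast two_le_card
  obtain ⟨M, hM⟩ : ∃ M : ℕ, ∀ P ∈ U, P.deg < w + M :=
    ⟨U.sup MonicIrr.deg + 1, fun P hP => by
      have := Finset.le_sup (f := MonicIrr.deg) hP
      omega⟩
  have hmaps : ∀ P ∈ U, P.deg ∈ Finset.Ico w (w + M) := fun P hP =>
    Finset.mem_Ico.2 ⟨hU P hP, hM P hP⟩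
  rw [← Finset.sum_fiberwise_of_maps_to hmaps]
  calc _ ≤ ∑ n ∈ Finset.Ico w (w + M), (1 / 2 : ℝ) ^ n := by
        refine Finset.sum_le_sum fun n _ => ?_
        have h1 : ∀ P ∈ U.filter (fun P => P.deg = n), invNorm P ^ 2 =
            ((Fintype.card F : ℝ) ^ n)⁻¹ ^ 2 := fun P hP => by
          rw [invNorm, (Finset.mem_filter.1 hP).2]
        rw [Finset.sum_congr rfl h1, Finset.sum_const, nsmul_eq_mul]
        have hc : ((U.filter fun P => P.deg = n).card : ℝ) ≤ (Fintype.card F : ℝ) ^ n := by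
          exact_mod_cast card_filter_deg_le U n
        calc _ ≤ (Fintype.card F : ℝ) ^ n * ((Fintype.card F : ℝ) ^ n)⁻¹ ^ 2 := by gcongr
          _ = ((Fintype.card F : ℝ) ^ n)⁻¹ := by field_simp
          _ ≤ _ := by rw [one_div, inv_pow]; gcongr
    _ = (1 / 2) ^ w * ∑ n ∈ Finset.range M, (1 / 2 : ℝ) ^ n := by
        rw [Finset.sum_Ico_eq_sum_range, add_tsub_cancel_left, Finset.mul_sum]
        exact Finset.sum_congr rfl fun n _ => pow_add _ _ _
    _ ≤ _ := by
        rw [mul_comm 2]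
        refine mul_le_mul_of_nonneg_left ?_ (by positivity)
        rw [geom_sum_eq (by norm_num)]
        have : (0 : ℝ) < (1 / 2) ^ M := by positivity
        rw [div_le_iff_of_neg (by norm_num)]
        linarith

end Primes

/-! ### The zeta function as a truncated polynomial identity -/

section PrimeProduct

variable {F : Type*} [Field F] [Fintype F]

open scoped Classical in
/-- The number of monic polynomials of degree `n` divisible by a monic `D`. -/
theorem card_filter_dvd {D : F[X]} (hD : D.Monic) (n : ℕ) :
    (((polysLT F n).filter fun g => D ∣ X ^ n + g).card : ℝ) =
      if D.natDegree ≤ n then (Fintype.card F : ℝ) ^ (n - D.natDegree) else 0 := by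
  classical
  have hmon : ∀ {k : ℕ} {g : F[X]}, g ∈ polysLT F k → (X ^ k + g).Monic := fun hg =>
    monic_X_pow_add (mem_polysLT.1 hg)
  have hdeg : ∀ {k : ℕ} {g : F[X]}, g ∈ polysLT F k → (X ^ k + g).natDegree = k := by
    intro k g hg
    have : (X ^ k + g).degree = (k : WithBot ℕ) := by
      rw [degree_add_eq_left_of_degree_lt (by rw [degree_X_pow]; exact mem_polysLT.1 hg),
        degree_X_pow]
    exact natDegree_eq_of_degree_eq_some this
  split_ifs with h
  · rw [← Nat.cast_pow, Nat.cast_inj, ← card_polysLT]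
    symm
    refine Finset.card_bij (fun g _ => D * (X ^ (n - D.natDegree) + g) - X ^ n) ?_ ?_ ?_
    · intro g hg
      have hM := hD.mul (hmon hg)
      have hN : (D * (X ^ (n - D.natDegree) + g)).natDegree = n := by
        rw [hD.natDegree_mul (hmon hg), hdeg hg]; omega
      refine Finset.mem_filter.2 ⟨mem_polysLT.2 ?_, by rw [add_sub_cancel]; exact dvd_mul_right _ _⟩
      have h1 := (degree_eq_iff_natDegree_eq hM.ne_zero).2 hN
      rw [← h1]
      refine degree_sub_lt_left (by rw [h1, degree_X_pow]) hM.ne_zero ?_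
      rw [hM.leadingCoeff, leadingCoeff_X_pow]
    · intro g _ g' _ h
      exact add_left_cancel (mul_left_cancel₀ hD.ne_zero (sub_left_injective h))
    · intro g hg
      obtain ⟨hg, E, hE⟩ := Finset.mem_filter.1 hg
      have hEm : E.Monic := hD.of_mul_monic_left (hE ▸ hmon hg)
      have hEd : E.natDegree = n - D.natDegree := by
        have := congrArg natDegree hE
        rw [hdeg hg, hD.natDegree_mul hEm] at this
        omega
      refine ⟨E - X ^ (n - D.natDegree), mem_polysLT.2 ?_, ?_⟩
      · have h1 := (degree_eq_iff_natDegree_eq hEm.ne_zero).2 hEd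
        rw [← h1]
        refine degree_sub_lt_left (by rw [h1, degree_X_pow]) hEm.ne_zero ?_
        rw [hEm.leadingCoeff, leadingCoeff_X_pow]
      · simp only [add_sub_cancel]
        rw [← hE, add_sub_cancel_left]
  · rw [Nat.cast_eq_zero, Finset.card_eq_zero, Finset.filter_eq_empty_iff]
    intro g hg hd
    have := natDegree_le_of_dvd hd (hmon hg).ne_zero
    rw [hdeg hg] at this
    exact h this

/-- This is `∑_{d ∣ f} μ(d) = 0` summed over the monic `f = X ^ n + g` of degree `n`. The sum over
subsets of the primes dividing `f` vanishes unless there are none, that is unless `n = 0`; `n < N`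
ensures that every prime factor is available. -/
theorem sum_powerset_neg_one_pow_mul {N n : ℕ} (hn : n < N) :
    ∑ S ∈ (primesLT F N).powerset, (-1 : ℝ) ^ S.card *
      (if ∑ P ∈ S, P.deg ≤ n then (Fintype.card F : ℝ) ^ (n - ∑ P ∈ S, P.deg) else 0) =
      if n = 0 then 1 else 0 := by
  classical
  have h : ∀ S ∈ (primesLT F N).powerset, (-1 : ℝ) ^ S.card *
      (if ∑ P ∈ S, P.deg ≤ n then (Fintype.card F : ℝ) ^ (n - ∑ P ∈ S, P.deg) else 0) =
      ∑ g ∈ polysLT F n, if ∀ P ∈ S, P.1 ∣ X ^ n + g then (-1 : ℝ) ^ S.card else 0 := by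
    intro S _
    rw [← MonicIrr.natDegree_prod, ← card_filter_dvd (MonicIrr.monic_prod S), ← Finset.sum_filter,
      Finset.sum_const, nsmul_eq_mul, mul_comm]
    simp only [MonicIrr.prod_dvd_iff]
  rw [Finset.sum_congr rfl h, Finset.sum_comm]
  have h2 : ∀ g ∈ polysLT F n, ∑ S ∈ (primesLT F N).powerset,
      (if ∀ P ∈ S, P.1 ∣ X ^ n + g then (-1 : ℝ) ^ S.card else 0) =
      if n = 0 then 1 else 0 := by
    intro g hg
    have hm : (X ^ n + g).Monic := monic_X_pow_add (mem_polysLT.1 hg)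
    have hd : (X ^ n + g).degree = (n : WithBot ℕ) := by
      rw [degree_add_eq_left_of_degree_lt (by rw [degree_X_pow]; exact mem_polysLT.1 hg),
        degree_X_pow]
    rw [← Finset.sum_filter]
    have e : (primesLT F N).powerset.filter (fun S => ∀ P ∈ S, P.1 ∣ X ^ n + g) =
        ((primesLT F N).filter fun P => P.1 ∣ X ^ n + g).powerset := by
      ext S
      simp only [Finset.mem_filter, Finset.mem_powerset, Finset.subset_iff]
      exact ⟨fun h P hP => ⟨h.1 hP, h.2 P hP⟩, fun h => ⟨fun P hP => (h hP).1, fun P hP => (h hP).2⟩⟩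
    rw [e]
    have e2 := Finset.sum_powerset_neg_one_pow_card
      (x := (primesLT F N).filter fun P => P.1 ∣ X ^ n + g)
    have e3 : (((primesLT F N).filter fun P => P.1 ∣ X ^ n + g) = ∅) ↔ n = 0 := by
      rw [Finset.filter_eq_empty_iff]
      constructor
      · intro h
        by_contra hn0
        obtain ⟨P, hP⟩ := MonicIrr.exists_dvd (f := X ^ n + g) (fun hu => by
          rw [isUnit_iff_degree_eq_zero, hd] at hu
          exact hn0 (by exact_mod_cast hu))
        refine h (mem_primesLT.2 (lt_of_le_of_lt ?_ hn)) hP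
        have := natDegree_le_of_dvd hP hm.ne_zero
        rwa [natDegree_eq_of_degree_eq_some hd] at this
      · rintro rfl P _ hP
        have : IsUnit (X ^ 0 + g) := by rw [isUnit_iff_degree_eq_zero, hd]; rfl
        exact P.irreducible.not_isUnit (isUnit_of_dvd_unit hP this)
    have e4 := congrArg (fun z : ℤ => (z : ℝ)) e2
    push_cast at e4
    rw [e4]
    simp only [e3]
  rw [Finset.sum_congr rfl h2, Finset.sum_const, card_polysLT]
  split_ifs with h0
  · simp [h0]
  · simp

/-- The truncated product of the local zeta factors. -/
theorem X_pow_dvd_prod_primesLT (N : ℕ) :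
    (X : ℝ[X]) ^ N ∣ ∏ P ∈ primesLT F N, (1 - C (invNorm P) * X ^ P.deg) - (1 - X) := by
  classical
  set q : ℝ := (Fintype.card F : ℝ)
  have hq : q ≠ 0 := by simp [q]
  -- `a d` is the sum of the Möbius function over products of degree `d` of distinct primes from
  -- `primesLT F N`; up to the factor `q ^ d` it is the coefficient of `X ^ d`.
  set a : ℕ → ℝ := fun d => ∑ S ∈ (primesLT F N).powerset,
    if ∑ P ∈ S, P.deg = d then (-1 : ℝ) ^ S.card else 0 with ha
  have hA : ∀ n < N, ∑ d ∈ Finset.range (n + 1), a d * q ^ (n - d) = if n = 0 then 1 else 0 := by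
    intro n hn
    rw [← sum_powerset_neg_one_pow_mul (F := F) hn]
    simp only [ha, Finset.sum_mul]
    rw [Finset.sum_comm]
    refine Finset.sum_congr rfl fun S _ => ?_
    simp only [ite_mul, zero_mul]
    rw [Finset.sum_ite_eq]
    simp only [Finset.mem_range, Nat.lt_succ_iff]
    split_ifs <;> simp [q]
  -- Subtracting `q` times the convolution identity at `n` from the one at `n + 1` isolates `a (n +
  -- 1)`: it is `-q` for `n = 0` and `0` otherwise.
  have hrec : ∀ n, n + 1 < N → a (n + 1) = (if n + 1 = 0 then 1 else 0) - q * if n = 0 then 1 else 0 := by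
    intro n hn
    rw [← hA n (by omega), ← hA (n + 1) hn, Finset.sum_range_succ _ (n + 1), Finset.mul_sum]
    rw [Nat.sub_self, pow_zero, mul_one]
    have : ∀ d ∈ Finset.range (n + 1), a d * q ^ (n + 1 - d) = q * (a d * q ^ (n - d)) := by
      intro d hd
      have : n + 1 - d = n - d + 1 := by have := Finset.mem_range.1 hd; omega
      rw [this, pow_succ]; ring
    rw [Finset.sum_congr rfl this]
    ring
  rw [X_pow_dvd_iff]
  intro d hd
  have hcoef : (∏ P ∈ primesLT F N, (1 - C (invNorm P) * X ^ P.deg)).coeff d = a d * (q ^ d)⁻¹ := by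
    rw [Finset.prod_sub, finsetSum_coeff, ha, Finset.sum_mul]
    refine Finset.sum_congr rfl fun S _ => ?_
    rw [Finset.prod_const_one, mul_one, Finset.prod_mul_distrib, Finset.prod_pow_eq_pow_sum,
      ← map_prod]
    have : ((-1 : ℝ[X]) ^ S.card) = C ((-1) ^ S.card) := by simp
    rw [this, ← mul_assoc, ← C_mul, coeff_C_mul_X_pow]
    simp only [eq_comm (a := d)]
    split_ifs with h
    · rw [← h, ← Finset.prod_pow_eq_pow_sum, ← Finset.prod_inv_distrib]
      rfl
    · simp
  rw [coeff_sub, hcoef, coeff_sub, coeff_one, coeff_X]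
  rcases d with _ | n
  · have := hA 0 hd
    simp at this
    simp [this]
  · rw [hrec n hd]
    rcases n with _ | n
    · simp [hq]
    · simp

end PrimeProduct

/-! ### Divisor sums as sums over sets of primes -/

section DivisorSums

variable {F : Type*} [Field F] [Fintype F]

open scoped Classical in
/-- The truncated divisor sum as a sum over finite sets of primes. -/
theorem divisorSum_eq_sum_powerset {χ : ℝ → ℝ} (hχ : IsCutoff χ) {R : ℝ} (hR : 0 < R) {N : ℕ}
    (hN : R ≤ N) (f : F[X]) :
    divisorSum χ R f = ∑ S ∈ ((primesLT F N).filter fun P => P.1 ∣ f).powerset,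
      (-1) ^ S.card * χ ((∑ P ∈ S, P.deg : ℕ) / R) := by
  unfold divisorSum
  symm
  -- Only nonzero terms are matched: the Möbius function removes divisors that are not squarefree,
  -- and the cutoff removes sets of total degree at least `R`.
  refine Finset.sum_bij_ne_zero (fun S _ _ => ∏ P ∈ S, P.1) ?_ ?_ ?_ ?_
  · intro S hS h0
    have hdeg : ((∑ P ∈ S, P.deg : ℕ) : ℝ) < R := by
      by_contra h
      exact h0 (by rw [hχ.eq_zero ((one_le_div hR).2 (not_lt.1 h)), mul_zero])
    have hm := MonicIrr.monic_prod S
    refine Finset.mem_filter.2 ⟨mem_polysLT.2 ?_, hm, ?_, ?_⟩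
    · rw [degree_eq_natDegree hm.ne_zero, MonicIrr.natDegree_prod, Nat.cast_lt]
      exact Nat.lt_ceil.2 hdeg
    · rw [MonicIrr.prod_dvd_iff]
      exact fun P hP => (Finset.mem_filter.1 (Finset.mem_powerset.1 hS hP)).2
    · rwa [MonicIrr.natDegree_prod]
  · intro S _ _ S' _ _ h
    ext P
    rw [← MonicIrr.dvd_prod_iff, ← MonicIrr.dvd_prod_iff, h]
  · intro d hd h0
    obtain ⟨-, hm, hdf, hdR⟩ := Finset.mem_filter.1 hd
    have hsq : Squarefree d := by
      by_contra h
      exact h0 (by rw [UniqueFactorizationMonoid.moebius_of_not_squarefree h]; simp)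
    have hdN : d.natDegree < N := by exact_mod_cast hdR.trans_le hN
    set S := (primesLT F N).filter fun P => P.1 ∣ d
    have hSd : ∏ P ∈ S, P.1 = d := by
      obtain ⟨h, hh⟩ := (MonicIrr.prod_dvd_iff S d).2 fun P hP => (Finset.mem_filter.1 hP).2
      have hhm : h.Monic := (MonicIrr.monic_prod S).of_mul_monic_left (hh ▸ hm)
      have hu : IsUnit h := by
        by_contra hu
        obtain ⟨P, hP⟩ := MonicIrr.exists_dvd hu
        have hPd : P.1 ∣ d := hP.trans ⟨_, by rw [hh, mul_comm]⟩
        have hPS : P ∈ S := Finset.mem_filter.2 ⟨mem_primesLT.2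
          ((natDegree_le_of_dvd hPd hm.ne_zero).trans_lt hdN), hPd⟩
        exact P.irreducible.not_isUnit
          (hsq P.1 (hh ▸ mul_dvd_mul ((P.dvd_prod_iff S).2 hPS) hP))
      rw [hh, hhm.eq_one_of_isUnit hu, mul_one]
    refine ⟨S, Finset.mem_powerset.2 fun P hP => ?_, ?_, hSd⟩
    · obtain ⟨h1, h2⟩ := Finset.mem_filter.1 hP
      exact Finset.mem_filter.2 ⟨h1, h2.trans hdf⟩
    · rw [← MonicIrr.natDegree_prod, hSd]
      have := MonicIrr.moebius_prod S
      rw [hSd] at this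
      rw [this] at h0
      push_cast at h0
      exact h0
  · intro S _ _
    rw [MonicIrr.moebius_prod, MonicIrr.natDegree_prod]
    push_cast
    rfl

end DivisorSums


/-! ### Averages under homomorphisms and translations -/

section Expectations

/-- Averaging `f (h + θ g)` over both variables can be done in either order, and each order removes
one variable by translation invariance. -/
theorem expect_comp_surjective {G H : Type*} [AddGroup G] [AddGroup H] [Fintype G] [Fintype H]
    (θ : G →+ H) (hθ : Function.Surjective θ) (f : H → ℝ) : 𝔼 g, f (θ g) = 𝔼 h, f h := by
  have h1 : ∀ h : H, 𝔼 g, f (h + θ g) = 𝔼 g, f (θ g) := by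
    intro h
    obtain ⟨g₀, rfl⟩ := hθ h
    exact Fintype.expect_equiv (Equiv.addLeft g₀) _ _ fun g => by simp
  have h2 : ∀ g : G, 𝔼 h, f (h + θ g) = 𝔼 h, f h := fun g =>
    Fintype.expect_equiv (Equiv.addRight (θ g)) _ _ fun h => by simp
  calc 𝔼 g, f (θ g) = 𝔼 h : H, 𝔼 g, f (h + θ g) := by
        rw [Finset.expect_congr rfl fun h _ => h1 h, Fintype.expect_const]
    _ = 𝔼 g, 𝔼 h : H, f (h + θ g) := Finset.expect_comm _ _ _
    _ = _ := by rw [Finset.expect_congr rfl fun g _ => h2 g, Fintype.expect_const]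

theorem expect_pi_prod {σ : Type*} [Fintype σ] [DecidableEq σ] {κ : σ → Type*}
    [∀ i, Fintype (κ i)] (φ : ∀ i, κ i → ℝ) :
    𝔼 x : (∀ i, κ i), ∏ i, φ i (x i) = ∏ i, 𝔼 y, φ i y := by
  simp only [Fintype.expect_eq_sum_div_card]
  rw [Finset.prod_div_distrib, Finset.prod_univ_sum, Fintype.piFinset_univ, Fintype.card_pi]
  push_cast
  rfl

/-- `θ` is an arbitrary map, since each single translate already leaves the average unchanged. This
localizes an average over the whole field to boxes. -/
theorem expect_translate {G : Type*} [AddGroup G] [Fintype G] {H : Type*} [Fintype H] [Nonempty H]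
    (θ : H → G) (f : G → ℝ) : 𝔼 x, f x = 𝔼 x, 𝔼 y, f (x + θ y) := by
  rw [Finset.expect_comm]
  have h : ∀ y, 𝔼 x, f (x + θ y) = 𝔼 x, f x := fun y =>
    Fintype.expect_equiv (Equiv.addRight (θ y)) _ _ fun x => by simp
  rw [Finset.expect_congr rfl fun y _ => h y, Fintype.expect_const]

end Expectations

/-! ### Affine forms over a finite field -/

section FiniteFieldForms

variable {k : Type*} [Field k] [Fintype k] {n : ℕ}

open scoped Classical in
theorem expect_indicator_eq_zero (u : k) (hu : u ≠ 0) (c b : k) :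
    (𝔼 x : k, if u * (x + c) + b = 0 then (1 : ℝ) else 0) = (Fintype.card k : ℝ)⁻¹ := by
  rw [Fintype.expect_eq_sum_div_card, Finset.sum_ite, Finset.sum_const_zero, add_zero,
    Finset.sum_const, nsmul_one, ← one_div]
  congr 1
  rw [Nat.cast_eq_one, Finset.card_eq_one]
  refine ⟨-b / u - c, ?_⟩
  ext x
  simp only [Finset.mem_filter, Finset.mem_univ, true_and, Finset.mem_singleton]
  constructor
  · intro h; field_simp; linear_combination h
  · rintro rfl; field_simp; ring

open scoped Classical in
theorem expect_affine_form (u : k) (hu : u ≠ 0) (c b : k) {l : Fin n → k} {j : Fin n}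
    (hj : l j ≠ 0) :
    (𝔼 v : Fin n → k, if u * (∑ j, l j * v j + c) + b = 0 then (1 : ℝ) else 0) =
      (Fintype.card k : ℝ)⁻¹ := by
  rw [← expect_indicator_eq_zero u hu c b]
  let θ : (Fin n → k) →+ k :=
    { toFun := fun v => ∑ j, l j * v j
      map_zero' := by simp
      map_add' := fun v w => by simp [mul_add, Finset.sum_add_distrib] }
  refine expect_comp_surjective θ (fun x => ⟨Pi.single j (x / l j), ?_⟩)
    (fun x => if u * (x + c) + b = 0 then (1 : ℝ) else 0)
  change ∑ i, l i * (Pi.single j (x / l j) : Fin n → k) i = x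
  rw [Finset.sum_eq_single j (fun i _ hi => by simp [hi]) (by simp)]
  simp only [Pi.single_eq_same]
  field_simp

open scoped Classical in
-- A nonzero minor makes the pair of forms surjective onto `k × k`, with preimages given by Cramer's
-- rule; the two conditions are then independent.
theorem expect_affine_pair (u : k) (hu : u ≠ 0) (c c' b : k) {l l' : Fin n → k} {j j' : Fin n}
    (hj : l j * l' j' - l j' * l' j ≠ 0) :
    (𝔼 v : Fin n → k, if u * (∑ j, l j * v j + c) + b = 0 ∧ u * (∑ j, l' j * v j + c') + b = 0
      then (1 : ℝ) else 0) = (Fintype.card k : ℝ)⁻¹ ^ 2 := by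
  have hjj : j ≠ j' := by rintro rfl; exact hj (by ring)
  have h : (𝔼 x : k × k, if u * (x.1 + c) + b = 0 ∧ u * (x.2 + c') + b = 0
      then (1 : ℝ) else 0) = (Fintype.card k : ℝ)⁻¹ ^ 2 := by
    have h1 : ∀ x : k × k, (if u * (x.1 + c) + b = 0 ∧ u * (x.2 + c') + b = 0
        then (1 : ℝ) else 0) = (if u * (x.1 + c) + b = 0 then 1 else 0) *
          (if u * (x.2 + c') + b = 0 then 1 else 0) := by
      intro x
      split_ifs <;> simp_all
    rw [Finset.expect_congr rfl fun x _ => h1 x, ← Finset.univ_product_univ,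
      Finset.expect_product]
    refine (Finset.expect_mul_expect _ _ (fun x : k => if u * (x + c) + b = 0 then (1 : ℝ) else 0)
      (fun x : k => if u * (x + c') + b = 0 then (1 : ℝ) else 0)).symm.trans ?_
    rw [expect_indicator_eq_zero u hu, expect_indicator_eq_zero u hu, sq]
  rw [← h]
  let θ : (Fin n → k) →+ k × k :=
    { toFun := fun v => (∑ j, l j * v j, ∑ j, l' j * v j)
      map_zero' := by simp
      map_add' := fun v w => by simp [mul_add, Finset.sum_add_distrib] }
  refine expect_comp_surjective θ ?_
    (fun x => if u * (x.1 + c) + b = 0 ∧ u * (x.2 + c') + b = 0 then (1 : ℝ) else 0)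
  rintro ⟨x, y⟩
  set d := l j * l' j' - l j' * l' j with hd
  refine ⟨Pi.single j ((x * l' j' - l j' * y) / d) + Pi.single j' ((l j * y - x * l' j) / d), ?_⟩
  have hs : ∀ f : Fin n → k, ∑ i, f i * ((Pi.single j ((x * l' j' - l j' * y) / d) +
      Pi.single j' ((l j * y - x * l' j) / d) : Fin n → k)) i =
      f j * ((x * l' j' - l j' * y) / d) + f j' * ((l j * y - x * l' j) / d) := by
    intro f
    simp only [Pi.add_apply, mul_add, Finset.sum_add_distrib]
    rw [Finset.sum_eq_single j (fun i _ hi => by simp [hi]) (by simp),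
      Finset.sum_eq_single j' (fun i _ hi => by simp [hi]) (by simp)]
    simp
  refine Prod.ext ?_ ?_
  · refine (hs l).trans ?_
    field_simp; rw [hd]; ring
  · refine (hs l').trans ?_
    field_simp; rw [hd]; ring

end FiniteFieldForms

/-! ### Equidistribution modulo primes and local densities -/

section Residues

variable {F : Type*} [Field F] [Fintype F]

instance (P : MonicIrr F) : Fact (Irreducible P.1) := ⟨P.irreducible⟩

instance (P : MonicIrr F) : Finite (AdjoinRoot P.1) :=
  haveI := P.monic.finite_adjoinRoot
  Module.finite_of_finite F

noncomputable instance (P : MonicIrr F) : Fintype (AdjoinRoot P.1) := Fintype.ofFinite _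

theorem inv_card_adjoinRoot (P : MonicIrr F) : (Fintype.card (AdjoinRoot P.1) : ℝ)⁻¹ = invNorm P := by
  have := P.monic.finite_adjoinRoot
  rw [invNorm, Module.card_eq_pow_finrank (K := F), (AdjoinRoot.powerBasis' P.monic).finrank]
  push_cast
  rfl

instance (H : ℕ) : Finite (degreeLT F H) := Finite.of_equiv _ (degreeLTEquiv F H).symm.toEquiv

noncomputable instance (H : ℕ) : Fintype (degreeLT F H) := Fintype.ofFinite _

/-- Reduction of the coordinates of a vector of polynomials modulo a prime. -/
noncomputable def reduceBox (n H : ℕ) (P : MonicIrr F) :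
    (Fin n → degreeLT F H) →+ (Fin n → AdjoinRoot P.1) where
  toFun y j := AdjoinRoot.mk P.1 (y j : F[X])
  map_zero' := by ext; simp
  map_add' y z := by ext; simp

/-- Vectors in a large box are equidistributed modulo distinct primes, jointly. -/
theorem expect_prod_reduceBox {σ : Type*} [DecidableEq σ] {P : σ → MonicIrr F}
    (hP : Function.Injective P) (U : Finset σ) {n H : ℕ} (hU : ∑ i ∈ U, (P i).deg ≤ H)
    (φ : ∀ i, (Fin n → AdjoinRoot (P i).1) → ℝ) :
    𝔼 y : Fin n → degreeLT F H, ∏ i ∈ U, φ i (reduceBox n H (P i) y) =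
      ∏ i ∈ U, 𝔼 v, φ i v := by
  let θ : (Fin n → degreeLT F H) →+ (∀ i : U, Fin n → AdjoinRoot (P i).1) :=
    { toFun := fun y i => reduceBox n H (P i) y
      map_zero' := by ext; simp
      map_add' := fun y z => by ext; simp }
  have hθ : Function.Surjective θ := by
    intro v
    choose g hg using fun (i : U) (j : Fin n) => AdjoinRoot.mk_surjective (v i j)
    set D := ∏ i ∈ U, (P i).1 with hD
    have hDm : D.Monic := monic_prod_of_monic _ _ fun i _ => (P i).monic
    have hDd : D.natDegree ≤ H := by
      rw [hD, natDegree_prod_of_monic _ _ fun i _ => (P i).monic]; exact hU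
    have hcrt : ∀ j, ∃ r : F[X], ∀ i : U, r - g i j ∈ Ideal.span {(P i).1} := fun j =>
      Ideal.exists_forall_sub_mem_ideal (I := fun i : U => Ideal.span {(P i).1})
        (fun i i' h => (Ideal.isCoprime_span_singleton_iff _ _).2
          (MonicIrr.isCoprime fun h' => h (Subtype.ext (hP h')))) (fun i => g i j)
    choose r hr using hcrt
    -- The Chinese remainder theorem gives a solution of unknown degree; reduction modulo the
    -- product `D` of the primes brings it into the box, as `deg D ≤ H`.
    refine ⟨fun j => ⟨r j %ₘ D, mem_degreeLT.2 ((degree_modByMonic_lt _ hDm).trans_le ?_)⟩, ?_⟩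
    · rw [degree_eq_natDegree hDm.ne_zero]; exact_mod_cast hDd
    · funext i j
      change AdjoinRoot.mk (P i).1 (r j %ₘ D) = v i j
      rw [← hg i j, AdjoinRoot.mk_eq_mk]
      have h1 : (P i).1 ∣ r j - g i j := Ideal.mem_span_singleton.1 (hr j i)
      have h2 : (P i).1 ∣ D := Finset.dvd_prod_of_mem _ i.2
      have h3 : r j %ₘ D - g i j = (r j - g i j) - D * (r j /ₘ D) := by
        linear_combination modByMonic_add_div (r j) D
      rw [h3]
      exact dvd_sub h1 (h2.mul_right _)
  have := expect_comp_surjective θ hθ (fun x => ∏ i : U, φ i (x i))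
  rw [expect_pi_prod (fun i : U => φ i)] at this
  rw [← Finset.prod_coe_sort, ← this]
  refine Finset.expect_congr rfl fun y _ => ?_
  rw [← Finset.prod_coe_sort]
  rfl

variable {m n : ℕ}

open scoped Classical in
/-- The density of the solutions modulo `P` of `W ψ i + b = 0`, `i ∈ C`. -/
noncomputable def localDensity (W b : F[X]) (a : Fin m → Fin n → F[X]) (c : Fin m → F[X])
    (P : MonicIrr F) (C : Finset (Fin m)) : ℝ :=
  𝔼 v : Fin n → AdjoinRoot P.1, if ∀ i ∈ C, AdjoinRoot.mk P.1 W *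
    (∑ j, AdjoinRoot.mk P.1 (a i j) * v j + AdjoinRoot.mk P.1 (c i)) + AdjoinRoot.mk P.1 b = 0
    then 1 else 0

variable {W b : F[X]} {a : Fin m → Fin n → F[X]} {c : Fin m → F[X]} {P : MonicIrr F}

theorem localDensity_empty : localDensity W b a c P ∅ = 1 := by
  simp [localDensity]

theorem localDensity_nonneg (C : Finset (Fin m)) : 0 ≤ localDensity W b a c P C :=
  Finset.expect_nonneg fun v _ => by split_ifs <;> simp

theorem localDensity_mono {C C' : Finset (Fin m)} (h : C ⊆ C') :
    localDensity W b a c P C' ≤ localDensity W b a c P C := by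
  refine Finset.expect_le_expect fun v _ => ?_
  split_ifs with h1 h2 h2
  · exact le_rfl
  · exact absurd (fun i hi => h1 i (h hi)) h2
  · exact zero_le_one
  · exact le_rfl

theorem abs_localDensity_le_one (C : Finset (Fin m)) : |localDensity W b a c P C| ≤ 1 := by
  rw [abs_of_nonneg (localDensity_nonneg C), ← localDensity_empty (W := W) (b := b) (a := a)
    (c := c) (P := P)]
  exact localDensity_mono (Finset.empty_subset C)

/-- Modulo a prime dividing `W` the value `W * ψ + b` is just `b`, which is a unit there. -/
theorem localDensity_eq_zero (hW : P.1 ∣ W) (hb : IsCoprime b W) {C : Finset (Fin m)}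
    (hC : C.Nonempty) : localDensity W b a c P C = 0 := by
  refine Finset.expect_eq_zero fun v _ => if_neg fun h => ?_
  obtain ⟨i, hi⟩ := hC
  have := h i hi
  rw [AdjoinRoot.mk_eq_zero.2 hW, zero_mul, zero_add, AdjoinRoot.mk_eq_zero] at this
  exact P.irreducible.not_isUnit (hb.isUnit_of_dvd' this hW)

theorem localDensity_singleton (hW : ¬ P.1 ∣ W) {i : Fin m} (hi : ∃ j, ¬ P.1 ∣ a i j) :
    localDensity W b a c P {i} = invNorm P := by
  obtain ⟨j, hj⟩ := hi
  rw [← inv_card_adjoinRoot, ← expect_affine_form (AdjoinRoot.mk P.1 W)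
    (by rwa [Ne, AdjoinRoot.mk_eq_zero]) (AdjoinRoot.mk P.1 (c i)) (AdjoinRoot.mk P.1 b)
    (l := fun j => AdjoinRoot.mk P.1 (a i j)) (j := j) (by rwa [Ne, AdjoinRoot.mk_eq_zero])]
  simp [localDensity]

theorem localDensity_pair (hW : ¬ P.1 ∣ W) {i i' : Fin m}
    (hi : ∃ j j', ¬ P.1 ∣ a i j * a i' j' - a i j' * a i' j) :
    localDensity W b a c P {i, i'} = invNorm P ^ 2 := by
  obtain ⟨j, j', hj⟩ := hi
  rw [← inv_card_adjoinRoot, ← expect_affine_pair (AdjoinRoot.mk P.1 W)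
    (by rwa [Ne, AdjoinRoot.mk_eq_zero]) (AdjoinRoot.mk P.1 (c i)) (AdjoinRoot.mk P.1 (c i'))
    (AdjoinRoot.mk P.1 b) (l := fun j => AdjoinRoot.mk P.1 (a i j))
    (l' := fun j => AdjoinRoot.mk P.1 (a i' j)) (j := j) (j' := j')
    (by rwa [Ne, ← map_mul, ← map_mul, ← map_sub, AdjoinRoot.mk_eq_zero])]
  simp [localDensity]

/-- More conditions only lower the density, so two of the forms in `C` suffice for the bound. -/
theorem localDensity_le_of_pair {e : ℝ}
    (h : ∀ i i', i ≠ i' → localDensity W b a c P {i, i'} ≤ e) {C : Finset (Fin m)}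
    (hC : 2 ≤ C.card) : |localDensity W b a c P C| ≤ e := by
  obtain ⟨i, hi, i', hi', hne⟩ := Finset.one_lt_card.1 hC
  rw [abs_of_nonneg (localDensity_nonneg C)]
  refine (localDensity_mono ?_).trans (h i i' hne)
  intro x hx
  rcases Finset.mem_insert.1 hx with rfl | hx
  · exact hi
  · rwa [Finset.mem_singleton.1 hx]

end Residues

/-! ### Box averages of divisor sums -/

section BoxAverage

variable {F : Type*} [Field F] [Fintype F] {m n : ℕ}

/-- Families of subsets as subsets-valued families, transposed. -/
def transposeEquiv (α β : Type*) [Fintype α] [Fintype β] [DecidableEq α] [DecidableEq β] :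
    (α → Finset β) ≃ (β → Finset α) where
  toFun S y := Finset.univ.filter fun x => y ∈ S x
  invFun B x := Finset.univ.filter fun y => x ∈ B y
  left_inv S := by ext x y; simp
  right_inv B := by ext y x; simp

open scoped Classical in
-- Divisibility is moved into an indicator, so that the index set no longer depends on `f` and the
-- average can be exchanged with the sum.
theorem divisorSum_eq_sum_finset {χ : ℝ → ℝ} (hχ : IsCutoff χ) {R : ℝ} (hR : 0 < R) {N : ℕ}
    (hN : R ≤ N) (f : F[X]) :
    divisorSum χ R f = ∑ S : Finset (primesLT F N), (if ∀ P ∈ S, P.1.1 ∣ f then 1 else 0) *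
      ((-1) ^ S.card * χ ((∑ P ∈ S, P.1.deg : ℕ) / R)) := by
  rw [divisorSum_eq_sum_powerset hχ hR hN]
  simp only [ite_mul, one_mul, zero_mul]
  rw [← Finset.sum_filter]
  symm
  refine Finset.sum_bij (fun S _ => S.map (Function.Embedding.subtype _)) ?_ ?_ ?_ ?_
  · intro S hS
    refine Finset.mem_powerset.2 fun P hP => ?_
    obtain ⟨Q, hQ, rfl⟩ := Finset.mem_map.1 hP
    exact Finset.mem_filter.2 ⟨Q.2, (Finset.mem_filter.1 hS).2 Q hQ⟩
  · intro S _ S' _ h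
    exact Finset.map_injective _ h
  · intro S hS
    have hS' := Finset.mem_powerset.1 hS
    refine ⟨S.subtype _, Finset.mem_filter.2 ⟨Finset.mem_univ _, fun P hP => ?_⟩, ?_⟩
    · exact (Finset.mem_filter.1 (hS' (Finset.mem_subtype.1 hP))).2
    · rw [Finset.subtype_map]
      exact Finset.filter_true_of_mem fun P hP => (Finset.mem_filter.1 (hS' hP)).1
  · intro S _
    rw [Finset.card_map, Finset.sum_map]
    rfl

/-- The average of a product of truncated divisor sums over a box as a sieve sum. -/
theorem expect_prod_divisorSum_sq {χ : ℝ → ℝ} (hχ : IsCutoff χ) {R : ℝ} (hR : 0 < R) {N H : ℕ}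
    (hN : R ≤ N) (hH : 2 * m * R ≤ H) (W b : F[X]) (a : Fin m → Fin n → F[X]) (c : Fin m → F[X])
    [DecidableEq (MonicIrr F)] :
    𝔼 y : Fin n → degreeLT F H, ∏ i, divisorSum χ R (W * (∑ j, a i j * (y j : F[X]) + c i) + b) ^ 2 =
      ∑ B : primesLT F N → Finset (Fin m × Bool),
        (∏ P : primesLT F N,
          ((-1) ^ (B P).card * localDensity W b a c P.1 ((B P).image Prod.fst))) *
          ∏ s, χ ((∑ P : primesLT F N, if s ∈ B P then P.1.deg else 0 : ℕ) / R) := by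
  classical
  set f : Fin m → (Fin n → degreeLT F H) → F[X] := fun i y =>
    W * (∑ j, a i j * (y j : F[X]) + c i) + b
  have h1 : ∀ y, ∏ i, divisorSum χ R (f i y) ^ 2 =
      ∑ S : Fin m × Bool → Finset (primesLT F N), (∏ s : Fin m × Bool,
        (if ∀ P ∈ S s, P.1.1 ∣ f s.1 y then (1 : ℝ) else 0)) *
          ∏ s, ((-1) ^ (S s).card * χ ((∑ P ∈ S s, P.1.deg : ℕ) / R)) := by
    intro y
    have : ∏ i, divisorSum χ R (f i y) ^ 2 = ∏ s : Fin m × Bool, divisorSum χ R (f s.1 y) := by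
      rw [Fintype.prod_prod_type]
      exact Finset.prod_congr rfl fun i _ => by rw [Fintype.prod_bool, sq]
    rw [this, Finset.prod_congr rfl fun s _ => divisorSum_eq_sum_finset hχ hR hN (f s.1 y),
      Finset.prod_univ_sum, Fintype.piFinset_univ]
    exact Finset.sum_congr rfl fun S _ => by
      rw [Finset.prod_mul_distrib]
      congr!
  rw [Finset.expect_congr rfl fun y _ => h1 y, Finset.expect_sum_comm]
  -- A set of primes for every slot is transposed into a set of slots for every prime, which is the
  -- form in which the average factors over primes.
  refine Fintype.sum_equiv (transposeEquiv _ _) _ _ fun S => ?_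
  set B := transposeEquiv (Fin m × Bool) (primesLT F N) S with hB
  have hmem : ∀ s P, s ∈ B P ↔ P ∈ S s := by intro s P; simp [hB, transposeEquiv]
  have hdeg : ∀ s, ∑ P : primesLT F N, (if s ∈ B P then P.1.deg else 0) = ∑ P ∈ S s, P.1.deg := by
    intro s
    simp only [hmem]
    rw [Finset.sum_ite_mem, Finset.univ_inter]
  have hsign : ∏ s, (-1 : ℝ) ^ (S s).card = ∏ P, (-1 : ℝ) ^ (B P).card := by
    rw [Finset.prod_pow_eq_pow_sum, Finset.prod_pow_eq_pow_sum]
    congr 1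
    have e1 : ∀ s, (S s).card = ∑ P : primesLT F N, if s ∈ B P then 1 else 0 := by
      intro s
      simp only [hmem]
      rw [Finset.sum_ite_mem, Finset.univ_inter, Finset.card_eq_sum_ones]
    have e2 : ∀ P, (B P).card = ∑ s : Fin m × Bool, if s ∈ B P then 1 else 0 := by
      intro P; simp
    rw [Finset.sum_congr rfl fun s _ => e1 s, Finset.sum_congr rfl fun P _ => e2 P,
      Finset.sum_comm]
  rw [← Finset.expect_mul, Finset.prod_mul_distrib, hsign, Finset.prod_mul_distrib]
  simp only [hdeg]
  -- If some cutoff vanishes, both sides are `0`. Otherwise every slot has degree below `R`, so the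
  -- primes that occur have total degree at most `2 * m * R ≤ H` and are jointly equidistributed in
  -- the box.
  by_cases hz : ∏ s, χ ((∑ P ∈ S s, P.1.deg : ℕ) / R) = 0
  · rw [hz, mul_zero, mul_zero, mul_zero]
  have hlt : ∀ s, ((∑ P ∈ S s, P.1.deg : ℕ) : ℝ) < R := by
    intro s
    by_contra h
    exact hz (Finset.prod_eq_zero (Finset.mem_univ s)
      (hχ.eq_zero ((one_le_div hR).2 (not_lt.1 h))))
  set U : Finset (primesLT F N) := Finset.univ.filter fun P => (B P).Nonempty with hU
  have hUdeg : ∑ P ∈ U, P.1.deg ≤ H := by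
    have h2 : ∑ P ∈ U, P.1.deg ≤ ∑ s, ∑ P ∈ S s, P.1.deg := by
      simp only [← hdeg]
      rw [Finset.sum_comm, hU, Finset.sum_filter]
      refine Finset.sum_le_sum fun P _ => ?_
      split_ifs with hP
      · obtain ⟨s, hs⟩ := hP
        have := Finset.single_le_sum (f := fun s => if s ∈ B P then P.1.deg else 0)
          (fun _ _ => Nat.zero_le _) (Finset.mem_univ s)
        simpa [hs] using this
      · exact Nat.zero_le _
    have h3 : ((∑ s, ∑ P ∈ S s, P.1.deg : ℕ) : ℝ) ≤ 2 * m * R := by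
      push_cast
      refine (Finset.sum_le_sum fun s _ => by exact_mod_cast (hlt s).le).trans ?_
      simp only [Finset.sum_const, Finset.card_univ, Fintype.card_prod, Fintype.card_fin,
        Fintype.card_bool, nsmul_eq_mul]
      push_cast
      rw [mul_comm (m : ℝ) 2]
    have h4 := (Nat.cast_le (α := ℝ).2 h2).trans (h3.trans hH)
    exact_mod_cast h4
  have hind : ∀ y, (∏ s : Fin m × Bool,
      (if ∀ P ∈ S s, P.1.1 ∣ f s.1 y then (1 : ℝ) else 0)) =
      ∏ P ∈ U, (if ∀ i ∈ (B P).image Prod.fst, AdjoinRoot.mk P.1.1 W *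
        (∑ j, AdjoinRoot.mk P.1.1 (a i j) * reduceBox n H P.1 y j + AdjoinRoot.mk P.1.1 (c i)) +
          AdjoinRoot.mk P.1.1 b = 0 then (1 : ℝ) else 0) := by
    intro y
    have hiff : ∀ (P : primesLT F N) i, AdjoinRoot.mk P.1.1 W *
        (∑ j, AdjoinRoot.mk P.1.1 (a i j) * reduceBox n H P.1 y j + AdjoinRoot.mk P.1.1 (c i)) +
          AdjoinRoot.mk P.1.1 b = 0 ↔ P.1.1 ∣ f i y := by
      intro P i
      rw [← AdjoinRoot.mk_eq_zero]
      simp only [f, map_add, map_mul, map_sum]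
      rfl
    simp only [hiff]
    rw [Finset.prod_ite_zero, Finset.prod_ite_zero]
    simp only [Finset.prod_const_one]
    congr 1
    rw [eq_iff_iff]
    constructor
    · intro h P _ i hi
      obtain ⟨s, hs, rfl⟩ := Finset.mem_image.1 hi
      exact h s (Finset.mem_univ s) P ((hmem s P).1 hs)
    · intro h s _ P hP
      have hs := (hmem s P).2 hP
      exact h P (Finset.mem_filter.2 ⟨Finset.mem_univ P, s, hs⟩) s.1 (Finset.mem_image_of_mem _ hs)
  rw [Finset.expect_congr rfl fun y _ => hind y,
    expect_prod_reduceBox (P := fun P : primesLT F N => P.1) Subtype.val_injective U hUdeg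
      (fun P v => if ∀ i ∈ (B P).image Prod.fst, AdjoinRoot.mk P.1.1 W *
        (∑ j, AdjoinRoot.mk P.1.1 (a i j) * v j + AdjoinRoot.mk P.1.1 (c i)) +
          AdjoinRoot.mk P.1.1 b = 0 then (1 : ℝ) else 0)]
  have hden : ∏ P ∈ U, localDensity W b a c P.1 ((B P).image Prod.fst) =
      ∏ P, localDensity W b a c P.1 ((B P).image Prod.fst) := by
    refine Finset.prod_subset (Finset.subset_univ _) fun P _ hP => ?_
    have : B P = ∅ := by
      by_contra h
      exact hP (Finset.mem_filter.2 ⟨Finset.mem_univ P, Finset.nonempty_iff_ne_empty.2 h⟩)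
    rw [this, Finset.image_empty, localDensity_empty]
  rw [← hden]
  unfold localDensity
  ring

end BoxAverage


/-! ### The totient of the primorial -/

section Totient

variable {F : Type*} [Field F] [Fintype F]

theorem polyPrimorial_monic (w : ℕ) : (polyPrimorial F w).Monic := by
  rw [polyPrimorial_eq]; exact MonicIrr.monic_prod _

theorem card_degreeLT (H : ℕ) : Fintype.card (degreeLT F H) = Fintype.card F ^ H := by
  rw [Fintype.card_congr (degreeLTEquiv F H).toEquiv, Fintype.card_fun, Fintype.card_fin]

/-- The proportion of residues coprime to the primorial. -/
theorem polyTotient_div_polyNorm (w : ℕ) :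
    (polyTotient (polyPrimorial F w) : ℝ) / polyNorm (polyPrimorial F w) =
      ∏ P ∈ primesLT F w, (1 - invNorm P) := by
  classical
  set W := polyPrimorial F w with hW
  have hWm : W.Monic := polyPrimorial_monic w
  have hdeg : ∑ P ∈ primesLT F w, P.deg ≤ W.natDegree := by
    rw [hW, polyPrimorial_eq, MonicIrr.natDegree_prod]
  have h := expect_prod_reduceBox (P := fun P : MonicIrr F => P) Function.injective_id
    (primesLT F w) (n := 1) hdeg (fun P v => if v 0 = 0 then (0 : ℝ) else 1)
  have h1 : ∀ P : MonicIrr F, (𝔼 v : Fin 1 → AdjoinRoot P.1, if v 0 = 0 then (0 : ℝ) else 1) =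
      1 - invNorm P := by
    intro P
    have e := expect_affine_form (n := 1) (1 : AdjoinRoot P.1) one_ne_zero 0 0 (l := fun _ => 1)
      (j := 0) one_ne_zero
    rw [inv_card_adjoinRoot] at e
    rw [← e, ← Fintype.expect_one (ι := Fin 1 → AdjoinRoot P.1) (M := ℝ),
      ← Finset.expect_sub_distrib]
    refine Finset.expect_congr rfl fun v _ => ?_
    simp only [Finset.univ_unique, Fin.default_eq_zero, Finset.sum_singleton, one_mul, add_zero]
    split_ifs <;> simp
  rw [Finset.prod_congr rfl fun P _ => h1 P] at h
  rw [← h]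
  have hcop : ∀ g : F[X], IsCoprime g W ↔ ∀ P ∈ primesLT F w, ¬ P.1 ∣ g := by
    intro g
    rw [hW, polyPrimorial_eq, IsCoprime.prod_right_iff]
    refine forall₂_congr fun P _ => ?_
    rw [isCoprime_comm, P.irreducible.coprime_iff_not_dvd]
  have h2 : ∀ y : Fin 1 → degreeLT F W.natDegree,
      ∏ P ∈ primesLT F w, (if reduceBox 1 W.natDegree P y 0 = 0 then (0 : ℝ) else 1) =
      if IsCoprime (y 0 : F[X]) W then 1 else 0 := by
    intro y
    rw [hcop]
    have e : ∀ P : MonicIrr F, reduceBox 1 W.natDegree P y 0 = 0 ↔ P.1 ∣ (y 0 : F[X]) := fun P =>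
      AdjoinRoot.mk_eq_zero
    have e' : ∀ P ∈ primesLT F w, (if reduceBox 1 W.natDegree P y 0 = 0 then (0 : ℝ) else 1) =
        if ¬ P.1 ∣ (y 0 : F[X]) then 1 else 0 := fun P _ => by
      rw [← e P, ite_not]
    rw [Finset.prod_congr rfl e', Finset.prod_ite_zero, Finset.prod_const_one]
    congr
  rw [Finset.expect_congr rfl fun y _ => h2 y,
    Fintype.expect_equiv (Equiv.funUnique (Fin 1) (degreeLT F W.natDegree))
      (fun y => if IsCoprime (y 0 : F[X]) W then (1 : ℝ) else 0)
      (fun g => if IsCoprime (g : F[X]) W then (1 : ℝ) else 0) (fun y => rfl),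
    Fintype.expect_eq_sum_div_card, card_degreeLT, polyNorm, if_neg hWm.ne_zero, ← Finset.sum_filter,
    Finset.sum_const, nsmul_one]
  push_cast
  congr 2
  rw [polyTotient, ← Set.ncard_coe_finset]
  refine (Set.ncard_image_of_injective _ Subtype.val_injective).symm.trans ?_ |>.symm
  congr 1
  ext g
  simp only [Set.mem_ofPred_eq, Set.mem_image, Finset.coe_filter, Finset.mem_univ, true_and,
    Subtype.exists, exists_and_right, exists_eq_right, mem_degreeLT, exists_prop,
    degree_eq_natDegree hWm.ne_zero]

end Totient

/-! ### Sieve weights averaged over a box -/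

section BoxEstimate

variable {F : Type*} [Field F] [Fintype F]

theorem not_dvd_primorial {w : ℕ} {P : MonicIrr F} (h : w ≤ P.deg) : ¬ P.1 ∣ polyPrimorial F w := by
  rw [polyPrimorial_eq, P.dvd_prod_iff, mem_primesLT]
  omega

theorem abs_pow_sub_one_le {t D R : ℝ} {m m₀ : ℕ} (hm : m ≤ m₀) (hD : 0 ≤ D) (hR : 1 ≤ R)
    (ht : |t - 1| ≤ D / R) : |t ^ m - 1| ≤ m₀ * (1 + D) ^ m₀ * D / R := by
  have hDR : D / R ≤ D := div_le_self hD hR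
  have ht1 : |t| ≤ 1 + D := by
    have := abs_add_le (t - 1) 1
    rw [sub_add_cancel, abs_one] at this
    linarith
  rw [← geom_sum_mul, abs_mul]
  have h1 : |∑ i ∈ Finset.range m, t ^ i| ≤ m₀ * (1 + D) ^ m₀ := by
    refine (Finset.abs_sum_le_sum_abs _ _).trans ?_
    calc _ ≤ ∑ _i ∈ Finset.range m, (1 + D) ^ m₀ := by
          refine Finset.sum_le_sum fun i hi => ?_
          rw [abs_pow]
          exact (pow_le_pow_left₀ (abs_nonneg _) ht1 i).trans
            (pow_le_pow_right₀ (by linarith) (by have := Finset.mem_range.1 hi; omega))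
      _ = m * (1 + D) ^ m₀ := by simp
      _ ≤ _ := by gcongr
  calc _ ≤ m₀ * (1 + D) ^ m₀ * (D / R) := mul_le_mul h1 ht (abs_nonneg _) (by positivity)
    _ = _ := by ring

/-- The average of a product of sieve weights over a box, with an explicit error term. -/
theorem exists_abs_expect_prod_sieveWeight_sub_one_le (F : Type*) [Field F] [Fintype F]
    {χ : ℝ → ℝ} (hχ : IsCutoff χ) (m₀ : ℕ) :
    ∃ M C : ℝ, 0 ≤ M ∧ 0 ≤ C ∧ ∃ K : ℕ → ℝ, (∀ w, 0 ≤ K w) ∧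
      ∀ (m n H N w : ℕ) (a : Fin m → Fin n → F[X]) (c : Fin m → F[X]) (b : F[X]) (R L : ℝ)
        (e : MonicIrr F → ℝ), m ≤ m₀ → 1 ≤ R → R ≤ N → w ≤ N → 2 * m * R ≤ H → 0 ≤ L →
        IsCoprime b (polyPrimorial F w) →
        (∀ P : MonicIrr F, w ≤ P.deg → ∀ i, ∃ j, ¬ P.1 ∣ a i j) →
        (∀ P : MonicIrr F, w ≤ P.deg → ∀ i i', i ≠ i' →
          localDensity (polyPrimorial F w) b a c P {i, i'} ≤ e P) →
        (∀ P, invNorm P ^ 2 ≤ e P) →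
        (∀ U ⊆ primesLT F N, (∀ P ∈ U, w ≤ P.deg) → ∑ P ∈ U, e P ≤ L) →
        |(𝔼 y : Fin n → degreeLT F H, ∏ i, sieveWeight χ R (polyPrimorial F w) b
            (∑ j, a i j * (y j : F[X]) + c i)) - 1| ≤
          (Real.exp (C * L) - 1) * M + Real.exp (C * L) * (K w / R) := by
  classical
  choose M hM0 hM using fun m => exists_abs_sieveSum_sub_le hχ m (fun P : MonicIrr F => P.deg)
    invNorm (fun P => (invNorm_pos P).le) invNorm_le_half
  choose K hK0 hK using fun m w => hM m (primesLT F w)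
  obtain ⟨L₀, -, -, hb1, hb2⟩ := hχ.exists_bound
  set D : ℝ := 4 * L₀ ^ 2
  have hD0 : 0 ≤ D := by positivity
  refine ⟨∑ m ∈ Finset.range (m₀ + 1), M m, 40 * 64 ^ m₀, Finset.sum_nonneg fun m _ => hM0 m,
    by positivity, fun w => ∑ m ∈ Finset.range (m₀ + 1), K m w + m₀ * (1 + D) ^ m₀ * D,
    fun w => add_nonneg (Finset.sum_nonneg fun m _ => hK0 m w) (by positivity), ?_⟩
  intro m n H N w a c b R L e hm hR hRN hwN hH hL0 hb ha hpair he hL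
  have hR0 : 0 < R := by linarith
  have hmr : m ∈ Finset.range (m₀ + 1) := Finset.mem_range.2 (by omega)
  have hMm : M m ≤ ∑ m ∈ Finset.range (m₀ + 1), M m :=
    Finset.single_le_sum (fun m _ => hM0 m) hmr
  have hKm : K m w ≤ ∑ m ∈ Finset.range (m₀ + 1), K m w :=
    Finset.single_le_sum (f := fun m => K m w) (fun m _ => hK0 m w) hmr
  set W := polyPrimorial F w with hW
  have hnot : ∀ P : MonicIrr F, P ∉ primesLT F w → w ≤ P.deg := fun P hP => by
    rw [mem_primesLT] at hP; omega
  have main := hK m w (primesLT F N) (fun P => localDensity W b a c P) e (primesLT_mono hwN)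
    (fun P _ => localDensity_empty)
    (fun P hP C hC => localDensity_eq_zero (by
      rw [hW, polyPrimorial_eq, P.dvd_prod_iff]; exact hP) hb hC)
    (fun P _ hP i => localDensity_singleton (not_dvd_primorial (hnot P hP)) (ha P (hnot P hP) i))
    (fun P _ _ C => abs_localDensity_le_one C)
    (fun P _ hP C hC => localDensity_le_of_pair (hpair P (hnot P hP)) hC)
    (fun P _ _ => he P) R L N hR hRN (X_pow_dvd_prod_primesLT N)
    (fun U hU hd => hL U hU fun P hP => hnot P (Finset.disjoint_left.1 hd hP))
  -- The normalization `Φ(W) / |W|` of the weight is exactly the factor `∏ (1 - 1/|P|)` that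
  -- compensates the trivial Euler factors at the primes dividing `W`.
  rw [← expect_prod_divisorSum_sq hχ hR0 hRN hH, ← polyTotient_div_polyNorm, ← mul_pow,
    Finset.mul_expect] at main
  have hsw : ∀ y : Fin n → degreeLT F H, ∏ i, sieveWeight χ R W b
      (∑ j, a i j * (y j : F[X]) + c i) =
      (R * (polyTotient (polyPrimorial F w) / polyNorm (polyPrimorial F w))) ^ m *
        ∏ i, divisorSum χ R (W * (∑ j, a i j * (y j : F[X]) + c i) + b) ^ 2 := by
    intro y
    simp only [sieveWeight, Finset.prod_mul_distrib, Finset.prod_const, Finset.card_univ,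
      Fintype.card_fin, mul_pow, hW]
  rw [Finset.expect_congr rfl fun y _ => hsw y]
  have hone : |(R * cutoffCorr χ R 0 0) ^ m - 1| ≤ m₀ * (1 + D) ^ m₀ * D / R :=
    abs_pow_sub_one_le hm hD0 hR (abs_mul_cutoffCorr_sub_one_le hχ hR hb1 hb2)
  have hexp : Real.exp (40 * 64 ^ m * L) ≤ Real.exp (40 * 64 ^ m₀ * L) := by
    apply Real.exp_le_exp.2
    apply mul_le_mul_of_nonneg_right _ hL0
    have : (64 : ℝ) ^ m ≤ 64 ^ m₀ := pow_le_pow_right₀ (by norm_num) hm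
    linarith
  have hexp1 : 1 ≤ Real.exp (40 * 64 ^ m₀ * L) := Real.one_le_exp (by positivity)
  refine (abs_sub_le _ ((R * cutoffCorr χ R 0 0) ^ m) 1).trans ?_
  calc _ ≤ ((Real.exp (40 * 64 ^ m * L) - 1) * M m + Real.exp (40 * 64 ^ m * L) * (K m w / R)) +
        m₀ * (1 + D) ^ m₀ * D / R := add_le_add main hone
    _ ≤ ((Real.exp (40 * 64 ^ m₀ * L) - 1) * (∑ m ∈ Finset.range (m₀ + 1), M m) +
        Real.exp (40 * 64 ^ m₀ * L) * ((∑ m ∈ Finset.range (m₀ + 1), K m w) / R)) +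
        Real.exp (40 * 64 ^ m₀ * L) * (m₀ * (1 + D) ^ m₀ * D / R) := by
        refine add_le_add (add_le_add ?_ ?_) ?_
        · exact mul_le_mul (by linarith) hMm (hM0 m) (by linarith)
        · have := hK0 m w
          gcongr
        · have : 0 ≤ m₀ * (1 + D) ^ m₀ * D / R := by positivity
          nlinarith
    _ = _ := by ring

end BoxEstimate

/-! ### Representatives and denominators in the field with `q ^ N` elements -/

section FiniteFieldModel

variable {F : Type*} [Field F]

namespace FieldChoice

variable (M : FieldChoice F) (N : ℕ+)

theorem rep_add (x y : M.FqN N) : M.rep N (x + y) = M.rep N x + M.rep N y :=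
  map_add (AdjoinRoot.modByMonicHom (M.monic N)) x y

theorem rep_sub (x y : M.FqN N) : M.rep N (x - y) = M.rep N x - M.rep N y :=
  map_sub (AdjoinRoot.modByMonicHom (M.monic N)) x y

theorem degree_f : (M.f N).degree = ((N : ℕ) : WithBot ℕ) := by
  rw [degree_eq_natDegree (M.monic N).ne_zero, M.natDegree_eq]

theorem rep_mk {p : F[X]} (hp : p.degree < ((N : ℕ) : WithBot ℕ)) :
    M.rep N (AdjoinRoot.mk (M.f N) p) = p := by
  rw [rep, AdjoinRoot.modByMonicHom_mk, (modByMonic_eq_self_iff (M.monic N)).2]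
  rwa [degree_f]

theorem rep_injective : Function.Injective (M.rep N) :=
  (AdjoinRoot.mk_leftInverse (M.monic N)).injective

theorem degree_rep_lt (x : M.FqN N) : (M.rep N x).degree < ((N : ℕ) : WithBot ℕ) := by
  obtain ⟨p, rfl⟩ := AdjoinRoot.mk_surjective x
  rw [rep, AdjoinRoot.modByMonicHom_mk, ← M.degree_f N]
  exact degree_modByMonic_lt _ (M.monic N)

/-- The reduced denominator of `r` divides `g`, whose degree is less than `N`, so it is invertible
modulo `f N` and denominators may be cleared there. -/
theorem embed_mul_mk {r : RatFunc F} {g a : F[X]} (hg : g ≠ 0) (hgN : g.natDegree < N)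
    (h : r * algebraMap F[X] (RatFunc F) g = algebraMap F[X] (RatFunc F) a) :
    M.embed N r * AdjoinRoot.mk (M.f N) g = AdjoinRoot.mk (M.f N) a := by
  have hd : algebraMap F[X] (RatFunc F) r.denom ≠ 0 := RatFunc.algebraMap_ne_zero r.denom_ne_zero
  have h1 : r.num * g = a * r.denom := by
    apply RatFunc.algebraMap_injective F
    have hr : r * algebraMap F[X] (RatFunc F) r.denom = algebraMap F[X] (RatFunc F) r.num := by
      rw [← div_eq_iff hd |>.1 (RatFunc.num_div_denom r)]
    rw [map_mul, map_mul, ← h, ← hr]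
    ring
  have hdvd : r.denom ∣ g := (RatFunc.isCoprime_num_denom r).symm.dvd_of_dvd_mul_left
    ⟨a, by rw [h1, mul_comm]⟩
  have hmk : AdjoinRoot.mk (M.f N) r.denom ≠ 0 := by
    rw [Ne, AdjoinRoot.mk_eq_zero]
    intro h2
    have := natDegree_le_of_dvd (h2.trans hdvd) hg
    rw [M.natDegree_eq] at this
    omega
  rw [embed, div_mul_eq_mul_div, div_eq_iff hmk, ← map_mul, ← map_mul, h1]

end FieldChoice

/-- A common denominator for a matrix of small rational functions. -/
theorem exists_common_denominator {m n k₀ : ℕ} {L : Fin m → Fin n → RatFunc F}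
    (hL : ∀ i j, L i j ∈ smallRatFunc F k₀) :
    ∃ (g : F[X]) (a : Fin m → Fin n → F[X]), g ≠ 0 ∧ g.natDegree ≤ m * n * k₀ ∧
      (∀ i j, (a i j).natDegree ≤ m * n * k₀) ∧
      ∀ i j, L i j * algebraMap F[X] (RatFunc F) g = algebraMap F[X] (RatFunc F) (a i j) := by
  classical
  choose A G hA hG hG0 hAG using hL
  have hnd : ∀ {p : F[X]}, p.degree < (k₀ : WithBot ℕ) → p.natDegree ≤ k₀ := fun hp =>
    natDegree_le_of_degree_le hp.le
  have hGd : ∀ S : Finset (Fin m × Fin n), (∏ s ∈ S, G s.1 s.2).natDegree ≤ S.card * k₀ := by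
    intro S
    refine (natDegree_prod_le _ _).trans ((Finset.sum_le_card_nsmul _ _ k₀ fun s _ =>
      hnd (hG s.1 s.2)).trans (by simp))
  have hcard : (Finset.univ : Finset (Fin m × Fin n)).card = m * n := by simp
  refine ⟨∏ s : Fin m × Fin n, G s.1 s.2, fun i j => A i j * ∏ s ∈ Finset.univ.erase (i, j),
    G s.1 s.2, Finset.prod_ne_zero_iff.2 fun s _ => hG0 _ _, ?_, fun i j => ?_, fun i j => ?_⟩
  · simpa [hcard] using hGd Finset.univ
  · refine natDegree_mul_le.trans ?_
    have h1 := hGd (Finset.univ.erase (i, j))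
    rw [Finset.card_erase_of_mem (Finset.mem_univ _), hcard] at h1
    have hpos : 0 < m * n := by rw [← hcard]; exact Finset.card_pos.2 ⟨(i, j), Finset.mem_univ _⟩
    have h2 := hnd (hA i j)
    calc _ ≤ k₀ + (m * n - 1) * k₀ := add_le_add h2 h1
      _ = (1 + (m * n - 1)) * k₀ := by ring
      _ = _ := by congr 1; omega
  · rw [← Finset.mul_prod_erase _ _ (Finset.mem_univ (i, j)), hAG, map_mul, map_mul]
    have : algebraMap F[X] (RatFunc F) (G i j) ≠ 0 := RatFunc.algebraMap_ne_zero (hG0 i j)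
    field_simp

theorem abs_expect_sub_le {α : Type*} [Fintype α] [Nonempty α] {f : α → ℝ} {t η : ℝ}
    (h : ∀ x, |f x - t| ≤ η) : |(𝔼 x, f x) - t| ≤ η := by
  rw [← Fintype.expect_const (ι := α) t, ← Finset.expect_sub_distrib]
  refine (Finset.abs_expect_le _ _).trans ?_
  exact (Finset.expect_le_expect fun x _ => h x).trans (le_of_eq (Fintype.expect_const _))

end FiniteFieldModel


/-! ### The linear forms estimate -/

section LinearForms

theorem degree_mul_lt_of_natDegree_le {F : Type*} [Field F] {a y : F[X]} {D H N : ℕ}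
    (ha : a.natDegree ≤ D) (hy : y.degree < (H : WithBot ℕ)) (hN : D + H ≤ N) :
    (a * y).degree < (N : WithBot ℕ) := by
  rcases eq_or_ne (a * y) 0 with h0 | h0
  · rw [h0, degree_zero]; exact WithBot.bot_lt_coe N
  · have hy0 : y ≠ 0 := right_ne_zero_of_mul h0
    rw [degree_eq_natDegree h0, Nat.cast_lt]
    rw [degree_eq_natDegree hy0, Nat.cast_lt] at hy
    have := natDegree_mul_le (p := a) (q := y)
    omega

/-- Nonproportional vectors over a field have a nonzero minor. -/
theorem exists_minor_ne_zero {K : Type*} [Field K] {n : ℕ} {u v : Fin n → K} (hv : v ≠ 0)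
    (h : ∀ c : K, u ≠ c • v) : ∃ j j', u j * v j' - u j' * v j ≠ 0 := by
  by_contra! hc
  obtain ⟨j', hj'⟩ := Function.ne_iff.1 hv
  refine h (u j' / v j') (funext fun j => ?_)
  rw [Pi.smul_apply, smul_eq_mul]
  have hj'' : v j' ≠ 0 := hj'
  field_simp
  linear_combination hc j j'

variable {F : Type*} [Field F] [Fintype F]

theorem MonicIrr.not_dvd_of_natDegree_lt (P : MonicIrr F) {f : F[X]} (hf : f ≠ 0)
    (h : f.natDegree < P.deg) : ¬ P.1 ∣ f := fun hd =>
  absurd (natDegree_le_of_dvd hd hf) (not_le.2 h)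

/-- Systems of pairwise nonproportional forms of bounded height stay so modulo large primes. -/
theorem exists_minor_not_dvd {m n D : ℕ} {L : Fin m → Fin n → RatFunc F}
    {g : F[X]} {a : Fin m → Fin n → F[X]} (hg : g ≠ 0) (haD : ∀ i j, (a i j).natDegree ≤ D)
    (haL : ∀ i j, L i j * algebraMap F[X] (RatFunc F) g = algebraMap F[X] (RatFunc F) (a i j))
    {i i' : Fin m} (hi' : L i' ≠ 0) (h : ∀ c : RatFunc F, L i ≠ c • L i') {P : MonicIrr F}
    (hP : 2 * D < P.deg) : ∃ j j', ¬ P.1 ∣ a i j * a i' j' - a i j' * a i' j := by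
  obtain ⟨j, j', hj⟩ := exists_minor_ne_zero hi' h
  refine ⟨j, j', P.not_dvd_of_natDegree_lt ?_ ?_⟩
  · intro h0
    have h1 := congrArg (algebraMap F[X] (RatFunc F)) h0
    simp only [map_sub, map_mul, map_zero, ← haL] at h1
    have hg' : algebraMap F[X] (RatFunc F) g ≠ 0 := RatFunc.algebraMap_ne_zero hg
    refine hj (mul_right_cancel₀ (mul_ne_zero hg' hg') ?_)
    linear_combination h1
  · refine lt_of_le_of_lt (natDegree_sub_le _ _) (lt_of_le_of_lt ?_ hP)
    have h2 : ∀ x y, (a i x * a i' y).natDegree ≤ 2 * D := fun x y =>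
      natDegree_mul_le.trans (by have := haD i x; have := haD i' y; omega)
    exact max_le (h2 _ _) (h2 _ _)

theorem exists_coeff_not_dvd {m n D : ℕ} {L : Fin m → Fin n → RatFunc F}
    {g : F[X]} {a : Fin m → Fin n → F[X]} (hg : g ≠ 0) (haD : ∀ i j, (a i j).natDegree ≤ D)
    (haL : ∀ i j, L i j * algebraMap F[X] (RatFunc F) g = algebraMap F[X] (RatFunc F) (a i j))
    {i : Fin m} (hi : L i ≠ 0) {P : MonicIrr F} (hP : 2 * D < P.deg) : ∃ j, ¬ P.1 ∣ a i j := by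
  obtain ⟨j, hj⟩ := Function.ne_iff.1 hi
  refine ⟨j, P.not_dvd_of_natDegree_lt ?_ (by have := haD i j; omega)⟩
  intro h0
  have hg' : algebraMap F[X] (RatFunc F) g ≠ 0 := RatFunc.algebraMap_ne_zero hg
  have h1 := haL i j
  rw [h0, map_zero] at h1
  exact (mul_ne_zero hj hg') h1

instance (H : ℕ) : Nonempty (degreeLT F H) := ⟨0⟩

/-- Averages of products of the sieve majorant along affine forms. -/
theorem exists_abs_expect_linearForms_sub_one_le (F : Type*) [Field F] [Fintype F] {χ : ℝ → ℝ}
    (hχ : IsCutoff χ) (m₀ n₀ k₀ : ℕ) :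
    ∃ A C : ℝ, 0 ≤ A ∧ 0 ≤ C ∧ ∃ K : ℕ → ℝ, (∀ w, 0 ≤ K w) ∧
      ∀ (M : FieldChoice F) (N : ℕ+) (w : ℕ) (R : ℝ) (b : F[X]), 1 ≤ R → w ≤ N →
        2 * (m₀ * n₀ * k₀) < w → 2 * m₀ * R + m₀ * n₀ * k₀ ≤ (N : ℕ) →
        IsCoprime b (polyPrimorial F w) → ∀ m n : ℕ, m ≤ m₀ → n ≤ n₀ →
        ∀ L : Fin m → Fin n → RatFunc F, (∀ i j, L i j ∈ smallRatFunc F k₀) → (∀ i, L i ≠ 0) →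
        (∀ i i', i ≠ i' → ∀ c : RatFunc F, L i ≠ c • L i') → ∀ d : Fin m → M.FqN N,
        |(𝔼 x : Fin n → M.FqN N, ∏ i, sieveWeight χ R (polyPrimorial F w) b
            (M.rep N (∑ j, M.embed N (L i j) * x j + d i))) - 1| ≤
          (Real.exp (C * (2 * (1 / 2) ^ w)) - 1) * A +
            Real.exp (C * (2 * (1 / 2) ^ w)) * (K w / R) := by
  obtain ⟨A, C, hA, hC, K, hK0, hK⟩ := exists_abs_expect_prod_sieveWeight_sub_one_le F hχ m₀
  refine ⟨A, C, hA, hC, K, hK0, ?_⟩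
  intro M N w R b hR hwN hw hRN hb m n hm hn L hL hL0 hprop d
  obtain ⟨g, a, hg, hgD, haD, haL⟩ := exists_common_denominator hL
  rcases m.eq_zero_or_pos with rfl | hmpos
  · simp only [Finset.univ_eq_empty, Finset.prod_empty, Fintype.expect_const, sub_self, abs_zero]
    have := hK0 w
    have : 1 ≤ Real.exp (C * (2 * (1 / 2) ^ w)) := Real.one_le_exp (by positivity)
    have : 0 ≤ K w / R := by positivity
    have : 0 ≤ (Real.exp (C * (2 * (1 / 2) ^ w)) - 1) * A := mul_nonneg (by linarith) hA
    positivity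
  set D := m₀ * n₀ * k₀ with hD
  have hmnk : m * n * k₀ ≤ D := by rw [hD]; gcongr
  have hDN : D ≤ N := by
    have : 0 ≤ 2 * (m₀ : ℝ) * R := by positivity
    have h2 : ((D : ℕ) : ℝ) ≤ ((N : ℕ) : ℝ) := by rw [hD]; push_cast; linarith
    exact_mod_cast h2
  set H := (N : ℕ) - D with hH
  have hHN : D + H = N := by omega
  have hHR : 2 * m * R ≤ H := by
    have h1 : (H : ℝ) = (N : ℕ) - D := by rw [hH, Nat.cast_sub hDN]
    have h2 : (m : ℝ) ≤ m₀ := by exact_mod_cast hm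
    rw [h1, hD]; push_cast
    nlinarith
  have hRN' : R ≤ (N : ℕ) := by
    have h2 : (1 : ℝ) ≤ m₀ := by exact_mod_cast hmpos.trans_le hm
    have h3 : (0 : ℝ) ≤ m₀ * n₀ * k₀ := by positivity
    nlinarith
  have hgN : g.natDegree < N := by omega
  -- Translating by multiples `g * y` of the common denominator turns the coefficients into the
  -- polynomials `a i j`. As `H = N - D`, each `a i j * y j` has degree less than `N`, so it is its
  -- own representative.
  let θ : (Fin n → degreeLT F H) → (Fin n → M.FqN N) := fun y j =>
    AdjoinRoot.mk (M.f N) (g * (y j : F[X]))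
  rw [expect_translate θ]
  refine abs_expect_sub_le fun x => ?_
  have hform : ∀ y : Fin n → degreeLT F H, ∀ i,
      M.rep N (∑ j, M.embed N (L i j) * (x + θ y) j + d i) =
        ∑ j, a i j * (y j : F[X]) + M.rep N (∑ j, M.embed N (L i j) * x j + d i) := by
    intro y i
    have h1 : ∑ j, M.embed N (L i j) * (x + θ y) j + d i =
        AdjoinRoot.mk (M.f N) (∑ j, a i j * (y j : F[X])) +
          (∑ j, M.embed N (L i j) * x j + d i) := by
      rw [map_sum, ← add_assoc, ← Finset.sum_add_distrib]
      congr 1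
      refine Finset.sum_congr rfl fun j _ => ?_
      rw [Pi.add_apply, mul_add, add_comm]
      congr 1
      change _ * AdjoinRoot.mk (M.f N) (g * (y j : F[X])) = _
      rw [map_mul, ← mul_assoc, M.embed_mul_mk N hg hgN (haL i j), map_mul]
    rw [h1, M.rep_add, M.rep_mk]
    refine (degree_sum_le _ _).trans_lt ((Finset.sup_lt_iff (WithBot.bot_lt_coe _)).2 fun j _ => ?_)
    exact degree_mul_lt_of_natDegree_le ((haD i j).trans hmnk) (mem_degreeLT.1 (y j).2) hHN.le
  simp only [hform]
  have hdeg : ∀ P : MonicIrr F, w ≤ P.deg → 2 * (m * n * k₀) < P.deg := fun P hP => by omega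
  refine hK m n H N w a _ b R _ (fun P => invNorm P ^ 2) hm hR hRN' hwN hHR (by positivity) hb
    (fun P hP i => exists_coeff_not_dvd hg haD haL (hL0 i) (hdeg P hP)) ?_ (fun P => le_rfl)
    (fun U _ hU => sum_invNorm_sq_le U w hU)
  intro P hP i i' hii'
  rw [localDensity_pair (not_dvd_primorial hP)
    (exists_minor_not_dvd hg haD haL (hL0 i') (hprop i i' hii') (hdeg P hP))]

end LinearForms

/-! ### The correlation estimate -/

section Correlations

variable {F : Type*} [Field F] [Fintype F]

open scoped Classical in
/-- The sum of the inverse norms of the primes of degree less than `N` that divide `f`. -/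
noncomputable def invNormSum (N : ℕ) (f : F[X]) : ℝ :=
  ∑ P ∈ (primesLT F N).filter fun P => P.1 ∣ f, invNorm P

theorem invNormSum_nonneg (N : ℕ) (f : F[X]) : 0 ≤ invNormSum N f :=
  Finset.sum_nonneg fun P _ => (invNorm_pos P).le

/-- Correlations of the sieve majorant. -/
theorem exists_expect_correlation_le (F : Type*) [Field F] [Fintype F] {χ : ℝ → ℝ}
    (hχ : IsCutoff χ) (l₀ : ℕ) :
    ∃ A C : ℝ, 0 ≤ A ∧ 0 ≤ C ∧ ∃ K : ℕ → ℝ, (∀ w, 0 ≤ K w) ∧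
      ∀ (M : FieldChoice F) (N : ℕ+) (w : ℕ) (R : ℝ) (b : F[X]), 1 ≤ R → w ≤ N →
        2 * l₀ * R ≤ (N : ℕ) → IsCoprime b (polyPrimorial F w) → ∀ l : ℕ, 1 ≤ l → l ≤ l₀ →
        ∀ h : Fin l → M.FqN N,
        (𝔼 x : M.FqN N, ∏ i, sieveWeight χ R (polyPrimorial F w) b (M.rep N (x + h i))) ≤
          Real.exp (C * (2 + ∑ i : Fin l, ∑ j ∈ Finset.Ioi i,
            invNormSum N (M.rep N (h i - h j)))) * (1 + A + K w / R) := by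
  classical
  obtain ⟨A, C, hA, hC, K, hK0, hK⟩ := exists_abs_expect_prod_sieveWeight_sub_one_le F hχ l₀
  refine ⟨A, C, hA, hC, K, hK0, ?_⟩
  intro M N w R b hR hwN hRN hb l hl1 hl h
  have hR0 : 0 < R := by linarith
  have hl0 : (1 : ℝ) ≤ l₀ := by exact_mod_cast hl1.trans hl
  have hRN' : R ≤ (N : ℕ) := by nlinarith
  have hHR : 2 * l * R ≤ (N : ℕ) := by
    have h2 : (l : ℝ) ≤ l₀ := by exact_mod_cast hl
    nlinarith
  set S : ℝ := ∑ i : Fin l, ∑ j ∈ Finset.Ioi i, invNormSum N (M.rep N (h i - h j)) with hS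
  have hS0 : 0 ≤ S := Finset.sum_nonneg fun i _ => Finset.sum_nonneg fun j _ => invNormSum_nonneg _ _
  have hbound : |(𝔼 x : M.FqN N, ∏ i, sieveWeight χ R (polyPrimorial F w) b (M.rep N (x + h i))) - 1|
      ≤ (Real.exp (C * (2 + S)) - 1) * A + Real.exp (C * (2 + S)) * (K w / R) := by
    let θ : (Fin 1 → degreeLT F (N : ℕ)) → M.FqN N := fun y => AdjoinRoot.mk (M.f N) (y 0 : F[X])
    rw [expect_translate θ]
    refine abs_expect_sub_le fun x => ?_
    have hform : ∀ y : Fin 1 → degreeLT F (N : ℕ), ∀ i, M.rep N (x + θ y + h i) =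
        ∑ j, (1 : F[X]) * (y j : F[X]) + M.rep N (x + h i) := by
      intro y i
      rw [add_right_comm, add_comm, M.rep_add, M.rep_mk N (mem_degreeLT.1 (y 0).2)]
      simp
    simp only [hform]
    refine hK l 1 N N w (fun _ _ => 1) (fun i => M.rep N (x + h i)) b R (2 + S)
      (fun P => invNorm P ^ 2 + ∑ i : Fin l, ∑ j ∈ Finset.Ioi i,
        if P.1 ∣ M.rep N (h i - h j) then invNorm P else 0) hl hR hRN' hwN hHR (by linarith) hb
      (fun P _ i => ⟨0, fun hd => P.irreducible.not_isUnit (isUnit_of_dvd_one hd)⟩) ?_ ?_ ?_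
    · intro P hP i i' hii'
      wlog hlt : i < i' generalizing i i'
      · rw [Finset.pair_comm]
        exact this i' i hii'.symm (lt_of_le_of_ne (not_lt.1 hlt) hii'.symm)
      have hpos : ∀ i j : Fin l, 0 ≤ (if P.1 ∣ M.rep N (h i - h j) then invNorm P else 0) := by
        intro i j; split_ifs; exacts [(invNorm_pos P).le, le_rfl]
      -- The two shifted values differ by `W * (h i - h i')`. If `P` divides `h i - h i'`, one
      -- condition already bounds the density by `1/|P|`; if not, the two conditions contradict each
      -- other.
      by_cases hd : P.1 ∣ M.rep N (h i - h i')
      · have h1 : localDensity (polyPrimorial F w) b (fun _ _ => (1 : F[X]))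
            (n := 1) (fun i => M.rep N (x + h i)) P {i, i'} ≤ invNorm P := by
          rw [← localDensity_singleton (W := polyPrimorial F w) (b := b) (n := 1)
            (a := fun (_ : Fin l) _ => (1 : F[X])) (c := fun i => M.rep N (x + h i)) (i := i)
            (not_dvd_primorial hP)
            ⟨0, fun hd => P.irreducible.not_isUnit (isUnit_of_dvd_one hd)⟩]
          exact localDensity_mono (by simp)
        have h2 : invNorm P ≤ ∑ i : Fin l, ∑ j ∈ Finset.Ioi i,
            if P.1 ∣ M.rep N (h i - h j) then invNorm P else 0 := by
          refine le_trans ?_ (Finset.single_le_sum (fun i _ => Finset.sum_nonneg fun j _ => hpos i j)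
            (Finset.mem_univ i))
          refine le_trans ?_ (Finset.single_le_sum (fun j _ => hpos i j) (Finset.mem_Ioi.2 hlt))
          rw [if_pos hd]
        nlinarith [sq_nonneg (invNorm P)]
      · have h1 : localDensity (polyPrimorial F w) b (fun _ _ => (1 : F[X]))
            (n := 1) (fun i => M.rep N (x + h i)) P {i, i'} = 0 := by
          refine Finset.expect_eq_zero fun v _ => if_neg fun hv => ?_
          have e1 := hv i (by simp)
          have e2 := hv i' (by simp)
          have hW : AdjoinRoot.mk P.1 (polyPrimorial F w) ≠ 0 := by
            rw [Ne, AdjoinRoot.mk_eq_zero]; exact not_dvd_primorial hP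
          refine hd ?_
          have h3 : M.rep N (h i - h i') = M.rep N (x + h i) - M.rep N (x + h i') := by
            rw [← M.rep_sub]; congr 1; ring
          rw [h3, ← AdjoinRoot.mk_eq_zero, map_sub]
          refine mul_left_cancel₀ hW ?_
          linear_combination e1 - e2
        rw [h1]
        exact add_nonneg (sq_nonneg _) (Finset.sum_nonneg fun i _ => Finset.sum_nonneg fun j _ =>
          hpos i j)
    · intro P
      refine le_add_of_nonneg_right (Finset.sum_nonneg fun i _ => Finset.sum_nonneg fun j _ => ?_)
      split_ifs; exacts [(invNorm_pos P).le, le_rfl]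
    · intro U hU hUw
      rw [Finset.sum_add_distrib]
      refine add_le_add ((sum_invNorm_sq_le U w hUw).trans ?_) ?_
      · have : (1 / 2 : ℝ) ^ w ≤ 1 := pow_le_one₀ (by norm_num) (by norm_num)
        linarith
      · rw [Finset.sum_comm, hS]
        refine Finset.sum_le_sum fun i _ => ?_
        rw [Finset.sum_comm]
        refine Finset.sum_le_sum fun j _ => ?_
        rw [← Finset.sum_filter, invNormSum]
        exact Finset.sum_le_sum_of_subset_of_nonneg (Finset.filter_subset_filter _ hU)
          fun P _ _ => (invNorm_pos P).le
  have h1 := (abs_le.1 hbound).2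
  have hE : 1 ≤ Real.exp (C * (2 + S)) := Real.one_le_exp (by positivity)
  nlinarith

end Correlations


/-! ### Exponential moments of sums over prime divisors -/

section Moments

variable {F : Type*} [Field F] [Fintype F]

theorem MonicIrr.card_adjoinRoot (P : MonicIrr F) :
    Fintype.card (AdjoinRoot P.1) = Fintype.card F ^ P.deg := by
  have := P.monic.finite_adjoinRoot
  rw [Module.card_eq_pow_finrank (K := F), (AdjoinRoot.powerBasis' P.monic).finrank]
  rfl

theorem MonicIrr.dvd_X_pow_card_sub_X (P : MonicIrr F) :
    P.1 ∣ X ^ Fintype.card F ^ P.deg - X := by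
  rw [← AdjoinRoot.mk_eq_zero, map_sub, map_pow, ← P.card_adjoinRoot, FiniteField.pow_card, sub_self]

/-- The elementary upper bound for the number of primes of degree `n`. -/
theorem card_filter_deg_mul_le (U : Finset (MonicIrr F)) {n : ℕ} (hn : 0 < n) :
    (U.filter fun P => P.deg = n).card * n ≤ Fintype.card F ^ n := by
  have h2 : 1 < Fintype.card F := two_le_card
  -- All primes of degree `n` divide `X ^ (q ^ n) - X` and are pairwise coprime; comparing degrees
  -- gives the bound.
  have hdvd : ∏ P ∈ U.filter (fun P => P.deg = n), P.1 ∣ X ^ Fintype.card F ^ n - X := by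
    rw [MonicIrr.prod_dvd_iff]
    intro P hP
    rw [← (Finset.mem_filter.1 hP).2]
    exact P.dvd_X_pow_card_sub_X
  have h := natDegree_le_of_dvd hdvd (FiniteField.X_pow_card_pow_sub_X_ne_zero F hn.ne' h2)
  rw [MonicIrr.natDegree_prod, FiniteField.X_pow_card_pow_sub_X_natDegree_eq F hn.ne' h2] at h
  rwa [Finset.sum_congr rfl fun P hP => (Finset.mem_filter.1 hP).2, Finset.sum_const,
    smul_eq_mul] at h

/-- There are at most `q ^ n / n` primes of degree `n`, so the sum is at most harmonic. It controls
`invNormSum` at `0`, which all primes divide. -/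
theorem sum_invNorm_primesLT_le (N : ℕ) :
    ∑ P ∈ primesLT F N, invNorm P ≤ 1 + Real.log N := by
  have hq : (0 : ℝ) < Fintype.card F := by exact_mod_cast Fintype.card_pos
  have hmaps : ∀ P ∈ primesLT F N, P.deg ∈ Finset.Ico 1 N := fun P hP =>
    Finset.mem_Ico.2 ⟨P.deg_pos, mem_primesLT.1 hP⟩
  rw [← Finset.sum_fiberwise_of_maps_to hmaps]
  have hh := harmonic_le_one_add_log N
  refine le_trans ?_ hh
  rw [harmonic_eq_sum_Icc]
  push_cast
  refine le_trans ?_ (Finset.sum_le_sum_of_subset_of_nonneg (s := Finset.Ico 1 N)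
    (fun n hn => ?_) fun n _ _ => by positivity)
  · refine Finset.sum_le_sum fun n hn => ?_
    have hn0 : 0 < n := (Finset.mem_Ico.1 hn).1
    have h1 : ∀ P ∈ (primesLT F N).filter (fun P => P.deg = n), invNorm P =
        ((Fintype.card F : ℝ) ^ n)⁻¹ := fun P hP => by
      rw [invNorm, (Finset.mem_filter.1 hP).2]
    rw [Finset.sum_congr rfl h1, Finset.sum_const, nsmul_eq_mul, ← div_eq_mul_inv,
      div_le_iff₀ (by positivity), inv_mul_eq_div, le_div_iff₀ (by exact_mod_cast hn0)]
    exact_mod_cast card_filter_deg_mul_le (primesLT F N) hn0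
  · have := Finset.mem_Ico.1 hn
    exact Finset.mem_Icc.2 ⟨this.1, this.2.le⟩

open scoped Classical in
-- Excluding `0` keeps the bound true when `deg D > N`, where `0` would otherwise be the one
-- multiple counted.
theorem card_filter_ne_zero_dvd_mul_le {D : F[X]} (hD : D ≠ 0) (N : ℕ) :
    ((polysLT F N).filter fun h => h ≠ 0 ∧ D ∣ h).card * Fintype.card F ^ D.natDegree ≤
      Fintype.card F ^ N := by
  rcases lt_or_ge N D.natDegree with hlt | hle
  · rw [Finset.card_eq_zero.2, zero_mul]
    · exact Nat.zero_le _
    refine Finset.filter_eq_empty_iff.2 fun h hh hc => ?_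
    have h1 := natDegree_le_of_dvd hc.2 hc.1
    rw [mem_polysLT, degree_eq_natDegree hc.1, Nat.cast_lt] at hh
    omega
  · obtain ⟨e, rfl⟩ := Nat.exists_eq_add_of_le' hle
    rw [pow_add]
    refine Nat.mul_le_mul_right _ ?_
    rw [← card_polysLT e]
    refine Finset.card_le_card_of_surjOn (fun g => D * g) fun h hh => ?_
    obtain ⟨hh1, hh0, g, rfl⟩ := Finset.mem_filter.1 hh
    refine ⟨g, ?_, rfl⟩
    have hg := right_ne_zero_of_mul hh0
    rw [mem_polysLT, degree_eq_natDegree hh0, Nat.cast_lt, natDegree_mul hD hg] at hh1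
    rw [Finset.mem_coe, mem_polysLT, degree_eq_natDegree hg, Nat.cast_lt]
    omega

theorem exp_sub_one_le {c x : ℝ} (hc : 0 ≤ c) (hx0 : 0 ≤ x) (hx : x ≤ 1) :
    Real.exp (c * x) - 1 ≤ c * Real.exp c * x := by
  have h1 := Real.add_one_le_exp (-(c * x))
  have h2 : Real.exp (c * x) * Real.exp (-(c * x)) = 1 := by rw [← Real.exp_add]; simp
  have h3 : Real.exp (c * x) ≤ Real.exp c := Real.exp_le_exp.2 (by nlinarith)
  have h4 := Real.exp_pos (c * x)
  have h5 : 0 ≤ c * x := by positivity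
  nlinarith

open scoped Classical in
-- The exponential is `∏_{P ∣ h} (1 + a P)` with `a P` of order `1/|P|`. Expanding and counting
-- nonzero multiples of each product of primes bounds the sum by `q ^ N * ∏ (1 + a P / |P|)`, which
-- is controlled by `∑ 1/|P|² ≤ 2`.
theorem sum_exp_invNormSum_le {c : ℝ} (hc : 0 ≤ c) (N : ℕ) :
    ∑ h ∈ (polysLT F N).erase 0, Real.exp (c * invNormSum N h) ≤
      Real.exp (c * Real.exp c * 2) * (Fintype.card F : ℝ) ^ N := by
  classical
  have hq : (0 : ℝ) < Fintype.card F := by exact_mod_cast Fintype.card_pos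
  set a : MonicIrr F → ℝ := fun P => Real.exp (c * invNorm P) - 1 with ha
  have ha0 : ∀ P, 0 ≤ a P := fun P => by
    have := Real.one_le_exp (mul_nonneg hc (invNorm_pos P).le)
    simp only [ha]; linarith
  have ha1 : ∀ P, a P ≤ c * Real.exp c * invNorm P := fun P =>
    exp_sub_one_le hc (invNorm_pos P).le (by linarith [invNorm_le_half P])
  have hexp : ∀ h : F[X], Real.exp (c * invNormSum N h) =
      ∑ S ∈ (primesLT F N).powerset, if ∏ P ∈ S, P.1 ∣ h then ∏ P ∈ S, a P else 0 := by
    intro h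
    have h1 : Real.exp (c * invNormSum N h) =
        ∏ P ∈ primesLT F N, (1 + if P.1 ∣ h then a P else 0) := by
      rw [invNormSum, Finset.mul_sum, Real.exp_sum, Finset.prod_filter]
      refine Finset.prod_congr rfl fun P _ => ?_
      simp only [ha]
      split_ifs <;> ring
    rw [h1, Finset.prod_one_add]
    refine Finset.sum_congr rfl fun S _ => ?_
    rw [Finset.prod_ite_zero]
    congr 1
    rw [MonicIrr.prod_dvd_iff]
  simp only [hexp]
  rw [Finset.sum_comm]
  calc _ ≤ ∑ S ∈ (primesLT F N).powerset, (∏ P ∈ S, a P * invNorm P) * (Fintype.card F : ℝ) ^ N := by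
        refine Finset.sum_le_sum fun S _ => ?_
        rw [← Finset.sum_filter, Finset.sum_const, nsmul_eq_mul, Finset.prod_mul_distrib]
        have hm := MonicIrr.monic_prod S
        have h1 := card_filter_ne_zero_dvd_mul_le hm.ne_zero N
        have h2 : ((polysLT F N).erase 0).filter (fun h => ∏ P ∈ S, P.1 ∣ h) =
            (polysLT F N).filter fun h => h ≠ 0 ∧ ∏ P ∈ S, P.1 ∣ h := by
          ext h; simp only [Finset.mem_filter, Finset.mem_erase]; tauto
        have h3 : ∏ P ∈ S, invNorm P = ((Fintype.card F : ℝ) ^ (∏ P ∈ S, P.1).natDegree)⁻¹ := by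
          rw [MonicIrr.natDegree_prod, ← Finset.prod_pow_eq_pow_sum, ← Finset.prod_inv_distrib]
          rfl
        rw [h2, h3, mul_comm, mul_assoc]
        refine mul_le_mul_of_nonneg_left ?_ (Finset.prod_nonneg fun P _ => ha0 P)
        rw [inv_mul_eq_div, le_div_iff₀ (by positivity)]
        exact_mod_cast h1
    _ = (∏ P ∈ primesLT F N, (1 + a P * invNorm P)) * (Fintype.card F : ℝ) ^ N := by
        rw [← Finset.sum_mul, Finset.prod_one_add]
    _ ≤ _ := by
        refine mul_le_mul_of_nonneg_right ?_ (by positivity)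
        calc _ ≤ ∏ P ∈ primesLT F N, Real.exp (c * Real.exp c * invNorm P ^ 2) := by
              refine Finset.prod_le_prod (fun P _ => ?_) fun P _ => ?_
              · have := mul_nonneg (ha0 P) (invNorm_pos P).le
                linarith
              · have h1 := mul_le_mul_of_nonneg_right (ha1 P) (invNorm_pos P).le
                have h2 := Real.add_one_le_exp (c * Real.exp c * invNorm P ^ 2)
                nlinarith
          _ ≤ _ := by
              rw [← Real.exp_sum, ← Finset.mul_sum]
              refine Real.exp_le_exp.2 (mul_le_mul_of_nonneg_left ?_ (by positivity))
              simpa using sum_invNorm_sq_le (primesLT F N) 0 fun P _ => Nat.zero_le _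

theorem exists_exp_log_le_pow {c : ℝ} (hc : 0 ≤ c) :
    ∃ B : ℝ, ∀ N : ℕ, 0 < N → Real.exp (c * (1 + Real.log N)) ≤ B * 2 ^ N := by
  have hl : 0 < Real.log 2 := Real.log_pos (by norm_num)
  set η := Real.log 2 / (c + 1) with hη
  have hη0 : 0 < η := by positivity
  refine ⟨Real.exp (c - c * Real.log η), fun N hN => ?_⟩
  have hN' : (0 : ℝ) < N := by exact_mod_cast hN
  have h1 := Real.log_le_sub_one_of_pos (mul_pos hη0 hN')
  rw [Real.log_mul hη0.ne' hN'.ne'] at h1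
  have h2 : c * η ≤ Real.log 2 := by
    rw [hη, mul_div_assoc', div_le_iff₀ (by positivity)]
    nlinarith
  have h3 : (2 : ℝ) ^ N = Real.exp (N * Real.log 2) := by
    rw [Real.exp_nat_mul, Real.exp_log (by norm_num)]
  rw [h3, ← Real.exp_add, Real.exp_le_exp]
  nlinarith

theorem FieldChoice.card_FqN (M : FieldChoice F) (N : ℕ+) :
    Fintype.card (M.FqN N) = Fintype.card F ^ (N : ℕ) := by
  have := (M.monic N).finite_adjoinRoot
  rw [Module.card_eq_pow_finrank (K := F), (AdjoinRoot.powerBasis' (M.monic N)).finrank,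
    AdjoinRoot.powerBasis'_dim, M.natDegree_eq]

theorem FieldChoice.sum_rep (M : FieldChoice F) (N : ℕ+) (f : F[X] → ℝ) :
    ∑ x : M.FqN N, f (M.rep N x) = ∑ h ∈ polysLT F N, f h := by
  refine Finset.sum_bij (fun x _ => M.rep N x) (fun x _ => mem_polysLT.2 (M.degree_rep_lt N x))
    (fun x _ y _ h => M.rep_injective N h) (fun h hh => ?_) fun _ _ => rfl
  exact ⟨AdjoinRoot.mk (M.f N) h, Finset.mem_univ _, M.rep_mk N (mem_polysLT.1 hh)⟩

/-- All exponential moments of `invNormSum` are bounded. -/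
theorem exists_expect_exp_invNormSum_le (F : Type*) [Field F] [Fintype F] {c : ℝ} (hc : 0 ≤ c) :
    ∃ B : ℝ, ∀ (M : FieldChoice F) (N : ℕ+),
      (𝔼 x : M.FqN N, Real.exp (c * invNormSum N (M.rep N x))) ≤ B := by
  classical
  obtain ⟨B, hB⟩ := exists_exp_log_le_pow hc
  have h2 : (2 : ℝ) ≤ Fintype.card F := by exact_mod_cast two_le_card
  refine ⟨Real.exp (c * Real.exp c * 2) + B, fun M N => ?_⟩
  rw [Fintype.expect_eq_sum_div_card, M.card_FqN, M.sum_rep N fun h => Real.exp (c * invNormSum N h)]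
  push_cast
  rw [div_le_iff₀ (by positivity), add_mul]
  -- The zero polynomial has `invNormSum` as large as `1 + log N`, but its single term is only a
  -- power of `N` and is dominated by `q ^ N`.
  have h0 : (0 : F[X]) ∈ polysLT F N := by
    rw [mem_polysLT, degree_zero]; exact WithBot.bot_lt_coe _
  rw [← Finset.sum_erase_add _ _ h0]
  refine add_le_add (sum_exp_invNormSum_le hc N) ?_
  have hB0 : 0 ≤ B := by
    have h3 := (Real.exp_pos _).le.trans (hB 1 one_pos)
    norm_num at h3; exact h3
  have h1 : invNormSum N (0 : F[X]) ≤ 1 + Real.log N := by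
    rw [invNormSum, Finset.filter_true_of_mem fun P _ => dvd_zero _]
    exact sum_invNorm_primesLT_le N
  calc _ ≤ Real.exp (c * (1 + Real.log N)) :=
        Real.exp_le_exp.2 (mul_le_mul_of_nonneg_left h1 hc)
    _ ≤ B * 2 ^ (N : ℕ) := hB N N.pos
    _ ≤ _ := by gcongr

end Moments

/-! ### From exponential bounds to the correlation condition -/

section CorrelationWeights

variable {F : Type*} [Field F] [Fintype F] (M : FieldChoice F)

/-- The sum over at most `l₀ ^ 2` pairs is at most `l₀ ^ 2` times its largest term, whose
exponential occurs on the right. A pair exists because `2 ≤ l`. -/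
theorem exp_pair_sum_le {l l₀ : ℕ} (hl : 2 ≤ l) (hl₀ : l ≤ l₀) {c : ℝ} (hc : 0 ≤ c)
    (s : Fin l → Fin l → ℝ) (hs : ∀ i j, 0 ≤ s i j) :
    Real.exp (c * ∑ i, ∑ j ∈ Finset.Ioi i, s i j) ≤
      ∑ i, ∑ j ∈ Finset.Ioi i, Real.exp (c * l₀ ^ 2 * s i j) := by
  classical
  rw [Finset.sum_sigma', Finset.sum_sigma']
  set T := (Finset.univ : Finset (Fin l)).sigma fun i => Finset.Ioi i with hT
  have hne : T.Nonempty := by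
    refine ⟨⟨⟨0, by omega⟩, ⟨1, by omega⟩⟩, ?_⟩
    simp [hT]
  obtain ⟨t, ht, hmax⟩ := Finset.exists_max_image T (fun t => s t.1 t.2) hne
  refine le_trans ?_ (Finset.single_le_sum (f := fun t : (_ : Fin l) × Fin l =>
    Real.exp (c * l₀ ^ 2 * s t.1 t.2)) (fun t _ => (Real.exp_pos _).le) ht)
  refine Real.exp_le_exp.2 ?_
  rw [mul_assoc]
  refine mul_le_mul_of_nonneg_left ?_ hc
  refine (Finset.sum_le_card_nsmul _ _ _ hmax).trans ?_
  rw [nsmul_eq_mul]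
  refine mul_le_mul_of_nonneg_right ?_ (hs _ _)
  have h1 : T.card ≤ l ^ 2 := by
    have : T.card ≤ (Finset.univ : Finset ((_ : Fin l) × Fin l)).card := Finset.card_le_univ _
    simpa [sq] using this
  exact_mod_cast h1.trans (Nat.pow_le_pow_left hl₀ 2)

/-- Exponential correlation bounds for large `N` imply the correlation condition. -/
theorem correlationCondition_of_eventually {l₀ : ℕ} {ν : ∀ N : ℕ+, M.FqN N → ℝ}
    (hν : ∀ N x, 0 ≤ ν N x) {D c : ℝ} (hD : 0 ≤ D) (hc : 0 ≤ c) (N₀ : ℕ+)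
    (h : ∀ N : ℕ+, N₀ ≤ N → ∀ l : ℕ, 2 ≤ l → l ≤ l₀ → ∀ h : Fin l → M.FqN N,
      (𝔼 x : M.FqN N, ∏ i, ν N (x + h i)) ≤
        D * Real.exp (c * ∑ i : Fin l, ∑ j ∈ Finset.Ioi i, invNormSum N (M.rep N (h i - h j)))) :
    CorrelationCondition M l₀ ν := by
  classical
  have hsum0 : ∀ N, 0 ≤ ∑ x, ν N x := fun N => Finset.sum_nonneg fun x _ => hν N x
  -- Below `N₀` the weight is a constant that dominates every product of at most `l₀` values of `ν
  -- N`; these finitely many `N` do not affect the boundedness of moments.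
  set τ : ∀ N : ℕ+, M.FqN N → ℝ := fun N x =>
    if N₀ ≤ N then D * Real.exp (c * l₀ ^ 2 * invNormSum N (M.rep N x))
    else (1 + ∑ y, ν N y) ^ l₀ with hτ
  have hτ0 : ∀ N x, 0 ≤ τ N x := by
    intro N x
    have := hsum0 N
    simp only [hτ]
    split_ifs <;> positivity
  refine ⟨τ, hτ0, ?_, ?_⟩
  · intro p hp
    obtain ⟨B, hB⟩ := exists_expect_exp_invNormSum_le F
      (c := p * (c * l₀ ^ 2)) (by positivity)
    have hnn : ∀ N : ℕ+, 0 ≤ 𝔼 x : M.FqN N, τ N x ^ p := fun N =>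
      Finset.expect_nonneg fun x _ => Real.rpow_nonneg (hτ0 N x) p
    have hB0 : 0 ≤ B := le_trans (Finset.expect_nonneg fun x _ => (Real.exp_pos _).le) (hB M 1)
    refine ⟨D ^ p * B + ∑ N ∈ Finset.Iic N₀, 𝔼 x : M.FqN N, τ N x ^ p, fun N => ?_⟩
    rcases le_or_gt N₀ N with hN | hN
    · refine le_add_of_le_of_nonneg ?_ (Finset.sum_nonneg fun N _ => hnn N)
      refine le_trans (le_of_eq ?_) (mul_le_mul_of_nonneg_left (hB M N) (Real.rpow_nonneg hD p))
      rw [Finset.mul_expect]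
      refine Finset.expect_congr rfl fun x _ => ?_
      simp only [hτ]
      rw [if_pos hN, Real.mul_rpow hD (Real.exp_pos _).le, ← Real.exp_mul]
      congr 2
      ring
    · refine le_add_of_nonneg_of_le (mul_nonneg (Real.rpow_nonneg hD p) hB0) ?_
      exact Finset.single_le_sum (f := fun N : ℕ+ => 𝔼 x : M.FqN N, τ N x ^ p)
        (fun N _ => hnn N) (Finset.mem_Iic.2 hN.le)
  · intro N l hl hl₀ g
    rcases le_or_gt N₀ N with hN | hN
    · refine (h N hN l hl hl₀ g).trans ?_
      simp only [hτ, if_pos hN, ← Finset.mul_sum]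
      exact mul_le_mul_of_nonneg_left (exp_pair_sum_le hl hl₀ hc
        (fun i j => invNormSum N (M.rep N (g i - g j))) fun i j => invNormSum_nonneg _ _) hD
    · have h1 : (𝔼 x : M.FqN N, ∏ i, ν N (x + g i)) ≤ (1 + ∑ y, ν N y) ^ l₀ := by
        refine (Finset.expect_le_expect (g := fun _ => (1 + ∑ y, ν N y) ^ l₀) fun x _ => ?_).trans
          (le_of_eq (Fintype.expect_const _))
        calc _ ≤ ∏ _i : Fin l, (1 + ∑ y, ν N y) :=
              Finset.prod_le_prod (fun i _ => hν _ _) fun i _ => by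
                have := Finset.single_le_sum (f := ν N) (fun y _ => hν N y)
                  (Finset.mem_univ (x + g i))
                linarith
          _ = (1 + ∑ y, ν N y) ^ l := by simp
          _ ≤ _ := pow_le_pow_right₀ (by linarith [hsum0 N]) hl₀
      refine h1.trans ?_
      have hpair : (⟨1, by omega⟩ : Fin l) ∈ Finset.Ioi (⟨0, by omega⟩ : Fin l) := by simp
      refine le_trans ?_ (Finset.single_le_sum (fun i _ => Finset.sum_nonneg fun j _ => hτ0 _ _)
        (Finset.mem_univ (⟨0, by omega⟩ : Fin l)))
      refine le_trans ?_ (Finset.single_le_sum (fun j _ => hτ0 _ _) hpair)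
      simp only [hτ, if_neg (not_le.2 hN), le_refl]

end CorrelationWeights


/-! ### Counting irreducible polynomials -/

section PrimeCounting

variable {F : Type*} [Field F] [Fintype F]

open scoped Classical in
theorem ncard_degree_lt (s : Set F[X]) (N : ℕ) :
    {f ∈ s | f.degree < (N : WithBot ℕ)}.ncard = ((polysLT F N).filter (· ∈ s)).card := by
  rw [← Set.ncard_coe_finset]
  congr 1
  ext f
  rw [Finset.mem_coe, Finset.mem_filter, mem_polysLT, and_comm]
  rfl

/-- The elementary lower bound for the number of irreducible polynomials of degree at most `n`. -/
theorem FieldChoice.card_pow_le_mul_ncard (M : FieldChoice F) (n : ℕ+) :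
    Fintype.card F ^ (n : ℕ) ≤
      n * {f ∈ irreducibles F | f.degree < ((n + 1 : ℕ) : WithBot ℕ)}.ncard := by
  classical
  have := (M.monic n).finite_adjoinRoot
  have hfin : Module.finrank F (M.FqN n) = n := by
    rw [(AdjoinRoot.powerBasis' (M.monic n)).finrank, AdjoinRoot.powerBasis'_dim, M.natDegree_eq]
  have hint : ∀ y : M.FqN n, IsIntegral F y := fun y => Algebra.IsIntegral.isIntegral y
  have hdeg : ∀ y : M.FqN n, (minpoly F y).natDegree ≤ n := fun y => by
    rw [← hfin]; exact minpoly.natDegree_le y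
  rw [ncard_degree_lt, ← M.card_FqN n, ← Finset.card_univ]
  -- Each of the `q ^ n` field elements has an irreducible minimal polynomial of degree at most `n`,
  -- and each such polynomial has at most `n` roots.
  refine Finset.card_le_mul_card_image_of_maps_to (f := fun y => minpoly F y) (fun y _ => ?_) _
    fun p hp => ?_
  · refine Finset.mem_filter.2 ⟨mem_polysLT.2 ?_, minpoly.irreducible (hint y)⟩
    rw [degree_eq_natDegree (minpoly.ne_zero (hint y)), Nat.cast_lt]
    exact Nat.lt_succ_of_le (hdeg y)
  · obtain ⟨hp1, hp2⟩ := Finset.mem_filter.1 hp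
    have hp0 : p ≠ 0 := Irreducible.ne_zero hp2
    rw [mem_polysLT, degree_eq_natDegree hp0, Nat.cast_lt] at hp1
    have hinj := FaithfulSMul.algebraMap_injective F (M.FqN n)
    calc _ ≤ (p.map (algebraMap F (M.FqN n))).roots.toFinset.card := by
          refine Finset.card_le_card fun y hy => ?_
          have hy' : minpoly F y = p := (Finset.mem_filter.1 hy).2
          rw [Multiset.mem_toFinset, mem_roots (map_ne_zero hp0), IsRoot.def, eval_map_algebraMap,
            ← hy', minpoly.aeval]
      _ ≤ _ := (Multiset.toFinset_card_le _).trans ((card_roots' _).trans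
          (by rw [natDegree_map]; omega))

theorem eventually_mul_pow_half_le {q : ℕ} (hq : 2 ≤ q) {ε : ℝ} (hε : 0 < ε) :
    ∀ᶠ N : ℕ in atTop, (q : ℝ) ^ (N / 2) ≤ ε / (4 * q * N) * (q : ℝ) ^ N := by
  have hq0 : (2 : ℝ) ≤ q := by exact_mod_cast hq
  have h := tendsto_pow_const_mul_const_pow_of_abs_lt_one 1 (r := (1 / 2 : ℝ))
    (by rw [abs_of_pos] <;> norm_num)
  have h1 : ∀ᶠ m : ℕ in atTop, (m : ℝ) ^ 1 * (1 / 2) ^ m < ε / (8 * q) :=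
    h.eventually_lt_const (by positivity)
  have h2 : Tendsto (fun N : ℕ => N - N / 2) atTop (atTop : Filter ℕ) :=
    tendsto_atTop.2 fun a => (eventually_ge_atTop (2 * a)).mono fun N hN => by omega
  filter_upwards [h2.eventually h1, eventually_gt_atTop 0] with N hN hN0
  have hN0' : (0 : ℝ) < N := by exact_mod_cast hN0
  obtain ⟨m, hm⟩ : ∃ m, m = N - N / 2 := ⟨_, rfl⟩
  rw [← hm, pow_one, one_div, inv_pow, ← div_eq_mul_inv, div_lt_iff₀ (by positivity)] at hN
  have hNm : (N : ℝ) ≤ 2 * m := by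
    have : N ≤ 2 * m := by omega
    exact_mod_cast this
  have hpow : (2 : ℝ) ^ m ≤ (q : ℝ) ^ m := by gcongr
  have hs : (q : ℝ) ^ N = (q : ℝ) ^ (N / 2) * (q : ℝ) ^ m := by rw [← pow_add]; congr 1; omega
  rw [hs, div_mul_eq_mul_div, le_div_iff₀ (by positivity), mul_left_comm ε]
  refine mul_le_mul_of_nonneg_left ?_ (by positivity)
  have h3 : (m : ℝ) * (8 * q) < ε * 2 ^ m := by
    rw [div_mul_eq_mul_div, lt_div_iff₀ (by positivity)] at hN; exact hN
  have h4 : ε * 2 ^ m ≤ ε * (q : ℝ) ^ m := by gcongr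
  nlinarith

/-- Sets of primes of positive relative upper density have many elements infinitely often. -/
theorem FieldChoice.frequently_le_ncard (M : FieldChoice F) {A : Set F[X]} {ε : ℝ} (hε : 0 < ε)
    (h : ε ≤ relUpperDensity A) :
    ∃ᶠ N : ℕ in atTop, (Fintype.card F : ℝ) ^ (N / 2) +
      ε / (4 * Fintype.card F * N) * (Fintype.card F : ℝ) ^ N ≤
        {f ∈ A | f.degree < (N : WithBot ℕ)}.ncard := by
  have hlt : ε / 2 < relUpperDensity A := by linarith
  have hf := frequently_lt_of_lt_limsup
    (isCoboundedUnder_le_of_le atTop (x := 0) fun N => by positivity) hlt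
  refine (hf.and_eventually ((eventually_mul_pow_half_le (two_le_card (F := F)) hε).and
    (eventually_ge_atTop 2))).mono fun N hN => ?_
  obtain ⟨hN1, hN2, hN3⟩ := hN
  have hq : (0 : ℝ) < Fintype.card F := by exact_mod_cast Fintype.card_pos
  obtain ⟨n, rfl⟩ := Nat.exists_eq_add_of_le' (by omega : 1 ≤ N)
  have hn : 0 < n := by omega
  have hc := M.card_pow_le_mul_ncard ⟨n, hn⟩
  simp only [PNat.mk_coe] at hc
  have hc' : (Fintype.card F : ℝ) ^ n ≤
      n * ({f ∈ irreducibles F | f.degree < ((n + 1 : ℕ) : WithBot ℕ)}.ncard : ℝ) := by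
    exact_mod_cast hc
  have hn' : (0 : ℝ) < n := by exact_mod_cast hn
  have hI : (0 : ℝ) < {f ∈ irreducibles F | f.degree < ((n + 1 : ℕ) : WithBot ℕ)}.ncard := by
    have : (0 : ℝ) < (Fintype.card F : ℝ) ^ n := by positivity
    by_contra h0
    nlinarith
  rw [lt_div_iff₀ hI] at hN1
  -- The density bound is twice the desired main term; the second half pays for `q ^ (N / 2)`, which
  -- allows the elements of low degree to be discarded later.
  have h1 : 2 * (ε / (4 * Fintype.card F * ((n + 1 : ℕ) : ℝ)) * (Fintype.card F : ℝ) ^ (n + 1)) ≤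
      ε / 2 * {f ∈ irreducibles F | f.degree < ((n + 1 : ℕ) : WithBot ℕ)}.ncard := by
    have e : 2 * (ε / (4 * Fintype.card F * ((n + 1 : ℕ) : ℝ)) * (Fintype.card F : ℝ) ^ (n + 1)) =
        ε / 2 * ((Fintype.card F : ℝ) ^ n / (n + 1)) := by
      push_cast; field_simp; ring
    rw [e]
    refine mul_le_mul_of_nonneg_left ?_ (by positivity)
    rw [div_le_iff₀ (by positivity)]
    nlinarith
  linarith

end PrimeCounting

/-! ### A residue class rich in elements of the set -/

section Residues

variable {F : Type*} [Field F] [Fintype F]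

open scoped Classical in
theorem polyTotient_eq_card (W : F[X]) (hW : W ≠ 0) :
    polyTotient W = ((polysLT F W.natDegree).filter fun g => IsCoprime g W).card := by
  rw [polyTotient, ← Set.ncard_coe_finset]
  congr 1
  ext f
  rw [Finset.mem_coe, Finset.mem_filter, mem_polysLT, ← degree_eq_natDegree hW]
  rfl

theorem polyNorm_primorial (w : ℕ) : polyNorm (polyPrimorial F w) =
    (Fintype.card F : ℝ) ^ (polyPrimorial F w).natDegree := by
  rw [polyNorm, if_neg (polyPrimorial_monic w).ne_zero]

theorem totientRatio_pos (w : ℕ) :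
    0 < (polyTotient (polyPrimorial F w) : ℝ) / polyNorm (polyPrimorial F w) := by
  rw [polyTotient_div_polyNorm]
  exact Finset.prod_pos fun P _ => by linarith [invNorm_le_half P]

theorem totientRatio_le_one (w : ℕ) :
    (polyTotient (polyPrimorial F w) : ℝ) / polyNorm (polyPrimorial F w) ≤ 1 := by
  rw [polyTotient_div_polyNorm]
  exact Finset.prod_le_one (fun P _ => by linarith [invNorm_le_half P])
    fun P _ => by linarith [invNorm_pos P]

theorem exists_coprime_residue (w : ℕ) :
    ∃ b : F[X], b.degree < (polyPrimorial F w).degree ∧ IsCoprime b (polyPrimorial F w) := by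
  have h : polyTotient (polyPrimorial F w) ≠ 0 := fun h0 => by
    have := totientRatio_pos (F := F) w
    rw [h0] at this; simp at this
  obtain ⟨b, hb⟩ := Set.nonempty_of_ncard_ne_zero h
  exact ⟨b, hb⟩

theorem isCoprime_primorial_of_irreducible {f : F[X]} (hf : Irreducible f) {w : ℕ}
    (h : w ≤ f.natDegree) : IsCoprime f (polyPrimorial F w) := by
  rw [polyPrimorial_eq, IsCoprime.prod_right_iff]
  intro P hP
  rw [isCoprime_comm, P.irreducible.coprime_iff_not_dvd]
  intro hd
  have := natDegree_eq_of_degree_eq (degree_eq_degree_of_associated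
    (P.irreducible.associated_of_dvd hf hd))
  have h2 := mem_primesLT.1 hP
  unfold MonicIrr.deg at h2
  omega

open scoped Classical in
/-- Some residue class modulo the primorial contains many elements of a given set of primes. -/
theorem exists_residue_card_le {A : Set F[X]} (hA : A ⊆ irreducibles F) {w T : ℕ} (hT : w ≤ T)
    (N : ℕ) :
    ∃ b : F[X], b.degree < (polyPrimorial F w).degree ∧ IsCoprime b (polyPrimorial F w) ∧
      {f ∈ A | f.degree < ((N + (polyPrimorial F w).natDegree : ℕ) : WithBot ℕ)}.ncard ≤
        Fintype.card F ^ T + polyTotient (polyPrimorial F w) *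
          ((polysLT F N).filter fun h => polyPrimorial F w * h + b ∈ A ∧
            T ≤ (polyPrimorial F w * h + b).natDegree).card := by
  set W := polyPrimorial F w with hW
  have hWm : W.Monic := polyPrimorial_monic w
  set D := W.natDegree with hD
  set B := (polysLT F D).filter fun g => IsCoprime g W with hB
  obtain ⟨b₀, hb₀, hb₀'⟩ := exists_coprime_residue (F := F) w
  have hBne : B.Nonempty := ⟨b₀, Finset.mem_filter.2 ⟨mem_polysLT.2 (by
    rw [hD, ← degree_eq_natDegree hWm.ne_zero]; exact hb₀), hb₀'⟩⟩
  set S : F[X] → Finset F[X] := fun b => (polysLT F N).filter fun h => W * h + b ∈ A ∧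
    T ≤ (W * h + b).natDegree with hS
  -- Pigeonhole: an irreducible polynomial of degree at least `w` lies in a class coprime to `W`, so
  -- the most populated such class holds at least the average share.
  obtain ⟨b, hbB, hmax⟩ := Finset.exists_max_image B (fun b => (S b).card) hBne
  obtain ⟨hb1, hb2⟩ := Finset.mem_filter.1 hbB
  rw [mem_polysLT, hD, ← degree_eq_natDegree hWm.ne_zero] at hb1
  refine ⟨b, hb1, hb2, ?_⟩
  rw [ncard_degree_lt, ← Finset.card_filter_add_card_filter_not (fun f => f.natDegree < T)]
  refine add_le_add ?_ ?_
  · rw [← card_polysLT T]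
    refine Finset.card_le_card fun f hf => ?_
    obtain ⟨hf1, hf2⟩ := Finset.mem_filter.1 hf
    have hf0 : f ≠ 0 := (hA (Finset.mem_filter.1 hf1).2).ne_zero
    rw [mem_polysLT, degree_eq_natDegree hf0, Nat.cast_lt]
    exact hf2
  · rw [polyTotient_eq_card W hWm.ne_zero, mul_comm]
    refine Finset.card_le_mul_card_image_of_maps_to (f := fun f => f %ₘ W) (fun f hf => ?_) _
      fun c hc => ?_
    · obtain ⟨hf1, hf2⟩ := Finset.mem_filter.1 hf
      have hfi : Irreducible f := hA (Finset.mem_filter.1 hf1).2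
      refine Finset.mem_filter.2 ⟨mem_polysLT.2 ?_, ?_⟩
      · rw [← degree_eq_natDegree hWm.ne_zero]; exact degree_modByMonic_lt _ hWm
      · have h1 : IsCoprime f W := isCoprime_primorial_of_irreducible hfi (by omega)
        rw [modByMonic_eq_sub_mul_div, sub_eq_add_neg, ← mul_neg]
        exact h1.add_mul_left_left _
    · refine le_trans ?_ (hmax c hc)
      refine Finset.card_le_card_of_injOn (fun f => f /ₘ W) (fun f hf => ?_) fun f hf g hg hfg => ?_
      · obtain ⟨hf0, hfc⟩ := Finset.mem_filter.1 hf
        obtain ⟨hf1, hf2⟩ := Finset.mem_filter.1 hf0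
        obtain ⟨hf3, hf4⟩ := Finset.mem_filter.1 hf1
        have e : W * (f /ₘ W) + c = f := by rw [← hfc, add_comm]; exact modByMonic_add_div f W
        have hdeg : (f /ₘ W).degree < (N : WithBot ℕ) := by
          rcases eq_or_ne (f /ₘ W) 0 with h0 | h0
          · rw [h0, degree_zero]; exact WithBot.bot_lt_coe _
          · have hf0 : f ≠ 0 := (hA hf4).ne_zero
            rw [mem_polysLT, degree_eq_natDegree hf0, Nat.cast_lt] at hf3
            rw [degree_eq_natDegree h0, Nat.cast_lt, natDegree_divByMonic f hWm]
            have : f /ₘ W ≠ 0 → D ≤ f.natDegree := fun h => by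
              by_contra hlt
              exact h ((divByMonic_eq_zero_iff hWm).2 (degree_lt_degree (not_le.1 hlt)))
            have := this h0
            omega
        simp only [hS, Finset.coe_filter, Set.mem_ofPred_eq]
        rw [e]
        exact ⟨mem_polysLT.2 hdeg, hf4, by omega⟩
      · have hf' := (Finset.mem_filter.1 hf).2
        have hg' := (Finset.mem_filter.1 hg).2
        rw [← modByMonic_add_div f W, ← modByMonic_add_div g W]
        simp only at hfg hf' hg'
        rw [hfg, hf', hg']

end Residues

/-! ### The dense function below the majorant -/

section Majorant

variable {F : Type*} [Field F] [Fintype F]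

/-- The only other monic divisor is associated to `f` and has degree at least `R`, so `d = 1` alone
remains. -/
theorem divisorSum_of_irreducible (χ : ℝ → ℝ) {R : ℝ} (hR : 0 < R) {f : F[X]} (hf : Irreducible f)
    (h : R ≤ f.natDegree) : divisorSum χ R f = χ 0 := by
  classical
  have hfil : (polysLT F ⌈R⌉₊).filter (fun d => d.Monic ∧ d ∣ f ∧ (d.natDegree : ℝ) < R) = {1} := by
    ext d
    rw [Finset.mem_filter, Finset.mem_singleton]
    constructor
    · rintro ⟨-, hm, hd, hlt⟩
      rcases hf.dvd_iff.1 hd with hu | ha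
      · exact hm.eq_one_of_isUnit hu
      · rw [natDegree_eq_of_degree_eq (degree_eq_degree_of_associated ha)] at h
        linarith
    · rintro rfl
      refine ⟨mem_polysLT.2 ?_, monic_one, one_dvd _, by simpa using hR⟩
      rw [degree_one]
      exact_mod_cast Nat.ceil_pos.2 hR
  unfold divisorSum
  have : (polysLT F ⌈R⌉₊).filter (fun d => d.Monic ∧ d ∣ f ∧ (d.natDegree : ℝ) < R) = {1} := hfil
  simp only [this]
  simp

theorem sieveWeight_nonneg (χ : ℝ → ℝ) {R : ℝ} (hR : 0 ≤ R) (w : ℕ) (b h : F[X]) :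
    0 ≤ sieveWeight χ R (polyPrimorial F w) b h :=
  mul_nonneg (mul_nonneg hR (totientRatio_pos w).le) (sq_nonneg _)

/-- The restriction of the sieve majorant to a residue class rich in a set of primes. -/
theorem FieldChoice.exists_dense_le_sieveWeight (M : FieldChoice F) (χ : ℝ → ℝ) {A : Set F[X]}
    (hA : A ⊆ irreducibles F) {w T : ℕ} (hT : w ≤ T) (N : ℕ+) {R : ℝ} (hR : 0 < R) (hRT : R ≤ T) :
    ∃ b : F[X], b.degree < (polyPrimorial F w).degree ∧ IsCoprime b (polyPrimorial F w) ∧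
      ∃ φ : M.FqN N → ℝ,
        (∀ x, polyPrimorial F w * M.rep N x + b ∉ A → φ x = 0) ∧
        (∀ x, 0 ≤ φ x ∧ φ x ≤ sieveWeight χ R (polyPrimorial F w) b (M.rep N x)) ∧
        R * χ 0 ^ 2 * (({f ∈ A | f.degree <
          ((N + (polyPrimorial F w).natDegree : ℕ) : WithBot ℕ)}.ncard -
            (Fintype.card F : ℝ) ^ T) /
              (Fintype.card F : ℝ) ^ (N + (polyPrimorial F w).natDegree : ℕ)) ≤ 𝔼 x, φ x ∧
        ∀ x, |φ x| ≤ R * χ 0 ^ 2 := by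
  classical
  have hq : (0 : ℝ) < Fintype.card F := by exact_mod_cast Fintype.card_pos
  obtain ⟨b, hb1, hb2, hcard⟩ := exists_residue_card_le hA hT N
  refine ⟨b, hb1, hb2, ?_⟩
  set W := polyPrimorial F w with hW
  set s : ℝ := R * ((polyTotient W : ℝ) / polyNorm W) * χ 0 ^ 2 with hs
  have hs0 : 0 ≤ s := mul_nonneg (mul_nonneg hR.le (totientRatio_pos w).le) (sq_nonneg _)
  -- The degree condition `T ≤ natDegree` guarantees degree at least `R`; there the majorant takes
  -- exactly the value `s`.
  set φ : M.FqN N → ℝ := fun x =>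
    if W * M.rep N x + b ∈ A ∧ T ≤ (W * M.rep N x + b).natDegree then s else 0 with hφ
  have hφ0 : ∀ x, 0 ≤ φ x := fun x => by simp only [hφ]; split_ifs; exacts [hs0, le_rfl]
  have hφs : ∀ x, φ x ≤ s := fun x => by simp only [hφ]; split_ifs; exacts [le_rfl, hs0]
  refine ⟨φ, fun x hx => if_neg fun h => hx h.1, fun x => ⟨hφ0 x, ?_⟩, ?_, fun x => ?_⟩
  · simp only [hφ]
    split_ifs with h
    · have h1 : R ≤ (W * M.rep N x + b).natDegree := hRT.trans (by exact_mod_cast h.2)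
      rw [sieveWeight, divisorSum_of_irreducible χ hR (hA h.1) h1]
    · exact sieveWeight_nonneg χ hR.le w b _
  · rw [Fintype.expect_eq_sum_div_card, M.card_FqN,
      M.sum_rep N fun h => if W * h + b ∈ A ∧ T ≤ (W * h + b).natDegree then s else 0,
      ← Finset.sum_filter, Finset.sum_const, nsmul_eq_mul, hs, polyNorm_primorial, ← hW]
    have hcard' : ({f ∈ A | f.degree < ((N + W.natDegree : ℕ) : WithBot ℕ)}.ncard : ℝ) ≤
        (Fintype.card F : ℝ) ^ T + polyTotient W * ((polysLT F N).filter fun h => W * h + b ∈ A ∧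
            T ≤ (W * h + b).natDegree).card := by exact_mod_cast hcard
    rw [Nat.cast_pow, pow_add, mul_div_assoc', div_le_div_iff₀ (by positivity) (by positivity)]
    have hRχ : 0 ≤ R * χ 0 ^ 2 * (Fintype.card F : ℝ) ^ (N : ℕ) := by positivity
    have h2 := mul_le_mul_of_nonneg_left (sub_le_iff_le_add'.2 hcard') hRχ
    calc _ = _ := by ring
      _ ≤ _ := h2
      _ = _ := by field_simp
  · rw [abs_of_nonneg (hφ0 x)]
    refine (hφs x).trans ?_
    have := totientRatio_le_one (F := F) w
    rw [hs, mul_right_comm]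
    exact mul_le_of_le_one_right (by positivity) this

end Majorant


/-! ### Slow growth of the modulus -/

section Diagonal

/-- A slowly growing function along which eventual properties hold, and which hits a given infinite
set after a shift infinitely often. -/
theorem exists_slow_growth {P : ℕ → ℕ → Prop} (hP : ∀ j, ∀ᶠ N in atTop, P j N) {G : ℕ → Prop}
    (hG : ∃ᶠ N in atTop, G N) (D : ℕ → ℕ) :
    ∃ w : ℕ → ℕ, Tendsto w atTop atTop ∧ (∀ N, w N = 0 ∨ P (w N) N) ∧
      ∃ᶠ N in atTop, G (N + D (w N)) := by
  -- At stage `j` a good point `g` is found beyond the current threshold `x`, and the next threshold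
  -- `n` is put after `g`. Thus `w` still equals `j` at `g`, where the shift is `D j`.
  have hstep : ∀ j x : ℕ, ∃ g n : ℕ, x ≤ g ∧ G (g + D j) ∧ g < n ∧ ∀ N, n ≤ N → P (j + 1) N := by
    intro j x
    obtain ⟨y, hy, hGy⟩ := frequently_atTop.1 hG (x + D j)
    obtain ⟨n, hn⟩ := eventually_atTop.1 (hP (j + 1))
    refine ⟨y - D j, max n (y - D j + 1), by omega, ?_, by omega, fun N hN => hn N (by omega)⟩
    rwa [Nat.sub_add_cancel (by omega)]
  choose g n hxg hGg hgn hPn using hstep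
  let s : ℕ → ℕ := fun j => Nat.rec (motive := fun _ => ℕ) 0 (fun j x => n j x) j
  have hs : ∀ j, s (j + 1) = n j (s j) := fun j => rfl
  have hmono : StrictMono s := strictMono_nat_of_lt_succ fun j => by
    rw [hs]; exact (hxg _ _).trans_lt (hgn _ _)
  let w : ℕ → ℕ := fun N => Nat.findGreatest (fun j => s j ≤ N) N
  have hle : ∀ j N, s j ≤ N → j ≤ w N := fun j N h =>
    Nat.le_findGreatest (P := fun j => s j ≤ N) ((hmono.id_le j).trans h) h
  refine ⟨w, tendsto_atTop.2 fun j => (eventually_ge_atTop (s j)).mono fun N hN => hle j N hN,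
    fun N => ?_, frequently_atTop.2 fun a => ⟨g a (s a), (hmono.id_le a).trans (hxg _ _), ?_⟩⟩
  · rcases Nat.eq_zero_or_pos (w N) with h0 | hpos
    · exact Or.inl h0
    · right
      have h1 : s (w N) ≤ N := Nat.findGreatest_of_ne_zero (P := fun j => s j ≤ N) rfl hpos.ne'
      obtain ⟨j, hj⟩ := Nat.exists_eq_add_of_le' hpos
      rw [hj] at h1 ⊢
      exact hPn j (s j) N h1
  · have h1 : w (g a (s a)) = a := by
      refine le_antisymm ?_ (hle _ _ (hxg _ _))
      by_contra hlt
      have h2 : s (w (g a (s a))) ≤ g a (s a) :=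
        Nat.findGreatest_of_ne_zero (P := fun j => s j ≤ g a (s a)) rfl (by omega)
      have h3 : s (a + 1) ≤ s (w (g a (s a))) := hmono.monotone (show a + 1 ≤ w (g a (s a)) by omega)
      have h4 := hgn a (s a)
      rw [hs] at h3
      omega
    rw [h1]
    exact hGg a (s a)

end Diagonal


/-! ### Pseudorandomness and the final choice of parameters -/

section Assembly

variable {F : Type*} [Field F] [Fintype F]

theorem tendsto_linearForms_error (A C : ℝ) :
    Tendsto (fun j : ℕ => (Real.exp (C * (2 * (1 / 2) ^ j)) - 1) * A +
      Real.exp (C * (2 * (1 / 2) ^ j)) * (1 / ((j : ℝ) + 1))) atTop (𝓝 0) := by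
  have h1 : Tendsto (fun j : ℕ => C * (2 * (1 / 2 : ℝ) ^ j)) atTop (𝓝 (C * (2 * 0))) :=
    ((tendsto_pow_atTop_nhds_zero_of_lt_one (by norm_num) (by norm_num)).const_mul 2).const_mul C
  have h2 := (Real.continuous_exp.tendsto _).comp h1
  have h3 := ((h2.sub_const 1).mul_const A).add (h2.mul tendsto_one_div_add_atTop_nhds_zero_nat)
  simpa using h3

theorem tendsto_pnat_val : Tendsto (fun N : ℕ+ => (N : ℕ)) atTop atTop :=
  tendsto_atTop.2 fun a => (eventually_ge_atTop a.succPNat).mono fun N hN =>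
    (Nat.le_succ a).trans (by exact_mod_cast hN)

theorem frequently_pnat {P : ℕ → Prop} (h : ∃ᶠ N in atTop, P N) : ∃ᶠ N : ℕ+ in atTop, P N := by
  rw [frequently_atTop]
  intro a
  obtain ⟨N, hN, hPN⟩ := frequently_atTop.1 h a
  exact ⟨⟨N, a.pos.trans_le hN⟩, hN, hPN⟩

/-- The sieve majorants along a slowly growing choice of moduli are pseudorandom. -/
theorem isPseudorandom_sieveWeight {χ : ℝ → ℝ} {k : ℕ} {α : ℝ} (hα : 0 < α)
    (hα' : 2 * ((Fintype.card F ^ k * 2 ^ (Fintype.card F ^ k - 1) : ℕ) : ℝ) * α ≤ 1 / 2)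
    {A₁ C₁ A₂ C₂ : ℝ} (hA₂ : 0 ≤ A₂) (hC₂ : 0 ≤ C₂) {K₁ K₂ : ℕ → ℝ}
    (M : FieldChoice F)
    (h₁ : ∀ (N : ℕ+) (w : ℕ) (R : ℝ) (b : F[X]), 1 ≤ R → w ≤ N →
        2 * ((Fintype.card F ^ k * 2 ^ (Fintype.card F ^ k - 1)) * (3 * Fintype.card F ^ k - 4) * k)
          < w →
        2 * ((Fintype.card F ^ k * 2 ^ (Fintype.card F ^ k - 1) : ℕ) : ℝ) * R +
          ((Fintype.card F ^ k * 2 ^ (Fintype.card F ^ k - 1) : ℕ) : ℝ) *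
            ((3 * Fintype.card F ^ k - 4 : ℕ) : ℝ) * k ≤ (N : ℕ) →
        IsCoprime b (polyPrimorial F w) → ∀ m n : ℕ,
        m ≤ Fintype.card F ^ k * 2 ^ (Fintype.card F ^ k - 1) → n ≤ 3 * Fintype.card F ^ k - 4 →
        ∀ L : Fin m → Fin n → RatFunc F, (∀ i j, L i j ∈ smallRatFunc F k) → (∀ i, L i ≠ 0) →
        (∀ i i', i ≠ i' → ∀ c : RatFunc F, L i ≠ c • L i') → ∀ d : Fin m → M.FqN N,
        |(𝔼 x : Fin n → M.FqN N, ∏ i, sieveWeight χ R (polyPrimorial F w) b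
            (M.rep N (∑ j, M.embed N (L i j) * x j + d i))) - 1| ≤
          (Real.exp (C₁ * (2 * (1 / 2) ^ w)) - 1) * A₁ +
            Real.exp (C₁ * (2 * (1 / 2) ^ w)) * (K₁ w / R))
    (h₂ : ∀ (N : ℕ+) (w : ℕ) (R : ℝ) (b : F[X]), 1 ≤ R → w ≤ N →
        2 * ((2 ^ (Fintype.card F ^ k - 1) : ℕ) : ℝ) * R ≤ (N : ℕ) →
        IsCoprime b (polyPrimorial F w) → ∀ l : ℕ, 1 ≤ l → l ≤ 2 ^ (Fintype.card F ^ k - 1) →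
        ∀ h : Fin l → M.FqN N,
        (𝔼 x : M.FqN N, ∏ i, sieveWeight χ R (polyPrimorial F w) b (M.rep N (x + h i))) ≤
          Real.exp (C₂ * (2 + ∑ i : Fin l, ∑ j ∈ Finset.Ioi i,
            invNormSum N (M.rep N (h i - h j)))) * (1 + A₂ + K₂ w / R))
    {w : ℕ+ → ℕ} (hw : Tendsto w atTop atTop)
    (hwN : ∀ N, w N = 0 ∨ 1 ≤ α * (N : ℕ) ∧ w N ≤ N ∧
      ((Fintype.card F ^ k * 2 ^ (Fintype.card F ^ k - 1) : ℕ) : ℝ) *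
            ((3 * Fintype.card F ^ k - 4 : ℕ) : ℝ) * k ≤ (N : ℕ) / 2 ∧
      K₁ (w N) / (α * (N : ℕ)) ≤ 1 / ((w N : ℝ) + 1) ∧ K₂ (w N) / (α * (N : ℕ)) ≤ 1)
    {b : ℕ+ → F[X]} (hb : ∀ N, IsCoprime (b N) (polyPrimorial F (w N))) :
    IsPseudorandom M k fun N x =>
      sieveWeight χ (α * (N : ℕ)) (polyPrimorial F (w N)) (b N) (M.rep N x) := by
  have hq : 0 < Fintype.card F ^ k := pow_pos Fintype.card_pos k
  obtain ⟨m₀, hm₀⟩ : ∃ m₀, m₀ = Fintype.card F ^ k * 2 ^ (Fintype.card F ^ k - 1) := ⟨_, rfl⟩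
  obtain ⟨l₀, hl₀⟩ : ∃ l₀, l₀ = 2 ^ (Fintype.card F ^ k - 1) := ⟨_, rfl⟩
  have hlm : (l₀ : ℝ) ≤ m₀ := by
    rw [hm₀, ← hl₀]; exact_mod_cast Nat.le_mul_of_pos_left _ hq
  rw [← hm₀] at hα' h₁ hwN
  rw [← hl₀] at h₂
  obtain ⟨n₀, hn₀⟩ : ∃ n₀, n₀ = 3 * Fintype.card F ^ k - 4 := ⟨_, rfl⟩
  rw [← hn₀] at h₁ hwN
  have hnn : ∀ (N : ℕ+) (x : M.FqN N),
      0 ≤ sieveWeight χ (α * (N : ℕ)) (polyPrimorial F (w N)) (b N) (M.rep N x) := fun N x =>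
    sieveWeight_nonneg χ (by positivity) _ _ _
  have hαN : ∀ N : ℕ+, 2 * m₀ * (α * (N : ℕ)) ≤ ((N : ℕ) : ℝ) / 2 := fun N => by
    have := mul_le_mul_of_nonneg_right hα' (Nat.cast_nonneg (α := ℝ) (N : ℕ))
    linarith
  refine ⟨hnn, ?_, ?_⟩
  · rw [← hm₀, ← hn₀]
    intro ε hε
    have h3 := ((tendsto_linearForms_error A₁ C₁).comp hw).eventually_le_const hε
    have h4 := hw.eventually_gt_atTop (2 * (m₀ * n₀ * k))
    obtain ⟨N₀, hN₀⟩ := eventually_atTop.1 (h3.and h4)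
    refine ⟨N₀, fun N hN m n hm hn L hL hL0 hprop d => ?_⟩
    obtain ⟨h5, h6⟩ := hN₀ N hN
    -- For large `N` the value `w N` is nonzero, so the quantitative alternative holds; it replaces
    -- `K₁ w / R` by `1 / (w + 1)`, which tends to `0`.
    obtain ⟨g1, g2, g3, g4, -⟩ := (hwN N).resolve_left (by omega)
    refine (h₁ N (w N) _ (b N) g1 g2 h6 ?_ (hb N) m n hm hn L hL hL0 hprop d).trans
      (le_trans ?_ h5)
    · linarith [hαN N]
    · simp only [Function.comp_apply]
      gcongr
  · rw [← hl₀]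
    obtain ⟨N₀, hN₀⟩ := eventually_atTop.1 (hw.eventually_gt_atTop 0)
    refine correlationCondition_of_eventually M hnn (D := Real.exp (C₂ * 2) * (1 + A₂ + 1))
      (by positivity) hC₂ N₀ fun N hN l hl hl' g => ?_
    obtain ⟨g1, g2, -, -, g5⟩ := (hwN N).resolve_left (hN₀ N hN).ne'
    refine (h₂ N (w N) _ (b N) g1 g2 ?_ (hb N) l (by omega) hl' g).trans ?_
    · have := mul_le_mul_of_nonneg_right hlm (by positivity : 0 ≤ α * (N : ℕ))
      linarith [hαN N, Nat.cast_nonneg (α := ℝ) (N : ℕ)]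
    · rw [mul_add C₂, Real.exp_add, mul_right_comm]
      gcongr

end Assembly

end FunctionFieldGT

theorem theorem2p3 {F : Type*} [Field F] [Fintype F] (k : ℕ) (hk : 0 < k) :
    ∃ (α : ℝ) (χ : ℝ → ℝ) (C : ℝ), 0 < α ∧ FunctionFieldGT.IsCutoff χ ∧
      ∀ ε : ℝ, 0 < ε → ∃ δ : ℝ, 0 < δ ∧
        ∀ (M : FunctionFieldGT.FieldChoice F) (A : Set F[X]),
          A ⊆ FunctionFieldGT.irreducibles F → ε ≤ FunctionFieldGT.relUpperDensity A →
          ∃ (w : ℕ+ → ℕ) (W b : ℕ+ → F[X]) (ν : ∀ N : ℕ+, M.FqN N → ℝ),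
            Tendsto w atTop atTop ∧
            (∀ N : ℕ+, W N = FunctionFieldGT.polyPrimorial F (w N)) ∧
            (∀ N : ℕ+, (W N).degree < (N : ℕ) ∧ (b N).degree < (W N).degree ∧
              IsCoprime (b N) (W N)) ∧
            (∀ (N : ℕ+) (x : M.FqN N), ν N x =
              FunctionFieldGT.sieveWeight χ (α * (N : ℕ)) (W N) (b N) (M.rep N x)) ∧
            FunctionFieldGT.IsPseudorandom M k ν ∧
            ∃ᶠ N : ℕ+ in atTop, ∃ φ : M.FqN N → ℝ,
              (∀ x, W N * M.rep N x + b N ∉ A → φ x = 0) ∧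
              (∀ x, 0 ≤ φ x ∧ φ x ≤ ν N x) ∧
              δ ≤ 𝔼 x, φ x ∧
              ∀ x, |φ x| ≤ C * (N : ℕ) := by
  classical
  open FunctionFieldGT in
  obtain ⟨χ, hχ⟩ := exists_isCutoff
  obtain ⟨m₀, hm₀⟩ : ∃ m₀, m₀ = Fintype.card F ^ k * 2 ^ (Fintype.card F ^ k - 1) := ⟨_, rfl⟩
  have hq0 : (0 : ℝ) < Fintype.card F := by exact_mod_cast Fintype.card_pos
  have hm₀1 : 1 ≤ m₀ := by
    rw [hm₀]
    exact Nat.one_le_iff_ne_zero.2 (Nat.mul_ne_zero (pow_pos Fintype.card_pos k).ne' (by positivity))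
  have hm₀1' : (1 : ℝ) ≤ m₀ := by exact_mod_cast hm₀1
  obtain ⟨A₁, C₁, -, -, K₁, -, h₁⟩ := exists_abs_expect_linearForms_sub_one_le F hχ m₀
    (3 * Fintype.card F ^ k - 4) k
  obtain ⟨A₂, C₂, hA₂, hC₂, K₂, -, h₂⟩ := exists_expect_correlation_le F hχ
    (2 ^ (Fintype.card F ^ k - 1))
  -- With this `α` one has `2 * m₀ * R = N / 2`, so half of the available degree remains for
  -- clearing denominators.
  obtain ⟨α, hα⟩ : ∃ α : ℝ, α = 1 / (4 * m₀) := ⟨_, rfl⟩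
  have hα0 : 0 < α := by rw [hα]; positivity
  have hαm : 2 * (m₀ : ℝ) * α ≤ 1 / 2 := by rw [hα]; apply le_of_eq; field_simp; norm_num
  have hα4 : α ≤ 1 / 4 := by nlinarith
  have hχ0 := hχ.pos
  -- The mean is at least `α * N * χ 0 ^ 2 * ε / (4 * q * E)` with `E = N + deg W ≤ 2 * N`, which
  -- gives the constant `8` in `δ`.
  refine ⟨α, χ, α * χ 0 ^ 2, hα0, hχ, fun ε hε =>
    ⟨α * χ 0 ^ 2 * (ε / (8 * Fintype.card F)), by positivity, fun M A hA hAε => ?_⟩⟩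
  set Q : ℕ → ℕ → Prop := fun j N => 1 ≤ α * N ∧ j ≤ N ∧
    (m₀ : ℝ) * ((3 * Fintype.card F ^ k - 4 : ℕ) : ℝ) * k ≤ (N : ℝ) / 2 ∧
    K₁ j / (α * N) ≤ 1 / ((j : ℝ) + 1) ∧ K₂ j / (α * N) ≤ 1 ∧
    (polyPrimorial F j).natDegree < N ∧ 2 * j ≤ N with hQ
  have hQev : ∀ j, ∀ᶠ N in atTop, Q j N := by
    intro j
    have t1 : Tendsto (fun N : ℕ => α * (N : ℝ)) atTop atTop :=
      tendsto_natCast_atTop_atTop.const_mul_atTop hα0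
    have t2 : Tendsto (fun N : ℕ => (N : ℝ) / 2) atTop atTop :=
      tendsto_natCast_atTop_atTop.atTop_div_const two_pos
    exact (t1.eventually_ge_atTop 1).and ((eventually_ge_atTop j).and
      ((t2.eventually_ge_atTop _).and
      (((t1.const_div_atTop (K₁ j)).eventually_le_const (by positivity)).and
      (((t1.const_div_atTop (K₂ j)).eventually_le_const one_pos).and
      ((eventually_gt_atTop _).and (eventually_ge_atTop (2 * j)))))))
  obtain ⟨w, hw, hwQ, hwG⟩ := exists_slow_growth hQev (M.frequently_le_ncard hε hAε)
    fun j => (polyPrimorial F j).natDegree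
  have hdegW : ∀ N : ℕ+, (polyPrimorial F (w N)).natDegree < N := by
    intro N
    rcases hwQ N with h0 | h
    · rw [h0, polyPrimorial_eq, MonicIrr.natDegree_prod, Finset.sum_eq_zero]
      · exact N.pos
      · intro P hP
        exact absurd (mem_primesLT.1 hP) (Nat.not_lt_zero _)
    · exact h.2.2.2.2.2.1
  have hres : ∀ N : ℕ+, ∃ b : F[X], b.degree < (polyPrimorial F (w N)).degree ∧
      IsCoprime b (polyPrimorial F (w N)) ∧
      ((Fintype.card F : ℝ) ^ ((N + (polyPrimorial F (w N)).natDegree : ℕ) / 2) +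
        ε / (4 * Fintype.card F * (N + (polyPrimorial F (w N)).natDegree : ℕ)) *
          (Fintype.card F : ℝ) ^ (N + (polyPrimorial F (w N)).natDegree : ℕ) ≤
        {f ∈ A | f.degree < ((N + (polyPrimorial F (w N)).natDegree : ℕ) : WithBot ℕ)}.ncard →
        w N ≠ 0 → ∃ φ : M.FqN N → ℝ,
          (∀ x, polyPrimorial F (w N) * M.rep N x + b ∉ A → φ x = 0) ∧
          (∀ x, 0 ≤ φ x ∧
            φ x ≤ sieveWeight χ (α * (N : ℕ)) (polyPrimorial F (w N)) b (M.rep N x)) ∧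
          α * χ 0 ^ 2 * (ε / (8 * Fintype.card F)) ≤ 𝔼 x, φ x ∧
          ∀ x, |φ x| ≤ α * χ 0 ^ 2 * (N : ℕ)) := by
    intro N
    obtain ⟨E, hE⟩ : ∃ E, E = (N + (polyPrimorial F (w N)).natDegree : ℕ) := ⟨_, rfl⟩
    -- Only finitely many `N` have `w N = 0`; for them any coprime residue serves and no function
    -- `φ` is needed.
    rcases eq_or_ne (w N) 0 with h0 | h0
    · obtain ⟨b, hb1, hb2⟩ := exists_coprime_residue (F := F) (w N)
      exact ⟨b, hb1, hb2, fun _ h => absurd h0 h⟩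
    obtain ⟨g1, -, -, -, -, g6, g7⟩ := (hwQ N).resolve_left h0
    have hN1 : (1 : ℝ) ≤ (N : ℕ) := by exact_mod_cast N.pos
    have hN2 : 2 ≤ (N : ℕ) := by
      by_contra hlt
      have : ((N : ℕ) : ℝ) ≤ 1 := by exact_mod_cast (by omega : (N : ℕ) ≤ 1)
      nlinarith
    have hE2 : (E : ℝ) ≤ 2 * (N : ℕ) := by
      have : E ≤ 2 * N := by omega
      exact_mod_cast this
    have hE0 : (0 : ℝ) < E := by
      have : 0 < E := by omega
      exact_mod_cast this
    -- The degree threshold is `T = E / 2`: large enough to exceed `R`, since `α ≤ 1 / 4`, and small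
    -- enough that the discarded `q ^ T` polynomials are covered by the counting bound.
    have hRT : α * (N : ℕ) ≤ (E / 2 : ℕ) := by
      have h3 : (N : ℕ) ≤ 4 * (E / 2) := by omega
      have h4 : ((N : ℕ) : ℝ) ≤ 4 * (E / 2 : ℕ) := by exact_mod_cast h3
      nlinarith
    obtain ⟨b, hb1, hb2, φ, p1, p2, p3, p4⟩ := M.exists_dense_le_sieveWeight χ hA
      (w := w N) (T := E / 2) (by omega) N (R := α * (N : ℕ)) (by positivity) hRT
    refine ⟨b, hb1, hb2, fun hG _ => ⟨φ, p1, p2, le_trans ?_ p3, fun x => (p4 x).trans_eq (by ring)⟩⟩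
    rw [← hE] at hG ⊢
    have h5 : ε / (4 * Fintype.card F * E) ≤
        ({f ∈ A | f.degree < (E : WithBot ℕ)}.ncard - (Fintype.card F : ℝ) ^ (E / 2)) /
          (Fintype.card F : ℝ) ^ E := by
      rw [le_div_iff₀ (by positivity)]
      linarith
    have h6 : α * χ 0 ^ 2 * (ε / (8 * Fintype.card F)) ≤
        α * (N : ℕ) * χ 0 ^ 2 * (ε / (4 * Fintype.card F * E)) := by
      have h7 : α * (N : ℕ) * χ 0 ^ 2 * (ε / (4 * Fintype.card F * E)) =
          α * χ 0 ^ 2 * (ε / (8 * Fintype.card F)) * (2 * (N : ℕ) / E) := by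
        field_simp; norm_num
      rw [h7]
      exact le_mul_of_one_le_right (by positivity) ((one_le_div hE0).2 hE2)
    exact h6.trans (mul_le_mul_of_nonneg_left h5 (by positivity))
  choose b hb1 hb2 hb3 using hres
  have hw' : Tendsto (fun N : ℕ+ => w N) atTop atTop := hw.comp tendsto_pnat_val
  refine ⟨fun N => w N, fun N => polyPrimorial F (w N), b,
    fun N x => sieveWeight χ (α * (N : ℕ)) (polyPrimorial F (w N)) (b N) (M.rep N x), hw',
    fun N => rfl, fun N => ⟨?_, hb1 N, hb2 N⟩, fun N x => rfl, ?_, ?_⟩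
  · rw [degree_eq_natDegree (polyPrimorial_monic _).ne_zero, Nat.cast_lt]
    exact hdegW N
  · subst hm₀
    exact isPseudorandom_sieveWeight hα0 hαm hA₂ hC₂ M (h₁ M) (h₂ M) hw'
      (fun N => (hwQ N).imp id fun h => ⟨h.1, h.2.1, h.2.2.1, h.2.2.2.1, h.2.2.2.2.1⟩) hb2
  · refine ((frequently_pnat hwG).and_eventually (hw'.eventually_ne_atTop 0)).mono fun N hN => ?_
    exact hb3 N hN.1 hN.2
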